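/- Let $A\in\mathbb R^{m\times m}$, $B\in\mathbb R^{m\times d}$, $C\in\mathbb R^{l\times m}$, $D\in\mathbb R^{m\times n}$, $E\in\mathbb R^{l\times d}$ satisfy $E^\top C=0$ and $R:=E^\top E>0$, and let $\gamma>0$. Put $$\mathcal K=\{K\in\mathbb R^{d\times m}:\ \rho(A-BK)<1,\ \|\mathcal T(K)\|_\infty<\gamma\},\qquad \mathcal T(K)(z)=(C-EK)(zI-A+BK)^{-1}D,$$ where $\|\cdot\|_\infty$ is the supremum over $|z|=1$ of the largest singular value. For symmetric $P$ put $\tilde P=P+PD(\gamma^2I-D^\top PD)^{-1}D^\top P$. A stabilizing solution for $K$ is a matrix $P\ge 0$ with $$(A-BK)^\top\tilde P(A-BK)+C^\top C+K^\top RK-P=0,\qquad I-\gamma^{-2}D^\top PD>0,\qquad \rho\big((I-\gamma^{-2}PDD^\top)^{-\top}(A-BK)\big)<1 .$$ For every $K\in\mathcal K$ there is exactly one stabilizing solution; call it $P_K$, and let $$\mathcal J(K)=-\gamma^2\log\det(I-\gamma^{-2}P_KDD^\top).$$ A global optimum is a minimizer of $\mathcal J$ over $\mathcal K$; a stationary point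 is a $K\in\mathcal K$ at which $\mathcal J$ is differentiable with $\nabla\mathcal J(K)=0$. (a) Assume that $(A,C)$ has no unobservable mode on the unit circle, i.e. $Av=\mu v$, $Cv=0$, $|\mu|=1$ (with $\mu\in\mathbb C$, $v\in\mathbb C^m$) imply $v=0$; this holds in particular if $(A,C)$ is detectable. If a global optimum exists, then there is a global optimum $K^*\in\mathcal K$ with $$K^*=(R+B^\top\tilde P_{K^*}B)^{-1}B^\top\tilde P_{K^*}A ,$$ and $P_{K^*}\le P_K$ in the positive semidefinite order for all $K\in\mathcal K$. (b) If the pair $\big((I-\gamma^{-2}P_KDD^\top)^{-\top}(A-BK),\,D\big)$ is controllable at some stationary point $K$ (no assumption on the modes of $(A,C)$), then $K$ is the only stationary point and the unique global optimum; moreover $K=(R+B^\top\tilde P_KB)^{-1}B^\top\tilde P_KA$, and $P_K\le P_{K'}$ for all $K'\in\mathcal K$. -/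

import Mathlib

open scoped Matrix ENNReal

/-- Data of the discrete-time system `x⁺ = A x + B u + D w`, `z = C x + E u`, with
state `x ∈ ℝᵐ`, control `u ∈ ℝᵈ`, disturbance `w ∈ ℝⁿ`, controlled output `z ∈ ℝˡ`,
together with the robustness level `γ`. A control gain `K` means the feedback `u = -K x`. -/
structure MixedDesign (m d n l : ℕ) where
  A : Matrix (Fin m) (Fin m) ℝ
  B : Matrix (Fin m) (Fin d) ℝ
  C : Matrix (Fin l) (Fin m) ℝ
  D : Matrix (Fin m) (Fin n) ℝ
  E : Matrix (Fin l) (Fin d) ℝ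
  γ : ℝ

/-- A real matrix viewed as a complex one. -/
def toComplex {p q : ℕ} (M : Matrix (Fin p) (Fin q) ℝ) : Matrix (Fin p) (Fin q) ℂ :=
  M.map (fun x : ℝ => (x : ℂ))

/-- `ρ(M) < 1`, the spectral radius being taken over the complex eigenvalues. -/
def IsSchurStable {p : ℕ} (M : Matrix (Fin p) (Fin p) ℝ) : Prop :=
  spectralRadius ℂ (toComplex M) < 1

/-- The transfer function `G(z) = C (z I - A)⁻¹ B` of `x⁺ = A x + B w`, `z = C x`. -/
noncomputable def transferFunction {m n l : ℕ} (A : Matrix (Fin m) (Fin m) ℝ)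
    (B : Matrix (Fin m) (Fin n) ℝ) (C : Matrix (Fin l) (Fin m) ℝ) (z : ℂ) :
    Matrix (Fin l) (Fin n) ℂ :=
  toComplex C * (z • (1 : Matrix (Fin m) (Fin m) ℂ) - toComplex A)⁻¹ * toComplex B

open scoped Matrix.Norms.L2Operator in
/-- The `H∞`-norm: supremum over the unit circle of the largest singular value
(the operator norm for Euclidean norms) of the transfer matrix. -/
noncomputable def hInfNorm {n l : ℕ} (G : ℂ → Matrix (Fin l) (Fin n) ℂ) : ℝ≥0∞ :=
  ⨆ θ ∈ Set.Ico (0 : ℝ) (2 * Real.pi), ‖G (Complex.exp (θ * Complex.I))‖ₑ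

/-- Kalman's rank condition: `[D, F D, …, F^(m-1) D]` has rank `m`. -/
def IsControllablePair {m n : ℕ} (F : Matrix (Fin m) (Fin m) ℝ)
    (D : Matrix (Fin m) (Fin n) ℝ) : Prop :=
  (Matrix.of fun (i : Fin m) (kj : Fin m × Fin n) =>
    (F ^ (kj.1 : ℕ) * D) i kj.2).rank = m

/-- Every eigenvalue of `A` on the unit circle is observable through `C`
(in particular, this holds whenever `(A, C)` is detectable). -/
def NoUnobservableUnitCircleMode {m l : ℕ} (A : Matrix (Fin m) (Fin m) ℝ)
    (C : Matrix (Fin l) (Fin m) ℝ) : Prop :=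
  ∀ (μ : ℂ) (v : Fin m → ℂ), ‖μ‖ = 1 → toComplex A *ᵥ v = μ • v →
    toComplex C *ᵥ v = 0 → v = 0

namespace MixedDesign

variable {m d n l : ℕ} (S : MixedDesign m d n l)

/-- The control weight `R = Eᵀ E`. -/
def R : Matrix (Fin d) (Fin d) ℝ := S.Eᵀ * S.E

/-- The closed-loop matrix `A - B K`. -/
def closedLoop (K : Matrix (Fin d) (Fin m) ℝ) : Matrix (Fin m) (Fin m) ℝ :=
  S.A - S.B * K

/-- The closed-loop transfer function from the disturbance `w` to the output `z`. -/
noncomputable def closedLoopTransfer (K : Matrix (Fin d) (Fin m) ℝ) :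
    ℂ → Matrix (Fin l) (Fin n) ℂ :=
  transferFunction (S.closedLoop K) S.D (S.C - S.E * K)

/-- Without cross weights the output weight of the closed loop is `Cᵀ C + Kᵀ R K`. -/
theorem output_weight (h : S.Eᵀ * S.C = 0) (K : Matrix (Fin d) (Fin m) ℝ) :
    (S.C - S.E * K)ᵀ * (S.C - S.E * K) = S.Cᵀ * S.C + Kᵀ * S.R * K := by
  have h' : S.Cᵀ * S.E = 0 := by
    simpa using congrArg Matrix.transpose h
  simp only [R, Matrix.transpose_sub, Matrix.transpose_mul, Matrix.sub_mul, Matrix.mul_sub]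
  have e1 : S.Cᵀ * (S.E * K) = 0 := by rw [← Matrix.mul_assoc, h', Matrix.zero_mul]
  have e2 : Kᵀ * S.Eᵀ * S.C = 0 := by rw [Matrix.mul_assoc, h, Matrix.mul_zero]
  rw [e1, e2]
  simp [Matrix.mul_assoc]

/-- The feasible set `𝒦 = {K | ρ(A - B K) < 1, ‖T(K)‖_∞ < γ}`. -/
def feasible : Set (Matrix (Fin d) (Fin m) ℝ) :=
  {K | IsSchurStable (S.closedLoop K) ∧
    hInfNorm (S.closedLoopTransfer K) < ENNReal.ofReal S.γ}

/-- `P̃ = P + P D (γ² I - Dᵀ P D)⁻¹ Dᵀ P`. -/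
noncomputable def tilde (P : Matrix (Fin m) (Fin m) ℝ) : Matrix (Fin m) (Fin m) ℝ :=
  P + P * S.D * (S.γ ^ 2 • (1 : Matrix (Fin n) (Fin n) ℝ) - S.Dᵀ * P * S.D)⁻¹ * S.Dᵀ * P

/-- `(I - γ⁻² P D Dᵀ)⁻ᵀ (A - B K)`. -/
noncomputable def worstLoop (K : Matrix (Fin d) (Fin m) ℝ) (P : Matrix (Fin m) (Fin m) ℝ) :
    Matrix (Fin m) (Fin m) ℝ :=
  ((1 - (S.γ ^ 2)⁻¹ • (P * S.D * S.Dᵀ))⁻¹)ᵀ * S.closedLoop K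

/-- `P` is a stabilizing solution of the Riccati equation attached to the gain `K`. -/
structure IsStabilizingSolution (K : Matrix (Fin d) (Fin m) ℝ)
    (P : Matrix (Fin m) (Fin m) ℝ) : Prop where
  posSemidef : P.PosSemidef
  riccati : (S.closedLoop K)ᵀ * S.tilde P * S.closedLoop K
    + S.Cᵀ * S.C + Kᵀ * S.R * K - P = 0
  gap : (1 - (S.γ ^ 2)⁻¹ • (S.Dᵀ * P * S.D)).PosDef
  stable : IsSchurStable (S.worstLoop K P)

open Classical in
/-- `P_K`, the stabilizing solution of the Riccati equation for `K` (the value `0` is used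
for those gains that have no such solution). -/
noncomputable def riccatiSol (K : Matrix (Fin d) (Fin m) ℝ) : Matrix (Fin m) (Fin m) ℝ :=
  if h : ∃ P, S.IsStabilizingSolution K P then h.choose else 0

/-- The objective `J(K) = -γ² log det (I - γ⁻² P_K D Dᵀ)`. -/
noncomputable def cost (K : Matrix (Fin d) (Fin m) ℝ) : ℝ :=
  -S.γ ^ 2 * Real.log (1 - (S.γ ^ 2)⁻¹ • (S.riccatiSol K * S.D * S.Dᵀ)).det

/-- `K` solves `min J(K)` subject to `K ∈ 𝒦`. -/
def IsGlobalOptimum (K : Matrix (Fin d) (Fin m) ℝ) : Prop :=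
  K ∈ S.feasible ∧ ∀ K' ∈ S.feasible, S.cost K ≤ S.cost K'

/-- `K ∈ 𝒦` and `∇J(K) = 0`, i.e. `J` is Fréchet differentiable at `K` with derivative `0`. -/
def IsStationary (K : Matrix (Fin d) (Fin m) ℝ) : Prop :=
  K ∈ S.feasible ∧
    HasFDerivAt S.cost (0 : Matrix (Fin d) (Fin m) ℝ →L[ℝ] ℝ) K

/-- `K = (R + Bᵀ P̃_K B)⁻¹ Bᵀ P̃_K A`. -/
def HasOptimalForm (K : Matrix (Fin d) (Fin m) ℝ) : Prop :=
  K = (S.R + S.Bᵀ * S.tilde (S.riccatiSol K) * S.B)⁻¹ *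
    S.Bᵀ * S.tilde (S.riccatiSol K) * S.A

/-- `P_K ≤ P_{K'}` in the positive semidefinite order for all `K' ∈ 𝒦`. -/
def IsMatrixMinimal (K : Matrix (Fin d) (Fin m) ℝ) : Prop :=
  ∀ K' ∈ S.feasible, (S.riccatiSol K' - S.riccatiSol K).PosSemidef

end MixedDesign

/-! With g = γ², the form P̃ is a one-step worst case: yᵀP̃y is the maximum over w of (y + Dw)ᵀP(y +
Dw) − g|w|², attained at w = `gain` y, and y + Dw = `amp` y. Write F = A − BK, M = `amp` F for the
worst-case loop, E = RK − BᵀP̃F for `residual`, and H = R + BᵀP̃B for `ctrlWeight`.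

Existence of P_K is a bounded real lemma. Parseval for the finite Fourier transform turns the H∞
bound into an energy inequality. It bounds the Riccati iterates from 0, which are finite-horizon
values, and they increase to a solution. Working at a level slightly below γ² leaves the slack that
makes M stable (`exists_stabilizing_of_slack`). Uniqueness holds because two stabilizing solutions
differ by a solution of a homogeneous Stein equation.

For fixed P the Riccati map is quadratic in K, with gradient governed by E and Hessian by H > 0
(`ric_sub_ric`). Along −H⁻¹E the solution drops, after a step s, by at least s (Mₛᵏ)ᵀEᵀH⁻¹E Mₛᵏ for
every k, where Mₛ is the new worst-case loop. The cost sees P only through det(gI − DᵀPD), and its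
decrease controls the trace of the drop of DᵀPD. At a stationary point or a global optimum that drop
is o(s), so E Mᵏ D = 0 for all k (`residual_mul_pow_eq_zero`).

Conversely, freeze the worst disturbance produced by K. Against it, the choice of another gain is a
convex problem with costate P x. If E vanishes along the trajectory issued from X₀, then X₀ᵀ(P_{K'}
− P_K)X₀ ≥ 0 (`saddle`). Taking X₀ = D shows that stationary points are global optima; taking X₀ = I
when E = 0 gives matrix minimality.

In (b), controllability forces E = 0. A second optimum has (P' − P)D = 0, and a Stein equation then
propagates this along the reachable space, where the two gains must coincide. In (a), E need not
vanish off the reachable space, so policy iteration is applied. It does not change the gain on the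
reachable space, hence neither the transfer function nor PD. The P's decrease to a limit whose
optimal gain is the required optimum; the assumption on unit-circle modes preserves stability, both
at each iteration and in the limit. -/

set_option linter.unusedSectionVars false

/-! ### Real positive semidefinite matrices. -/

namespace Matrix

section Real

variable {ι κ : Type*} [Fintype ι] [Fintype κ]

theorem PosSemidef.isSymm {P : Matrix ι ι ℝ} (h : P.PosSemidef) : Pᵀ = P := by
  simpa using h.isHermitian.eq

theorem PosDef.isSymm {P : Matrix ι ι ℝ} (h : P.PosDef) : Pᵀ = P := h.posSemidef.isSymm

theorem PosSemidef.transpose_mul_mul_same {P : Matrix ι ι ℝ} (h : P.PosSemidef)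
    (M : Matrix ι κ ℝ) : (Mᵀ * P * M).PosSemidef := by
  simpa using h.conjTranspose_mul_mul_same M

theorem posSemidef_transpose_mul_self (M : Matrix ι κ ℝ) : (Mᵀ * M).PosSemidef := by
  simpa using posSemidef_conjTranspose_mul_self M

theorem posSemidef_real_iff {P : Matrix ι ι ℝ} :
    P.PosSemidef ↔ Pᵀ = P ∧ ∀ x, 0 ≤ x ⬝ᵥ P *ᵥ x := by
  rw [posSemidef_iff_dotProduct_mulVec]; simp [IsHermitian]

theorem PosSemidef.eq_zero_of_neg {P : Matrix ι ι ℝ} (h : P.PosSemidef) (h' : (-P).PosSemidef) :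
    P = 0 := by
  rw [← h.trace_eq_zero_iff]
  have := h.trace_nonneg
  have := h'.trace_nonneg
  rw [trace_neg] at this
  linarith

theorem PosSemidef.mul_eq_zero_of_transpose_mul_mul {P : Matrix ι ι ℝ} (h : P.PosSemidef)
    {M : Matrix ι κ ℝ} (hM : Mᵀ * P * M = 0) : P * M = 0 := by
  classical
  ext i j
  have h1 : M.col j ⬝ᵥ P *ᵥ M.col j = 0 := by
    have := congrFun (congrFun hM j) j
    rw [Matrix.mul_assoc] at this
    simpa [Matrix.mul_apply, dotProduct, mulVec, col] using this
  have h2 := (h.dotProduct_mulVec_zero_iff (M.col j)).1 (by simpa using h1)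
  simpa [Matrix.mul_apply, dotProduct, mulVec, col] using congrFun h2 i

theorem dotProduct_mulVec_eq_replicateCol (Q : Matrix ι ι ℝ) (v : ι → ℝ) :
    v ⬝ᵥ Q *ᵥ v = ((replicateCol Unit v)ᵀ * Q * replicateCol Unit v) () () := by
  rw [Matrix.mul_assoc, ← replicateCol_mulVec]
  simp [Matrix.mul_apply, dotProduct]

end Real

end Matrix

/-! ### Algebra of the one-step maximization over the disturbance. -/

namespace GameRiccati

variable {m n p : Type*} [Fintype m] [DecidableEq m] [Fintype n] [DecidableEq n]

/-- `g I - Dᵀ P D`. -/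
noncomputable def gap (D : Matrix m n ℝ) (g : ℝ) (P : Matrix m m ℝ) : Matrix n n ℝ :=
  g • 1 - Dᵀ * P * D

/-- `P + P D (g I - Dᵀ P D)⁻¹ Dᵀ P`. -/
noncomputable def tilde (D : Matrix m n ℝ) (g : ℝ) (P : Matrix m m ℝ) : Matrix m m ℝ :=
  P + P * D * (gap D g P)⁻¹ * Dᵀ * P

/-- The gain `(g I - Dᵀ P D)⁻¹ Dᵀ P` of the worst disturbance. -/
noncomputable def gain (D : Matrix m n ℝ) (g : ℝ) (P : Matrix m m ℝ) : Matrix n m ℝ :=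
  (gap D g P)⁻¹ * Dᵀ * P

/-- `1 + D (g I - Dᵀ P D)⁻¹ Dᵀ P`. -/
noncomputable def amp (D : Matrix m n ℝ) (g : ℝ) (P : Matrix m m ℝ) : Matrix m m ℝ :=
  1 + D * gain D g P

variable {D : Matrix m n ℝ} {g : ℝ} {P P' : Matrix m m ℝ}

theorem gap_isSymm (hP : Pᵀ = P) : (gap D g P)ᵀ = gap D g P := by
  simp [gap, hP, Matrix.mul_assoc]

theorem gap_inv_isSymm (hP : Pᵀ = P) : ((gap D g P)⁻¹)ᵀ = (gap D g P)⁻¹ := by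
  rw [Matrix.transpose_nonsing_inv, gap_isSymm hP]

theorem tilde_isSymm (hP : Pᵀ = P) : (tilde D g P)ᵀ = tilde D g P := by
  simp [tilde, hP, gap_inv_isSymm hP, Matrix.mul_assoc]

theorem amp_transpose (hP : Pᵀ = P) :
    (amp D g P)ᵀ = 1 + P * D * (gap D g P)⁻¹ * Dᵀ := by
  simp [amp, gain, hP, gap_inv_isSymm hP, Matrix.mul_assoc]

/-- The resolvent identity for the inverses of the two gaps, whose difference is Dᵀ(P' − P)D. All
difference formulas for `tilde` and `amp` come from it. -/
theorem gap_key (h : IsUnit (gap D g P).det) (h' : IsUnit (gap D g P').det) :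
    (gap D g P)⁻¹ * Dᵀ * (P - P') * D * (gap D g P')⁻¹ = (gap D g P)⁻¹ - (gap D g P')⁻¹ := by
  have e : Dᵀ * (P - P') * D = gap D g P' - gap D g P := by
    simp [gap, Matrix.mul_sub, Matrix.sub_mul]
  calc _ = (gap D g P)⁻¹ * (Dᵀ * (P - P') * D) * (gap D g P')⁻¹ := by simp [Matrix.mul_assoc]
    _ = _ := by
      rw [e, Matrix.mul_sub, Matrix.nonsing_inv_mul _ h, Matrix.sub_mul, Matrix.mul_assoc,
        Matrix.mul_nonsing_inv _ h']
      simp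

theorem gap_key' (h : IsUnit (gap D g P).det) (h' : IsUnit (gap D g P').det)
    (Z : Matrix n p ℝ) :
    (gap D g P)⁻¹ * (Dᵀ * (P * (D * ((gap D g P')⁻¹ * Z)))) =
      (gap D g P)⁻¹ * (Dᵀ * (P' * (D * ((gap D g P')⁻¹ * Z))))
        + (gap D g P)⁻¹ * Z - (gap D g P')⁻¹ * Z := by
  have := congrArg (· * Z) (gap_key h h')
  simp only [Matrix.mul_assoc, Matrix.sub_mul, Matrix.mul_sub] at this
  rw [add_sub_assoc, ← this]; abel

/-- The mixed factorization, with one `amp` on each side, makes the difference of two Riccati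
solutions solve a homogeneous Stein equation governed by both worst-case loops. -/
theorem tilde_sub_tilde (hP : Pᵀ = P) (h : IsUnit (gap D g P).det)
    (h' : IsUnit (gap D g P').det) :
    tilde D g P - tilde D g P' = (amp D g P)ᵀ * (P - P') * amp D g P' := by
  rw [amp_transpose hP]
  simp only [tilde, amp, gain, Matrix.mul_add, Matrix.add_mul, Matrix.mul_sub, Matrix.sub_mul,
    Matrix.mul_assoc, Matrix.one_mul, Matrix.mul_one]
  rw [gap_key' h h']
  simp only [Matrix.mul_add, Matrix.mul_sub]
  abel

theorem amp_eq (h : IsUnit (gap D g P).det) (h' : IsUnit (gap D g P').det) :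
    amp D g P = (1 + D * (gap D g P)⁻¹ * Dᵀ * (P - P')) * amp D g P' := by
  simp only [amp, gain, Matrix.mul_add, Matrix.add_mul, Matrix.mul_sub, Matrix.sub_mul,
    Matrix.mul_assoc, Matrix.one_mul, Matrix.mul_one]
  rw [gap_key' h h']
  simp only [Matrix.mul_add, Matrix.mul_sub]
  abel

/-- Expressing both outer factors through P' isolates a quadratic remainder, which has a sign once
the gap of P is positive. This yields one-sided comparisons. -/
theorem tilde_sub_tilde' (hP : Pᵀ = P) (hP' : P'ᵀ = P') (h : IsUnit (gap D g P).det)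
    (h' : IsUnit (gap D g P').det) :
    tilde D g P - tilde D g P' = (amp D g P')ᵀ *
      ((P - P') + (D ᵀ * (P - P'))ᵀ * (gap D g P)⁻¹ * (Dᵀ * (P - P'))) * amp D g P' := by
  rw [tilde_sub_tilde hP h h', amp_eq h h']
  simp only [Matrix.transpose_mul, Matrix.transpose_add, Matrix.transpose_sub, hP, hP',
    Matrix.transpose_transpose, Matrix.transpose_one, gap_inv_isSymm hP]
  simp only [Matrix.mul_add, Matrix.add_mul, Matrix.mul_sub, Matrix.sub_mul,
    Matrix.mul_assoc, Matrix.mul_one]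
  abel

theorem gap_posDef_of_le (h : (gap D g P).PosDef) (hle : (P - P').PosSemidef) :
    (gap D g P').PosDef := by
  have : gap D g P' = gap D g P + Dᵀ * (P - P') * D := by
    simp [gap, Matrix.mul_sub, Matrix.sub_mul]
  rw [this]
  exact h.add_posSemidef (hle.transpose_mul_mul_same D)

theorem gap_isUnit (h : (gap D g P).PosDef) : IsUnit (gap D g P).det :=
  (Matrix.isUnit_iff_isUnit_det _).1 h.isUnit

/-- Lower bound for the increment of `tilde`. -/
theorem tilde_sub_tilde_ge (hP : Pᵀ = P) (hP' : P'ᵀ = P') (h : (gap D g P).PosDef)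
    (h' : IsUnit (gap D g P').det) :
    (tilde D g P - tilde D g P' - (amp D g P')ᵀ * (P - P') * amp D g P').PosSemidef := by
  rw [tilde_sub_tilde' hP hP' (gap_isUnit h) h', Matrix.mul_add, Matrix.add_mul, add_sub_cancel_left]
  exact (h.inv.posSemidef.transpose_mul_mul_same _).transpose_mul_mul_same _

theorem tilde_mono (hP : Pᵀ = P) (hP' : P'ᵀ = P') (h : (gap D g P).PosDef)
    (hle : (P - P').PosSemidef) : (tilde D g P - tilde D g P').PosSemidef := by
  have := (tilde_sub_tilde_ge hP hP' h (gap_isUnit (gap_posDef_of_le h hle))).add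
    (hle.transpose_mul_mul_same (amp D g P'))
  simpa using this

theorem tilde_sub_self (h : (gap D g P).PosDef) (hP : Pᵀ = P) :
    (tilde D g P - P).PosSemidef := by
  have : tilde D g P - P = (Dᵀ * P)ᵀ * (gap D g P)⁻¹ * (Dᵀ * P) := by
    simp [tilde, hP, Matrix.mul_assoc]
  rw [this]
  exact h.inv.posSemidef.transpose_mul_mul_same _

theorem tilde_posSemidef (h : (gap D g P).PosDef) (hP : P.PosSemidef) :
    (tilde D g P).PosSemidef := by
  simpa using (tilde_sub_self h hP.isSymm).add hP

/-- Completion of the square in the disturbance. -/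
theorem complete_square (hP : Pᵀ = P) (h : IsUnit (gap D g P).det) (G : Matrix m p ℝ)
    (L : Matrix n p ℝ) :
    (G + D * L)ᵀ * P * (G + D * L) - g • (Lᵀ * L) = Gᵀ * tilde D g P * G
      - (L - gain D g P * G)ᵀ * gap D g P * (L - gain D g P * G) := by
  have e1 : (gap D g P)⁻¹ * gap D g P = 1 := Matrix.nonsing_inv_mul _ h
  have e2 : ∀ Z : Matrix n p ℝ, gap D g P * ((gap D g P)⁻¹ * Z) = Z := fun Z => by
    rw [← Matrix.mul_assoc, Matrix.mul_nonsing_inv _ h, Matrix.one_mul]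
  have e3 : ∀ Z : Matrix n p ℝ, (gap D g P)⁻¹ * (gap D g P * Z) = Z := fun Z => by
    rw [← Matrix.mul_assoc, e1, Matrix.one_mul]
  have e4 : gap D g P * L = g • L - Dᵀ * (P * (D * L)) := by
    simp [gap, Matrix.sub_mul, Matrix.mul_assoc]
  simp only [tilde, gain, Matrix.transpose_mul, Matrix.transpose_add, Matrix.transpose_sub, hP,
    Matrix.transpose_transpose, gap_inv_isSymm hP]
  simp only [Matrix.mul_add, Matrix.add_mul, Matrix.mul_sub, Matrix.sub_mul,
    Matrix.mul_assoc, e2, e3]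
  rw [e4]
  simp only [Matrix.mul_sub, Matrix.mul_smul]
  abel

theorem complete_square_gain (hP : Pᵀ = P) (h : IsUnit (gap D g P).det) (G : Matrix m p ℝ) :
    (amp D g P * G)ᵀ * P * (amp D g P * G) - g • ((gain D g P * G)ᵀ * (gain D g P * G)) =
      Gᵀ * tilde D g P * G := by
  have := complete_square hP h G (gain D g P * G)
  simp only [sub_self, Matrix.transpose_zero, Matrix.zero_mul, sub_zero] at this
  rw [← this, amp, Matrix.add_mul, Matrix.one_mul, Matrix.mul_assoc D]

theorem complete_square_vec (hP : Pᵀ = P) (h : IsUnit (gap D g P).det) (y : m → ℝ) (w : n → ℝ) :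
    (y + D *ᵥ w) ⬝ᵥ P *ᵥ (y + D *ᵥ w) - g * (w ⬝ᵥ w) = y ⬝ᵥ tilde D g P *ᵥ y
      - (w - gain D g P *ᵥ y) ⬝ᵥ gap D g P *ᵥ (w - gain D g P *ᵥ y) := by
  have e1 : Matrix.replicateCol Unit (y + D *ᵥ w) =
      Matrix.replicateCol Unit y + D * Matrix.replicateCol Unit w := by
    rw [← Matrix.replicateCol_mulVec, ← Matrix.replicateCol_add]
  have e2 : Matrix.replicateCol Unit (w - gain D g P *ᵥ y) =
      Matrix.replicateCol Unit w - gain D g P * Matrix.replicateCol Unit y := by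
    rw [← Matrix.replicateCol_mulVec]; ext; simp
  have e3 : w ⬝ᵥ w = ((Matrix.replicateCol Unit w)ᵀ * Matrix.replicateCol Unit w) () () := by
    simp [Matrix.mul_apply, dotProduct]
  have := congrFun (congrFun (complete_square hP h (Matrix.replicateCol Unit y)
    (Matrix.replicateCol Unit w)) ()) ()
  rw [Matrix.dotProduct_mulVec_eq_replicateCol, Matrix.dotProduct_mulVec_eq_replicateCol,
    Matrix.dotProduct_mulVec_eq_replicateCol, e1, e2, e3]
  simpa only [Matrix.sub_apply, Matrix.smul_apply, smul_eq_mul] using this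

/-- `amp` inverts `1 - g⁻¹ D Dᵀ P`. -/
theorem inv_one_sub (hg : g ≠ 0) (h : IsUnit (gap D g P).det) :
    (1 - g⁻¹ • (P * D * Dᵀ))⁻¹ = 1 + P * D * (gap D g P)⁻¹ * Dᵀ := by
  apply Matrix.inv_eq_right_inv
  have e : Dᵀ * (P * D) = g • 1 - gap D g P := by simp [gap, Matrix.mul_assoc]
  have e' : ∀ Z : Matrix n m ℝ, Dᵀ * (P * (D * Z)) = g • Z - gap D g P * Z := fun Z => by
    rw [← Matrix.mul_assoc P, ← Matrix.mul_assoc Dᵀ, e, Matrix.sub_mul]; simp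
  have e2 : ∀ Z : Matrix n m ℝ, gap D g P * ((gap D g P)⁻¹ * Z) = Z := fun Z => by
    rw [← Matrix.mul_assoc, Matrix.mul_nonsing_inv _ h, Matrix.one_mul]
  simp only [Matrix.mul_add, Matrix.sub_mul, Matrix.mul_assoc, Matrix.mul_one, Matrix.one_mul,
    Matrix.smul_mul, e', e2]
  simp only [Matrix.mul_sub, Matrix.mul_smul, smul_sub, smul_smul, inv_mul_cancel₀ hg, one_smul]
  abel

theorem det_one_sub (hg : g ≠ 0) :
    (1 - g⁻¹ • (P * D * Dᵀ)).det = (g⁻¹ • gap D g P).det := by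
  have : g⁻¹ • (P * D * Dᵀ) = (g⁻¹ • (P * D)) * Dᵀ := by simp
  rw [this, Matrix.det_one_sub_mul_comm]
  congr 1
  simp [gap, smul_sub, smul_smul, inv_mul_cancel₀ hg, Matrix.mul_assoc]

end GameRiccati

/-! ### Real matrices acting on complex eigenvectors. -/

section Complexification

variable {p q r : ℕ}

theorem toComplex_mul (M : Matrix (Fin p) (Fin q) ℝ) (N : Matrix (Fin q) (Fin r) ℝ) :
    toComplex (M * N) = toComplex M * toComplex N :=
  Matrix.map_mul (f := Complex.ofRealHom)

theorem toComplex_sub (M N : Matrix (Fin p) (Fin q) ℝ) :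
    toComplex (M - N) = toComplex M - toComplex N := by
  ext; simp [toComplex]

theorem toComplex_add (M N : Matrix (Fin p) (Fin q) ℝ) :
    toComplex (M + N) = toComplex M + toComplex N := by
  ext; simp [toComplex]

theorem toComplex_zero : toComplex (0 : Matrix (Fin p) (Fin q) ℝ) = 0 := by
  ext; simp [toComplex]

theorem toComplex_one : toComplex (1 : Matrix (Fin p) (Fin p) ℝ) = 1 := by
  ext i j; by_cases h : i = j <;> simp [toComplex, Matrix.one_apply, h]

theorem toComplex_pow (M : Matrix (Fin p) (Fin p) ℝ) (k : ℕ) :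
    toComplex (M ^ k) = toComplex M ^ k := by
  induction k with
  | zero => simp [toComplex_one]
  | succ k ih => rw [pow_succ, pow_succ, toComplex_mul, ih]

theorem continuous_toComplex :
    Continuous (toComplex : Matrix (Fin p) (Fin q) ℝ → Matrix (Fin p) (Fin q) ℂ) :=
  continuous_id.matrix_map Complex.continuous_ofReal

theorem toComplex_mulVec_re (M : Matrix (Fin p) (Fin q) ℝ) (v : Fin q → ℂ) :
    (fun i => ((toComplex M *ᵥ v) i).re) = M *ᵥ (fun i => (v i).re) := by
  ext i; simp [toComplex, Matrix.mulVec, dotProduct]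

theorem toComplex_mulVec_im (M : Matrix (Fin p) (Fin q) ℝ) (v : Fin q → ℂ) :
    (fun i => ((toComplex M *ᵥ v) i).im) = M *ᵥ (fun i => (v i).im) := by
  ext i; simp [toComplex, Matrix.mulVec, dotProduct]

/-- The hermitian form `v* P v` of a real symmetric matrix `P` on complex vectors. -/
noncomputable def hermForm (P : Matrix (Fin p) (Fin p) ℝ) (v : Fin p → ℂ) : ℝ :=
  (fun i => (v i).re) ⬝ᵥ P *ᵥ (fun i => (v i).re) + (fun i => (v i).im) ⬝ᵥ P *ᵥ (fun i => (v i).im)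

theorem hermForm_nonneg {P : Matrix (Fin p) (Fin p) ℝ} (hP : P.PosSemidef) (v : Fin p → ℂ) :
    0 ≤ hermForm P v :=
  add_nonneg ((Matrix.posSemidef_real_iff.1 hP).2 _) ((Matrix.posSemidef_real_iff.1 hP).2 _)

theorem hermForm_add (P Q : Matrix (Fin p) (Fin p) ℝ) (v : Fin p → ℂ) :
    hermForm (P + Q) v = hermForm P v + hermForm Q v := by
  simp [hermForm, Matrix.add_mulVec]; ring

theorem hermForm_sub (P Q : Matrix (Fin p) (Fin p) ℝ) (v : Fin p → ℂ) :
    hermForm (P - Q) v = hermForm P v - hermForm Q v := by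
  simp [hermForm, Matrix.sub_mulVec]; ring

theorem hermForm_smul (c : ℝ) (P : Matrix (Fin p) (Fin p) ℝ) (v : Fin p → ℂ) :
    hermForm (c • P) v = c * hermForm P v := by
  simp [hermForm, Matrix.smul_mulVec]; ring

theorem dotProduct_conj_mulVec (P : Matrix (Fin p) (Fin p) ℝ) (M : Matrix (Fin p) (Fin q) ℝ)
    (x : Fin q → ℝ) : x ⬝ᵥ (Mᵀ * P * M) *ᵥ x = (M *ᵥ x) ⬝ᵥ P *ᵥ (M *ᵥ x) := by
  rw [Matrix.mul_assoc, ← Matrix.mulVec_mulVec, Matrix.dotProduct_mulVec,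
    Matrix.vecMul_transpose, Matrix.mulVec_mulVec]

theorem hermForm_conj (P : Matrix (Fin p) (Fin p) ℝ) (M : Matrix (Fin p) (Fin q) ℝ)
    (v : Fin q → ℂ) : hermForm (Mᵀ * P * M) v = hermForm P (toComplex M *ᵥ v) := by
  simp only [hermForm, toComplex_mulVec_re, toComplex_mulVec_im, dotProduct_conj_mulVec]

theorem hermForm_smul_vec (P : Matrix (Fin p) (Fin p) ℝ) (μ : ℂ) (v : Fin p → ℂ) :
    hermForm P (μ • v) = ‖μ‖ ^ 2 * hermForm P v := by
  have e1 : (fun i => ((μ • v) i).re) = μ.re • (fun i => (v i).re) - μ.im • (fun i => (v i).im) := by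
    ext; simp
  have e2 : (fun i => ((μ • v) i).im) = μ.re • (fun i => (v i).im) + μ.im • (fun i => (v i).re) := by
    ext; simp
  rw [hermForm, hermForm, e1, e2, ← Complex.normSq_eq_norm_sq, Complex.normSq_apply]
  simp only [Matrix.mulVec_sub, Matrix.mulVec_add, Matrix.mulVec_smul, sub_dotProduct,
    add_dotProduct, dotProduct_sub, dotProduct_add, smul_dotProduct, dotProduct_smul, smul_eq_mul]
  ring

theorem eq_zero_of_hermForm_eq_zero {P : Matrix (Fin p) (Fin p) ℝ} (hP : P.PosSemidef)
    {v : Fin p → ℂ} (hv : hermForm P v = 0) : toComplex P *ᵥ v = 0 := by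
  have h1 := (Matrix.posSemidef_real_iff.1 hP).2 (fun i => (v i).re)
  have h2 := (Matrix.posSemidef_real_iff.1 hP).2 (fun i => (v i).im)
  unfold hermForm at hv
  have h3 := (hP.dotProduct_mulVec_zero_iff (fun i => (v i).re)).1 (by
    simp only [star_trivial]; linarith)
  have h4 := (hP.dotProduct_mulVec_zero_iff (fun i => (v i).im)).1 (by
    simp only [star_trivial]; linarith)
  rw [← toComplex_mulVec_re] at h3
  rw [← toComplex_mulVec_im] at h4
  funext i
  exact Complex.ext (congrFun h3 i) (congrFun h4 i)

theorem toComplex_mulVec_eq_zero_of_gram {M : Matrix (Fin q) (Fin p) ℝ} {v : Fin p → ℂ}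
    (hv : hermForm (Mᵀ * M) v = 0) : toComplex M *ᵥ v = 0 := by
  have := hermForm_conj 1 M v
  rw [Matrix.mul_one, hv] at this
  simpa [toComplex_one] using eq_zero_of_hermForm_eq_zero Matrix.PosSemidef.one this.symm

end Complexification

open Filter Topology

/-! ### Schur stability, Stein equations and openness. -/

section Stability

variable {p : ℕ}

theorem mem_spectrum_iff_exists_mulVec (M : Matrix (Fin p) (Fin p) ℂ) (μ : ℂ) :
    μ ∈ spectrum ℂ M ↔ ∃ v, v ≠ 0 ∧ M *ᵥ v = μ • v := by
  rw [spectrum.mem_iff, Matrix.isUnit_iff_isUnit_det, isUnit_iff_ne_zero, not_not,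
    ← Matrix.exists_mulVec_eq_zero_iff]
  refine exists_congr fun v => and_congr_right fun _ => ?_
  rw [Matrix.sub_mulVec, sub_eq_zero, eq_comm, Algebra.algebraMap_eq_smul_one, Matrix.smul_mulVec,
    Matrix.one_mulVec]

section
attribute [local instance] Matrix.linftyOpNormedRing Matrix.linftyOpNormedAlgebra

theorem isSchurStable_iff (M : Matrix (Fin p) (Fin p) ℝ) : IsSchurStable M ↔
    ∀ (μ : ℂ) (v : Fin p → ℂ), v ≠ 0 → toComplex M *ᵥ v = μ • v → ‖μ‖ < 1 := by
  have key : IsSchurStable M ↔ ∀ μ ∈ spectrum ℂ (toComplex M), ‖μ‖ < 1 := by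
    unfold IsSchurStable
    constructor
    · intro h μ hμ
      have h1 : (‖μ‖₊ : ℝ≥0∞) ≤ spectralRadius ℂ (toComplex M) :=
        le_iSup₂ (f := fun k (_ : k ∈ spectrum ℂ (toComplex M)) => (‖k‖₊ : ℝ≥0∞)) μ hμ
      have h2 := h1.trans_lt h
      exact_mod_cast h2
    · intro h
      -- The spectrum is empty when p = 0; the spectral radius is then 0.
      rcases (spectrum ℂ (toComplex M)).eq_empty_or_nonempty with h0 | h0
      · simp [spectralRadius, h0]
      · have : CompleteSpace (Matrix (Fin p) (Fin p) ℂ) := FiniteDimensional.complete ℂ _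
        have := spectrum.spectralRadius_lt_of_forall_lt_of_nonempty h0 (r := 1)
          (fun k hk => by exact_mod_cast h k hk)
        simpa using this
  rw [key]
  simp only [mem_spectrum_iff_exists_mulVec]
  exact ⟨fun h μ v hv e => h μ ⟨v, hv, e⟩, fun h μ ⟨v, hv, e⟩ => h μ v hv e⟩

/-- Gelfand's formula: any r strictly between the spectral radius and 1 eventually dominates the
k-th root of the norm of the k-th power. -/
theorem IsSchurStable.exists_pow_bound {M : Matrix (Fin p) (Fin p) ℝ} (h : IsSchurStable M) :
    ∃ c r : ℝ, 0 ≤ c ∧ 0 < r ∧ r < 1 ∧ ∀ k i j, |(M ^ k) i j| ≤ c * r ^ k := by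
  have : CompleteSpace (Matrix (Fin p) (Fin p) ℂ) := FiniteDimensional.complete ℂ _
  obtain ⟨r, hr, hr1⟩ := ENNReal.lt_iff_exists_nnreal_btwn.1 h
  have hr0 : 0 < r := by
    rcases eq_or_lt_of_le (zero_le (a := r)) with h0 | h0
    · rw [← h0] at hr; simp at hr
    · exact h0
  have hev := (spectrum.pow_nnnorm_pow_one_div_tendsto_nhds_spectralRadius
    (toComplex M)).eventually_lt_const hr
  have hO : (fun k => ‖toComplex M ^ k‖) =O[atTop] fun k => (r : ℝ) ^ k := by
    refine Asymptotics.IsBigO.of_bound 1 ?_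
    filter_upwards [hev, eventually_gt_atTop 0] with k hk hk0
    have h1 : (‖toComplex M ^ k‖₊ : ℝ≥0∞) < (r : ℝ≥0∞) ^ k := by
      have hk' : (0 : ℝ) < k := by exact_mod_cast hk0
      have := ENNReal.rpow_lt_rpow hk hk'
      rwa [← ENNReal.rpow_mul, one_div, inv_mul_cancel₀ hk'.ne', ENNReal.rpow_one,
        ENNReal.rpow_natCast] at this
    have h2 : ‖toComplex M ^ k‖₊ < r ^ k := by exact_mod_cast h1
    have h3 : ‖toComplex M ^ k‖ < (r : ℝ) ^ k := by exact_mod_cast h2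
    simpa using h3.le
  obtain ⟨c, hc0, hc⟩ := Asymptotics.bound_of_isBigO_nat_atTop hO
  have hr0' : (0 : ℝ) < r := by exact_mod_cast hr0
  refine ⟨c, r, hc0.le, hr0', by exact_mod_cast hr1, fun k i j => ?_⟩
  have h1 := hc (x := k) (pow_ne_zero _ hr0'.ne')
  rw [norm_norm, Real.norm_of_nonneg (pow_nonneg hr0'.le k)] at h1
  refine le_trans ?_ h1
  rw [← toComplex_pow]
  have h2 : ‖toComplex (M ^ k) i j‖ ≤ ‖toComplex (M ^ k)‖ := by
    rw [← coe_nnnorm, ← coe_nnnorm, NNReal.coe_le_coe, Matrix.linfty_opNNNorm_def]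
    refine le_trans ?_ (Finset.le_sup (Finset.mem_univ i))
    exact Finset.single_le_sum (f := fun j => ‖toComplex (M ^ k) i j‖₊) (fun _ _ => zero_le)
      (Finset.mem_univ j)
  simpa [toComplex] using h2

end

theorem IsSchurStable.tendsto_pow {M : Matrix (Fin p) (Fin p) ℝ} (h : IsSchurStable M) :
    Tendsto (fun k => M ^ k) atTop (𝓝 0) := by
  obtain ⟨c, r, -, hr0, hr1, hb⟩ := h.exists_pow_bound
  refine tendsto_pi_nhds.2 fun i => tendsto_pi_nhds.2 fun j => ?_
  refine squeeze_zero_norm (fun k => hb k i j) ?_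
  simpa using (tendsto_pow_atTop_nhds_zero_of_lt_one hr0.le hr1).const_mul c

theorem Matrix.isClosed_posSemidef {ι : Type*} [Fintype ι] :
    IsClosed {P : Matrix ι ι ℝ | P.PosSemidef} := by
  simp only [Matrix.posSemidef_real_iff, Set.ofPred_and, Set.ofPred_forall]
  refine (isClosed_eq continuous_id.matrix_transpose continuous_id).inter
    (isClosed_iInter fun x => isClosed_le continuous_const ?_)
  exact continuous_const.dotProduct (continuous_id.matrix_mulVec continuous_const)

/-- Iterating gives Y ≥ (Mᵏ)ᵀ Y Mᵏ, and the right-hand side tends to 0. -/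
theorem posSemidef_of_stein {M Y : Matrix (Fin p) (Fin p) ℝ} (h : IsSchurStable M)
    (hY : (Y - Mᵀ * Y * M).PosSemidef) : Y.PosSemidef := by
  have hk : ∀ k : ℕ, (Y - (M ^ k)ᵀ * Y * M ^ k).PosSemidef := by
    intro k
    induction k with
    | zero => simpa using Matrix.PosSemidef.zero
    | succ k ih =>
      have := hY.add (ih.transpose_mul_mul_same M)
      convert this using 1
      simp only [pow_succ, Matrix.transpose_mul, Matrix.mul_sub, Matrix.sub_mul, Matrix.mul_assoc]
      abel
  have hlim : Tendsto (fun k : ℕ => Y - (M ^ k)ᵀ * Y * M ^ k) atTop (𝓝 Y) := by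
    have hc : Continuous fun N : Matrix (Fin p) (Fin p) ℝ => Y - Nᵀ * Y * N := by fun_prop
    have := (hc.tendsto 0).comp h.tendsto_pow
    simpa only [Function.comp_def, Matrix.transpose_zero, Matrix.zero_mul, sub_zero] using this
  exact Matrix.isClosed_posSemidef.mem_of_tendsto hlim (Eventually.of_forall hk)

theorem eq_zero_of_stein {M N Y : Matrix (Fin p) (Fin p) ℝ} (hM : IsSchurStable M)
    (hN : IsSchurStable N) (hY : Y = Mᵀ * Y * N) : Y = 0 := by
  have hk : ∀ k : ℕ, Y = (M ^ k)ᵀ * Y * N ^ k := by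
    intro k
    induction k with
    | zero => simp
    | succ k ih =>
      calc Y = Mᵀ * ((M ^ k)ᵀ * Y * N ^ k) * N := by rw [← ih]; exact hY
        _ = _ := by simp only [pow_succ, Matrix.transpose_mul, Matrix.mul_assoc]
  have hlim : Tendsto (fun k : ℕ => (M ^ k)ᵀ * Y * N ^ k) atTop (𝓝 0) := by
    have hc : Continuous fun Z : Matrix (Fin p) (Fin p) ℝ × Matrix (Fin p) (Fin p) ℝ =>
      Z.1ᵀ * Y * Z.2 := by fun_prop
    have := (hc.tendsto (0, 0)).comp (hM.tendsto_pow.prodMk_nhds hN.tendsto_pow)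
    simpa only [Function.comp_def, Matrix.transpose_zero, Matrix.zero_mul] using this
  refine tendsto_nhds_unique ?_ hlim
  simp only [← hk]; exact tendsto_const_nhds

/-- The determinant is the product of the factors μ − a over the eigenvalues a, each of modulus
below 1. The bound does not depend on M, so it survives limits of stable matrices. -/
theorem IsSchurStable.norm_det_ge {M : Matrix (Fin p) (Fin p) ℝ} (h : IsSchurStable M) {μ : ℂ}
    (hμ : 1 ≤ ‖μ‖) : (‖μ‖ - 1) ^ p ≤ ‖(μ • (1 : Matrix (Fin p) (Fin p) ℂ) - toComplex M).det‖ := by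
  set f := (toComplex M).charpoly with hf
  have hev : (μ • (1 : Matrix (Fin p) (Fin p) ℂ) - toComplex M).det = f.eval μ := by
    rw [hf, Matrix.eval_charpoly]; congr 1; ext i j; simp [Matrix.scalar_apply, Matrix.one_apply,
      Matrix.diagonal_apply]
  have hsp := IsAlgClosed.splits f
  have hcard : Multiset.card f.roots = p := by
    rw [← hsp.natDegree_eq_card_roots, hf, Matrix.charpoly_natDegree_eq_dim, Fintype.card_fin]
  have hprod : f.eval μ = (f.roots.map fun a => μ - a).prod := by
    conv_lhs => rw [hsp.eq_prod_roots_of_monic (Matrix.charpoly_monic _)]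
    simp [Polynomial.eval_multiset_prod]
  have hroot : ∀ a ∈ f.roots, ‖a‖ < 1 := by
    intro a ha
    have : a ∈ spectrum ℂ (toComplex M) :=
      Matrix.mem_spectrum_of_isRoot_charpoly (Polynomial.isRoot_of_mem_roots ha)
    obtain ⟨v, hv, e⟩ := (mem_spectrum_iff_exists_mulVec _ _).1 this
    exact (isSchurStable_iff M).1 h a v hv e
  rw [hev, hprod, ← hcard]
  generalize f.roots = s at hroot
  induction s using Multiset.induction_on with
  | empty => simp
  | cons a s ih =>
    simp only [Multiset.card_cons, Multiset.map_cons, Multiset.prod_cons, norm_mul, pow_succ']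
    refine mul_le_mul ?_ (ih fun b hb => hroot b (Multiset.mem_cons_of_mem hb)) (by
      apply pow_nonneg; linarith) (norm_nonneg _)
    have := norm_sub_norm_le μ a
    have := hroot a (Multiset.mem_cons_self a s)
    linarith

theorem norm_le_one_of_tendsto {M : ℕ → Matrix (Fin p) (Fin p) ℝ} {N : Matrix (Fin p) (Fin p) ℝ}
    (hM : ∀ k, IsSchurStable (M k)) (hlim : Tendsto M atTop (𝓝 N)) {μ : ℂ} {v : Fin p → ℂ}
    (hv : v ≠ 0) (he : toComplex N *ᵥ v = μ • v) : ‖μ‖ ≤ 1 := by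
  by_contra! hμ
  have hc : Continuous fun Z : Matrix (Fin p) (Fin p) ℝ =>
      ‖(μ • (1 : Matrix (Fin p) (Fin p) ℂ) - toComplex Z).det‖ :=
    (continuous_const.sub continuous_toComplex).matrix_det.norm
  have h1 : (‖μ‖ - 1) ^ p ≤ ‖(μ • (1 : Matrix (Fin p) (Fin p) ℂ) - toComplex N).det‖ :=
    ge_of_tendsto ((hc.tendsto N).comp hlim)
      (Eventually.of_forall fun k => (hM k).norm_det_ge hμ.le)
  have h2 : (μ • (1 : Matrix (Fin p) (Fin p) ℂ) - toComplex N).det = 0 := by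
    rw [← Matrix.exists_mulVec_eq_zero_iff]
    exact ⟨v, hv, by simp [Matrix.sub_mulVec, Matrix.smul_mulVec, he]⟩
  rw [h2, norm_zero] at h1
  have : 0 < (‖μ‖ - 1) ^ p := pow_pos (by linarith) _
  linarith

theorem IsSchurStable.isUnit_det {M : Matrix (Fin p) (Fin p) ℝ} (h : IsSchurStable M) {z : ℂ}
    (hz : 1 ≤ ‖z‖) : IsUnit (z • (1 : Matrix (Fin p) (Fin p) ℂ) - toComplex M).det := by
  rw [isUnit_iff_ne_zero]
  intro h0
  obtain ⟨v, hv, e⟩ := Matrix.exists_mulVec_eq_zero_iff.2 h0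
  rw [Matrix.sub_mulVec, Matrix.smul_mulVec, Matrix.one_mulVec, sub_eq_zero] at e
  exact absurd ((isSchurStable_iff M).1 h z v hv e.symm) (not_lt.2 hz)

/-- Evaluating at a largest coordinate of an eigenvector bounds |μ|ᵏ by a row sum of Mᵏ. For a fixed
k the criterion is an open condition on M. -/
theorem isSchurStable_of_pow_entry_lt {M : Matrix (Fin p) (Fin p) ℝ} {k : ℕ}
    (hk : ∀ i, ∑ j, |(M ^ k) i j| < 1) : IsSchurStable M := by
  rw [isSchurStable_iff]
  intro μ v hv he
  have hpow : toComplex (M ^ k) *ᵥ v = μ ^ k • v := by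
    rw [toComplex_pow]
    clear hk
    induction k with
    | zero => simp
    | succ k ih => rw [pow_succ, ← Matrix.mulVec_mulVec, he, Matrix.mulVec_smul, ih, smul_smul,
        pow_succ']
  obtain ⟨i0, hi0⟩ := Function.ne_iff.1 hv
  have : Nonempty (Fin p) := ⟨i0⟩
  obtain ⟨i, -, hi⟩ := Finset.exists_max_image Finset.univ (fun i => ‖v i‖) Finset.univ_nonempty
  have hvi : 0 < ‖v i‖ := (norm_pos_iff.2 hi0).trans_le (hi i0 (Finset.mem_univ _))
  have h1 : ‖μ‖ ^ k * ‖v i‖ < 1 * ‖v i‖ := by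
    calc ‖μ‖ ^ k * ‖v i‖ = ‖(toComplex (M ^ k) *ᵥ v) i‖ := by rw [hpow]; simp
      _ ≤ ∑ j, ‖toComplex (M ^ k) i j * v j‖ :=
        norm_sum_le Finset.univ (fun j => toComplex (M ^ k) i j * v j)
      _ ≤ ∑ j, |(M ^ k) i j| * ‖v i‖ := by
        refine Finset.sum_le_sum fun j _ => ?_
        rw [norm_mul]
        simp only [toComplex, Matrix.map_apply, Complex.norm_real, Real.norm_eq_abs]
        exact mul_le_mul_of_nonneg_left (hi j (Finset.mem_univ _)) (abs_nonneg _)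
      _ = (∑ j, |(M ^ k) i j|) * ‖v i‖ := by rw [Finset.sum_mul]
      _ < 1 * ‖v i‖ := mul_lt_mul_of_pos_right (hk i) hvi
  have h2 := lt_of_mul_lt_mul_right h1 hvi.le
  by_contra! h3
  exact absurd (one_le_pow₀ h3 (n := k)) (not_le.2 h2)

theorem isOpen_isSchurStable : IsOpen {M : Matrix (Fin p) (Fin p) ℝ | IsSchurStable M} := by
  rw [isOpen_iff_mem_nhds]
  intro M hM
  have hc : ∀ i, Continuous fun N : Matrix (Fin p) (Fin p) ℝ => ∑ j, |N i j| := fun i => by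
    fun_prop
  have h1 : ∀ᶠ k in atTop, ∀ i, ∑ j, |(M ^ k) i j| < 1 := by
    refine eventually_all.2 fun i => ?_
    have := ((hc i).tendsto 0).comp hM.tendsto_pow
    exact this.eventually_lt_const (by simp)
  obtain ⟨k, hk⟩ := h1.exists
  have h2 : ∀ᶠ N in 𝓝 M, ∀ i, ∑ j, |(N ^ k) i j| < 1 := by
    refine eventually_all.2 fun i => ?_
    exact (((hc i).comp (continuous_pow k)).tendsto M).eventually_lt_const (hk i)
  filter_upwards [h2] with N hN using isSchurStable_of_pow_entry_lt hN

end Stability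

/-! ### Limits of matrices and the Riccati iteration. -/

theorem Matrix.continuousAt_nonsing_inv {𝕜 ι : Type*} [NormedField 𝕜] [Fintype ι] [DecidableEq ι]
    {M : Matrix ι ι 𝕜} (h : IsUnit M.det) :
    ContinuousAt (fun N : Matrix ι ι 𝕜 => N⁻¹) M := by
  simp only [Matrix.inv_def, Ring.inverse_eq_inv']
  exact ((continuous_id.matrix_det).continuousAt.inv₀ h.ne_zero).smul
    continuous_id.matrix_adjugate.continuousAt

theorem Matrix.exists_tendsto_of_monotone {ι : Type*} [Fintype ι] [DecidableEq ι]
    {P : ℕ → Matrix ι ι ℝ} {B : Matrix ι ι ℝ} (hs : ∀ k, (P k)ᵀ = P k)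
    (hmono : ∀ k, (P (k + 1) - P k).PosSemidef) (hB : ∀ k, (B - P k).PosSemidef) :
    ∃ L, Tendsto P atTop (𝓝 L) := by
  have h1 : ∀ x : ι → ℝ, ∃ a, Tendsto (fun k => x ⬝ᵥ P k *ᵥ x) atTop (𝓝 a) := by
    intro x
    have hm : Monotone fun k => x ⬝ᵥ P k *ᵥ x := monotone_nat_of_le_succ fun k => by
      have := (posSemidef_real_iff.1 (hmono k)).2 x
      rw [sub_mulVec, dotProduct_sub] at this
      linarith
    refine ⟨_, tendsto_atTop_ciSup hm ⟨x ⬝ᵥ B *ᵥ x, ?_⟩⟩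
    rintro _ ⟨k, rfl⟩
    have := (posSemidef_real_iff.1 (hB k)).2 x
    rw [sub_mulVec, dotProduct_sub] at this
    simpa using this
  choose a ha using h1
  -- Polarization recovers the entries from the limits of the quadratic forms.
  refine ⟨Matrix.of fun i j => (a (Pi.single i 1 + Pi.single j 1) - a (Pi.single i 1)
    - a (Pi.single j 1)) / 2, tendsto_pi_nhds.2 fun i => tendsto_pi_nhds.2 fun j => ?_⟩
  refine Tendsto.congr ?_ ((((ha (Pi.single i 1 + Pi.single j 1)).sub (ha (Pi.single i 1))).sub
    (ha (Pi.single j 1))).div_const 2)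
  intro k
  have hij : P k j i = P k i j := congrFun (congrFun (hs k) i) j
  simp [mulVec_add, hij]
  ring

namespace GameRiccati

variable {m n : ℕ} {F : Matrix (Fin m) (Fin m) ℝ} {D : Matrix (Fin m) (Fin n) ℝ}
  {Q : Matrix (Fin m) (Fin m) ℝ} {g : ℝ} {P P' : Matrix (Fin m) (Fin m) ℝ}

/-- The Riccati map `P ↦ Fᵀ P̃ F + Q`. -/
noncomputable def ric (F : Matrix (Fin m) (Fin m) ℝ) (D : Matrix (Fin m) (Fin n) ℝ)
    (Q : Matrix (Fin m) (Fin m) ℝ) (g : ℝ) (P : Matrix (Fin m) (Fin m) ℝ) :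
    Matrix (Fin m) (Fin m) ℝ :=
  Fᵀ * tilde D g P * F + Q

/-- The Riccati iteration started at `0`. -/
noncomputable def iter (F : Matrix (Fin m) (Fin m) ℝ) (D : Matrix (Fin m) (Fin n) ℝ)
    (Q : Matrix (Fin m) (Fin m) ℝ) (g : ℝ) (k : ℕ) : Matrix (Fin m) (Fin m) ℝ :=
  (ric F D Q g)^[k] 0

theorem iter_succ (k : ℕ) : iter F D Q g (k + 1) = ric F D Q g (iter F D Q g k) :=
  Function.iterate_succ_apply' _ _ _

theorem continuous_gap : Continuous (gap D g) := by unfold gap; fun_prop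

theorem continuousAt_tilde (h : IsUnit (gap D g P).det) : ContinuousAt (tilde D g) P := by
  have h1 : ContinuousAt (fun X => (gap D g X)⁻¹) P :=
    ContinuousAt.comp (f := gap D g) (Matrix.continuousAt_nonsing_inv h) continuous_gap.continuousAt
  have h2 : Continuous fun Z : Matrix (Fin m) (Fin m) ℝ × Matrix (Fin n) (Fin n) ℝ =>
      Z.1 + Z.1 * D * Z.2 * Dᵀ * Z.1 := by fun_prop
  exact ContinuousAt.comp (f := fun X => (X, (gap D g X)⁻¹)) h2.continuousAt
    (continuousAt_id.prodMk h1)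

theorem ric_posSemidef (hQ : Q.PosSemidef) (hP : P.PosSemidef) (h : (gap D g P).PosDef) :
    (ric F D Q g P).PosSemidef :=
  ((tilde_posSemidef h hP).transpose_mul_mul_same F).add hQ

theorem ric_mono (hP : Pᵀ = P) (hP' : P'ᵀ = P') (h : (gap D g P).PosDef)
    (hle : (P - P').PosSemidef) : (ric F D Q g P - ric F D Q g P').PosSemidef := by
  have := (tilde_mono hP hP' h hle).transpose_mul_mul_same F
  convert this using 1
  simp [ric, Matrix.mul_sub, Matrix.sub_mul]

theorem gap_sub_gap : gap D g P' - gap D g P = Dᵀ * (P - P') * D := by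
  simp [gap, Matrix.mul_sub, Matrix.sub_mul]

/-- The iterates increase and stay below B. The uniform margin S₀ passes to the limit, so the gap
stays positive definite there and the Riccati map is continuous at the limit. -/
theorem exists_solution (hQ : Q.PosSemidef) {S₀ : Matrix (Fin n) (Fin n) ℝ} (hS₀ : S₀.PosDef)
    {B : Matrix (Fin m) (Fin m) ℝ} (hgap : ∀ k, (gap D g (iter F D Q g k) - S₀).PosSemidef)
    (hB : ∀ k, (B - iter F D Q g k).PosSemidef) :
    ∃ P, Tendsto (iter F D Q g) atTop (𝓝 P) ∧ P.PosSemidef ∧ (gap D g P).PosDef ∧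
      ric F D Q g P = P := by
  have hgap' : ∀ k, (gap D g (iter F D Q g k)).PosDef := fun k => by
    simpa using hS₀.add_posSemidef (hgap k)
  have hpsd : ∀ k, (iter F D Q g k).PosSemidef := by
    intro k
    induction k with
    | zero => exact Matrix.PosSemidef.zero
    | succ k ih => rw [iter_succ]; exact ric_posSemidef hQ ih (hgap' k)
  have hmono : ∀ k, (iter F D Q g (k + 1) - iter F D Q g k).PosSemidef := by
    intro k
    induction k with
    | zero => simpa [iter] using hpsd 1
    | succ k ih =>
      have := ric_mono (F := F) (Q := Q) (hpsd (k + 1)).isSymm (hpsd k).isSymm (hgap' _) ih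
      rwa [← iter_succ, ← iter_succ] at this
  obtain ⟨P, hP⟩ := Matrix.exists_tendsto_of_monotone (fun k => (hpsd k).isSymm) hmono hB
  have hPgap : (gap D g P).PosDef := by
    have := Matrix.isClosed_posSemidef.mem_of_tendsto
      (((continuous_gap (D := D) (g := g)).sub (continuous_const (y := S₀))).tendsto P |>.comp hP)
      (Eventually.of_forall hgap)
    simpa using hS₀.add_posSemidef this
  refine ⟨P, hP, Matrix.isClosed_posSemidef.mem_of_tendsto hP (Eventually.of_forall hpsd),
    hPgap, ?_⟩
  have h1 : Tendsto (fun k => iter F D Q g (k + 1)) atTop (𝓝 (ric F D Q g P)) := by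
    simp only [iter_succ]
    have h2 : Continuous fun X : Matrix (Fin m) (Fin m) ℝ => Fᵀ * X * F + Q := by fun_prop
    exact (h2.tendsto _).comp ((continuousAt_tilde (gap_isUnit hPgap)).tendsto.comp hP)
  exact tendsto_nhds_unique h1 (hP.comp (tendsto_add_atTop_nat 1))

/-- A supersolution bounds every iterate by monotonicity, and its own gap serves as the uniform
margin. -/
theorem exists_solution_le (hQ : Q.PosSemidef) (hP' : P'.PosSemidef) (h : (gap D g P').PosDef)
    (hsup : (P' - ric F D Q g P').PosSemidef) :
    ∃ P, P.PosSemidef ∧ (gap D g P).PosDef ∧ ric F D Q g P = P ∧ (P' - P).PosSemidef := by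
  have hb : ∀ k, (iter F D Q g k)ᵀ = iter F D Q g k ∧ (P' - iter F D Q g k).PosSemidef := by
    intro k
    induction k with
    | zero => simpa [iter] using hP'
    | succ k ih =>
      rw [iter_succ]
      refine ⟨?_, ?_⟩
      · simp [ric, tilde_isSymm ih.1, hQ.isSymm, Matrix.mul_assoc]
      · simpa using hsup.add (ric_mono (F := F) (Q := Q) hP'.isSymm ih.1 h ih.2)
  obtain ⟨P, hlim, hP, hg, hr⟩ := exists_solution (F := F) hQ h (B := P')
    (fun k => by rw [gap_sub_gap]; exact (hb k).2.transpose_mul_mul_same D) (fun k => (hb k).2)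
  exact ⟨P, hP, hg, hr, Matrix.isClosed_posSemidef.mem_of_tendsto (hlim.const_sub P')
    (Eventually.of_forall fun k => (hb k).2)⟩

/-- A dearer disturbance gives a smaller maximum. The disturbance optimal at level g is used as a
competitor at level g'. -/
theorem tilde_anti {g' : ℝ} (hgg : g' ≤ g) (hP : Pᵀ = P) (h : IsUnit (gap D g P).det)
    (h' : (gap D g' P).PosDef) : (tilde D g' P - tilde D g P).PosSemidef := by
  have e1 := complete_square_gain hP h (1 : Matrix (Fin m) (Fin m) ℝ)
  have e2 := complete_square hP (gap_isUnit h') (1 : Matrix (Fin m) (Fin m) ℝ)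
    (gain D g P)
  simp only [Matrix.mul_one, Matrix.transpose_one, Matrix.one_mul] at e1 e2
  rw [show (1 : Matrix (Fin m) (Fin m) ℝ) + D * gain D g P = amp D g P from rfl,
    sub_eq_iff_eq_add] at e2
  rw [e2] at e1
  rw [← e1]
  have h1 := (Matrix.posSemidef_transpose_mul_self (gain D g P)).smul (sub_nonneg.2 hgg)
  have h2 := h'.posSemidef.transpose_mul_mul_same (gain D g P - gain D g' P)
  convert h1.add h2 using 1
  rw [sub_smul]
  abel

/-- A solution at the stricter level g' is a supersolution at level g and bounds a solution P there.
The term (g − g')LᵀL in the equation for P' − P forces L v = 0 on any mode of the worst-case loop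
with |μ| ≥ 1. Such a mode is then a mode of the stable matrix F, which is impossible. -/
theorem exists_stabilizing_of_slack {g' : ℝ} (hF : IsSchurStable F) (hQ : Q.PosSemidef)
    (hgg : g' < g) (hP' : P'.PosSemidef) (h' : (gap D g' P').PosDef)
    (hric : ric F D Q g' P' = P') :
    ∃ P, P.PosSemidef ∧ (gap D g P).PosDef ∧ ric F D Q g P = P ∧
      IsSchurStable (amp D g P * F) := by
  have hgap : (gap D g P').PosDef := by
    have : gap D g P' = gap D g' P' + (g - g') • 1 := by simp [gap, sub_smul]
    rw [this]
    exact h'.add_posSemidef (Matrix.PosSemidef.one.smul (sub_nonneg.2 hgg.le))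
  have hsup : (P' - ric F D Q g P').PosSemidef := by
    have := (tilde_anti hgg.le hP'.isSymm (gap_isUnit hgap) h').transpose_mul_mul_same F
    convert this using 1
    nth_rewrite 1 [← hric]
    simp [ric, Matrix.mul_sub, Matrix.sub_mul]
  obtain ⟨P, hP, hPg, hPr, hle⟩ := exists_solution_le hQ hP' hgap hsup
  refine ⟨P, hP, hPg, hPr, ?_⟩
  set L := gain D g P * F with hL
  set M := amp D g P * F with hM
  have hMF : M = F + D * L := by
    rw [hM, amp, Matrix.add_mul, Matrix.one_mul, Matrix.mul_assoc]
  have e1 : Mᵀ * P * M - g • (Lᵀ * L) + Q = P := by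
    rw [hM, hL, complete_square_gain hP.isSymm (gap_isUnit hPg)]; exact hPr
  -- The gain L of P is only a competitor for P' at level g', and Z is what it loses in the
  -- completed square.
  obtain ⟨Z, hZ, e2⟩ : ∃ Z : Matrix (Fin m) (Fin m) ℝ, Z.PosSemidef ∧
      Mᵀ * P' * M - g' • (Lᵀ * L) + Q + Z = P' := by
    refine ⟨_, h'.posSemidef.transpose_mul_mul_same (L - gain D g' P' * F), ?_⟩
    rw [hMF, complete_square hP'.isSymm (gap_isUnit h')]
    refine Eq.trans ?_ hric
    rw [ric]
    abel
  rw [isSchurStable_iff]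
  intro μ v hv he
  by_contra! hμ
  have e3 : P' - P = Mᵀ * (P' - P) * M + (g - g') • (Lᵀ * L) + Z := by
    nth_rewrite 1 [← e1, ← e2]
    rw [sub_smul, Matrix.mul_sub, Matrix.sub_mul]
    abel
  have e4 := congrArg (fun X => hermForm X v) e3
  simp only [hermForm_add, hermForm_smul] at e4
  rw [hermForm_conj, he, hermForm_smul_vec] at e4
  have h1 := hermForm_nonneg hle v
  have h2 := hermForm_nonneg hZ v
  have h3 := hermForm_nonneg (Matrix.posSemidef_transpose_mul_self L) v
  have h4 : 1 ≤ ‖μ‖ ^ 2 := one_le_pow₀ hμ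
  have h5 : hermForm (Lᵀ * L) v = 0 := by
    by_contra h0
    have : 0 < (g - g') * hermForm (Lᵀ * L) v :=
      mul_pos (sub_pos.2 hgg) (lt_of_le_of_ne h3 (Ne.symm h0))
    nlinarith
  have h6 := toComplex_mulVec_eq_zero_of_gram h5
  have h7 : toComplex F *ᵥ v = μ • v := by
    rw [← he, hMF, toComplex_add, toComplex_mul, Matrix.add_mulVec, ← Matrix.mulVec_mulVec, h6]
    simp
  exact absurd ((isSchurStable_iff F).1 hF μ v hv h7) (not_lt.2 hμ)

end GameRiccati

/-! ### Finite Fourier transform. -/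

section Parseval

theorem sum_root_pow_eq {M : ℕ} {ζ : ℂ} (hζ : IsPrimitiveRoot ζ M) {s t : ℕ} (hs : s < M)
    (ht : t < M) : ∑ k ∈ Finset.range M, (ζ ^ s * ζ⁻¹ ^ t) ^ k = if s = t then (M : ℂ) else 0 := by
  have hM : M ≠ 0 := by omega
  have hζ0 : ζ ≠ 0 := hζ.ne_zero hM
  split_ifs with h
  · subst h
    rw [← mul_pow, mul_inv_cancel₀ hζ0]
    simp
  · have h1 : ζ ^ s * ζ⁻¹ ^ t ≠ 1 := by
      intro h1
      rw [inv_pow, mul_inv_eq_one₀ (pow_ne_zero _ hζ0)] at h1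
      exact h (hζ.pow_inj hs ht h1)
    have h2 : (ζ ^ s * ζ⁻¹ ^ t) ^ M = 1 := by
      rw [mul_pow, ← pow_mul, ← pow_mul, mul_comm s, mul_comm t, pow_mul, pow_mul, inv_pow,
        hζ.pow_eq_one]
      simp
    have h3 := mul_geom_sum (ζ ^ s * ζ⁻¹ ^ t) M
    rw [h2, sub_self] at h3
    exact (mul_eq_zero.1 h3).resolve_left (sub_ne_zero.2 h1)

/-- Parseval's identity for the discrete Fourier transform. -/
theorem sum_norm_sq_dft {M : ℕ} {ζ : ℂ} (hζ : IsPrimitiveRoot ζ M) (hM : M ≠ 0) (a : ℕ → ℂ) :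
    ∑ k ∈ Finset.range M, ‖∑ t ∈ Finset.range M, (ζ ^ k)⁻¹ ^ t * a t‖ ^ 2 =
      M * ∑ t ∈ Finset.range M, ‖a t‖ ^ 2 := by
  have hconj : (starRingEnd ℂ) ζ⁻¹ = ζ := by
    rw [Complex.inv_eq_conj (hζ.norm'_eq_one hM), Complex.conj_conj]
  have h1 : ∀ k, ((‖∑ t ∈ Finset.range M, (ζ ^ k)⁻¹ ^ t * a t‖ ^ 2 : ℝ) : ℂ) =
      ∑ t ∈ Finset.range M, ∑ s ∈ Finset.range M,
        (ζ ^ s * ζ⁻¹ ^ t) ^ k * (a t * (starRingEnd ℂ) (a s)) := by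
    intro k
    rw [Complex.ofReal_pow, ← Complex.mul_conj', map_sum, Finset.sum_mul_sum]
    refine Finset.sum_congr rfl fun t _ => Finset.sum_congr rfl fun s _ => ?_
    rw [map_mul, map_pow, ← inv_pow, map_pow, hconj, mul_pow, ← pow_mul, ← pow_mul, ← pow_mul,
      ← pow_mul, mul_comm k t, mul_comm k s]
    ring
  have h2 : ((∑ k ∈ Finset.range M, ‖∑ t ∈ Finset.range M, (ζ ^ k)⁻¹ ^ t * a t‖ ^ 2 : ℝ) : ℂ) =
      ((M * ∑ t ∈ Finset.range M, ‖a t‖ ^ 2 : ℝ) : ℂ) := by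
    rw [Complex.ofReal_sum, Finset.sum_congr rfl fun k _ => h1 k, Finset.sum_comm]
    simp_rw [Finset.sum_comm (s := Finset.range M) (t := Finset.range M)
      (f := fun k s => (ζ ^ s * ζ⁻¹ ^ _) ^ k * (a _ * (starRingEnd ℂ) (a s))), ← Finset.sum_mul]
    push_cast
    rw [Finset.mul_sum]
    refine Finset.sum_congr rfl fun t ht => ?_
    rw [Finset.sum_eq_single_of_mem t ht]
    · rw [sum_root_pow_eq hζ (Finset.mem_range.1 ht) (Finset.mem_range.1 ht), if_pos rfl,
        Complex.mul_conj']
    · intro s hs hst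
      rw [sum_root_pow_eq hζ (Finset.mem_range.1 hs) (Finset.mem_range.1 ht), if_neg hst, zero_mul]
  exact_mod_cast h2

theorem sum_norm_sq_dft_vec {q M : ℕ} {ζ : ℂ} (hζ : IsPrimitiveRoot ζ M) (hM : M ≠ 0)
    (a : ℕ → Fin q → ℝ) :
    ∑ k ∈ Finset.range M, ‖WithLp.toLp 2 (∑ t ∈ Finset.range M,
        (ζ ^ k)⁻¹ ^ t • fun i => (a t i : ℂ))‖ ^ 2 =
      M * ∑ t ∈ Finset.range M, a t ⬝ᵥ a t := by
  simp only [EuclideanSpace.norm_sq_eq]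
  rw [Finset.sum_comm]
  simp only [Finset.sum_apply, Pi.smul_apply, smul_eq_mul]
  rw [Finset.sum_congr rfl fun i _ => sum_norm_sq_dft hζ hM fun t => (a t i : ℂ), ← Finset.mul_sum,
    Finset.sum_comm]
  congr 1
  refine Finset.sum_congr rfl fun t _ => ?_
  simp [dotProduct, pow_two]

end Parseval

/-! ### From the H∞ bound to an energy inequality. -/

section Energy

open scoped Matrix.Norms.L2Operator

variable {m n l : ℕ}

theorem exists_bound_of_hInfNorm_lt {G : ℂ → Matrix (Fin l) (Fin n) ℂ} {γ : ℝ}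
    (h : hInfNorm G < ENNReal.ofReal γ) :
    ∃ g₀, 0 ≤ g₀ ∧ g₀ < γ ∧
      ∀ θ ∈ Set.Ico (0 : ℝ) (2 * Real.pi), ‖G (Complex.exp (θ * Complex.I))‖ ≤ g₀ := by
  refine ⟨(hInfNorm G).toReal, ENNReal.toReal_nonneg, ENNReal.toReal_lt_of_lt_ofReal h,
    fun θ hθ => ?_⟩
  have h1 : ‖G (Complex.exp (θ * Complex.I))‖ₑ ≤ hInfNorm G :=
    le_iSup₂ (f := fun θ (_ : θ ∈ Set.Ico (0 : ℝ) (2 * Real.pi)) =>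
      ‖G (Complex.exp (θ * Complex.I))‖ₑ) θ hθ
  have h2 := ENNReal.toReal_mono (ne_top_of_lt h) h1
  simpa using h2

theorem continuousAt_resolvent {F : Matrix (Fin m) (Fin m) ℝ} {z : ℂ}
    (h : IsUnit (z • (1 : Matrix (Fin m) (Fin m) ℂ) - toComplex F).det) :
    ContinuousAt (fun Z : ℂ × Matrix (Fin m) (Fin m) ℝ =>
      (Z.1 • (1 : Matrix (Fin m) (Fin m) ℂ) - toComplex Z.2)⁻¹) (z, F) := by
  have h1 : Continuous fun Z : ℂ × Matrix (Fin m) (Fin m) ℝ =>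
      (Z.1 • (1 : Matrix (Fin m) (Fin m) ℂ) - toComplex Z.2) :=
    (continuous_fst.smul continuous_const).sub (continuous_toComplex.comp continuous_snd)
  exact ContinuousAt.comp (f := fun Z : ℂ × Matrix (Fin m) (Fin m) ℝ =>
      (Z.1 • (1 : Matrix (Fin m) (Fin m) ℂ) - toComplex Z.2))
    (Matrix.continuousAt_nonsing_inv h) h1.continuousAt

theorem exists_bound_resolvent {F : Matrix (Fin m) (Fin m) ℝ} (hF : IsSchurStable F)
    (H : Matrix (Fin l) (Fin m) ℝ) :
    ∃ b : ℝ, 0 ≤ b ∧ ∀ z : ℂ, ‖z‖ = 1 →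
      ‖toComplex H * (z • (1 : Matrix (Fin m) (Fin m) ℂ) - toComplex F)⁻¹‖ ≤ b := by
  have hc : ContinuousOn (fun z : ℂ =>
      toComplex H * (z • (1 : Matrix (Fin m) (Fin m) ℂ) - toComplex F)⁻¹)
      (Metric.sphere (0 : ℂ) 1) := by
    intro z hz
    have hz' : ‖z‖ = 1 := by simpa using hz
    have h1 : ContinuousAt (fun z : ℂ =>
        (z • (1 : Matrix (Fin m) (Fin m) ℂ) - toComplex F)⁻¹) z :=
      ContinuousAt.comp (f := fun z : ℂ => (z, F)) (continuousAt_resolvent (hF.isUnit_det hz'.ge))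
        (by fun_prop)
    have h2 : Continuous fun X : Matrix (Fin m) (Fin m) ℂ => toComplex H * X := by fun_prop
    exact (h2.continuousAt.comp h1).continuousWithinAt
  obtain ⟨b, hb⟩ := (isCompact_sphere (0 : ℂ) 1).exists_bound_of_continuousOn hc
  exact ⟨max b 0, le_max_right _ _, fun z hz => (hb z (by simpa using hz)).trans (le_max_left _ _)⟩

theorem toComplex_mulVec_ofReal {p q : ℕ} (A : Matrix (Fin p) (Fin q) ℝ) (v : Fin q → ℝ) :
    toComplex A *ᵥ (fun i => (v i : ℂ)) = fun i => ((A *ᵥ v) i : ℂ) := by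
  ext i; simp [toComplex, Matrix.mulVec, dotProduct]

/-- The transform of a trajectory over a window of length `M`. -/
theorem dft_trajectory {F : Matrix (Fin m) (Fin m) ℝ} {D : Matrix (Fin m) (Fin n) ℝ}
    {x : ℕ → Fin m → ℝ} {w : ℕ → Fin n → ℝ} (hx : ∀ t, x (t + 1) = F *ᵥ x t + D *ᵥ w t)
    {M : ℕ} {z : ℂ} (hz0 : z ≠ 0) (hz : z ^ M = 1) :
    (z • (1 : Matrix (Fin m) (Fin m) ℂ) - toComplex F) *ᵥ
        (∑ t ∈ Finset.range M, z⁻¹ ^ t • fun i => (x t i : ℂ)) =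
      toComplex D *ᵥ (∑ t ∈ Finset.range M, z⁻¹ ^ t • fun i => (w t i : ℂ))
        + z • fun i => ((x 0 - x M) i : ℂ) := by
  set X : ℕ → Fin m → ℂ := fun t i => (x t i : ℂ) with hX
  set W : ℕ → Fin n → ℂ := fun t i => (w t i : ℂ) with hW
  have hXs : ∀ t, X (t + 1) = toComplex F *ᵥ X t + toComplex D *ᵥ W t := by
    intro t
    rw [hX, hW]
    simp only [toComplex_mulVec_ofReal, hx]
    ext i; simp
  have e1 : ∑ t ∈ Finset.range M, z⁻¹ ^ t • X (t + 1) =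
      z • (∑ t ∈ Finset.range M, z⁻¹ ^ t • X t - X 0 + X M) := by
    have h1 := Finset.sum_range_succ (fun t => z⁻¹ ^ t • X t) M
    rw [Finset.sum_range_succ', inv_pow z M, hz] at h1
    simp only [inv_one, one_smul, pow_zero] at h1
    rw [eq_sub_of_add_eq h1.symm]
    rw [show ∑ k ∈ Finset.range M, z⁻¹ ^ (k + 1) • X (k + 1) + X 0 - X M - X 0 + X M =
      ∑ k ∈ Finset.range M, z⁻¹ ^ (k + 1) • X (k + 1) by abel, Finset.smul_sum]
    refine Finset.sum_congr rfl fun t _ => ?_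
    rw [smul_smul, pow_succ', ← mul_assoc, mul_inv_cancel₀ hz0, one_mul]
  have e2 : ∑ t ∈ Finset.range M, z⁻¹ ^ t • X (t + 1) =
      toComplex F *ᵥ (∑ t ∈ Finset.range M, z⁻¹ ^ t • X t) +
        toComplex D *ᵥ (∑ t ∈ Finset.range M, z⁻¹ ^ t • W t) := by
    simp only [hXs, Matrix.mulVec_sum, Matrix.mulVec_smul, smul_add, Finset.sum_add_distrib]
  rw [e2] at e1
  have e3 : (fun i => ((x 0 - x M) i : ℂ)) = X 0 - X M := by ext i; simp [hX]
  rw [e3, Matrix.sub_mulVec, Matrix.smul_mulVec, Matrix.one_mulVec]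
  rw [smul_add, smul_sub] at e1
  rw [smul_sub, sub_eq_iff_eq_add, add_right_comm, add_comm (toComplex D *ᵥ _), e1]
  abel

theorem norm_sq_toLp_ofReal {q : ℕ} (v : Fin q → ℝ) :
    ‖WithLp.toLp 2 (fun i => (v i : ℂ))‖ ^ 2 = v ⬝ᵥ v := by
  rw [EuclideanSpace.norm_sq_eq]
  simp [dotProduct, pow_two]

/-- On a window of length M the transform at the M-th roots of unity turns the dynamics into
multiplication by the transfer function. The failure of periodicity adds the single defect x₀ − x_M,
filtered by the resolvent. Young's inequality with parameter δ separates the two contributions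
before Parseval sums them. -/
theorem window_energy_le {F : Matrix (Fin m) (Fin m) ℝ} (hF : IsSchurStable F)
    {D : Matrix (Fin m) (Fin n) ℝ} {H : Matrix (Fin l) (Fin m) ℝ} {g₀ b δ : ℝ} (hδ : 0 < δ)
    (hG : ∀ θ ∈ Set.Ico (0 : ℝ) (2 * Real.pi),
      ‖transferFunction F D H (Complex.exp (θ * Complex.I))‖ ≤ g₀)
    (hb : ∀ z : ℂ, ‖z‖ = 1 →
      ‖toComplex H * (z • (1 : Matrix (Fin m) (Fin m) ℂ) - toComplex F)⁻¹‖ ≤ b)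
    {x : ℕ → Fin m → ℝ} {w : ℕ → Fin n → ℝ} (hx : ∀ t, x (t + 1) = F *ᵥ x t + D *ᵥ w t)
    {M : ℕ} (hM : M ≠ 0) :
    ∑ t ∈ Finset.range M, (H *ᵥ x t) ⬝ᵥ (H *ᵥ x t) ≤
      (1 + δ) * g₀ ^ 2 * ∑ t ∈ Finset.range M, w t ⬝ᵥ w t +
        (1 + δ⁻¹) * b ^ 2 * ((x 0 - x M) ⬝ᵥ (x 0 - x M)) := by
  have hζ := Complex.isPrimitiveRoot_exp M hM
  set ζ := Complex.exp (2 * Real.pi * Complex.I / M) with hζdef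
  have hM0 : (0 : ℝ) < M := by exact_mod_cast Nat.pos_of_ne_zero hM
  have hpt : ∀ k ∈ Finset.range M,
      ‖WithLp.toLp 2 (∑ t ∈ Finset.range M, (ζ ^ k)⁻¹ ^ t • fun i => ((H *ᵥ x t) i : ℂ))‖ ^ 2 ≤
        (1 + δ) * g₀ ^ 2 * ‖WithLp.toLp 2 (∑ t ∈ Finset.range M,
          (ζ ^ k)⁻¹ ^ t • fun i => (w t i : ℂ))‖ ^ 2 +
        (1 + δ⁻¹) * b ^ 2 * ((x 0 - x M) ⬝ᵥ (x 0 - x M)) := by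
    intro k hk
    have hkM : k < M := Finset.mem_range.1 hk
    have hn : ‖ζ ^ k‖ = 1 := by rw [norm_pow, hζ.norm'_eq_one hM, one_pow]
    have hz0 : ζ ^ k ≠ 0 := by rw [← norm_pos_iff, hn]; exact one_pos
    have hzM : (ζ ^ k) ^ M = 1 := by rw [← pow_mul, mul_comm, pow_mul, hζ.pow_eq_one, one_pow]
    have hexp : ζ ^ k = Complex.exp (((2 * Real.pi * (k / M) : ℝ) : ℂ) * Complex.I) := by
      rw [hζdef, ← Complex.exp_nat_mul]
      congr 1; push_cast; ring
    have hθ : 2 * Real.pi * ((k : ℝ) / M) ∈ Set.Ico (0 : ℝ) (2 * Real.pi) := by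
      have h1 : (k : ℝ) / M < 1 := (div_lt_one hM0).2 (by exact_mod_cast hkM)
      have h2 : 0 ≤ (k : ℝ) / M := by positivity
      have := Real.pi_pos
      exact ⟨by positivity, by nlinarith⟩
    have hdft := dft_trajectory hx hz0 hzM
    set z := ζ ^ k
    set X := ∑ t ∈ Finset.range M, z⁻¹ ^ t • fun i => (x t i : ℂ)
    set W := ∑ t ∈ Finset.range M, z⁻¹ ^ t • fun i => (w t i : ℂ)
    have hHX : ∑ t ∈ Finset.range M, z⁻¹ ^ t • (fun i => ((H *ᵥ x t) i : ℂ)) =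
        toComplex H *ᵥ X := by
      simp only [X, Matrix.mulVec_sum, Matrix.mulVec_smul, toComplex_mulVec_ofReal]
    have hsolve : X = (z • (1 : Matrix (Fin m) (Fin m) ℂ) - toComplex F)⁻¹ *ᵥ
        (toComplex D *ᵥ W + z • fun i => ((x 0 - x M) i : ℂ)) := by
      rw [← hdft, Matrix.mulVec_mulVec, Matrix.nonsing_inv_mul _ (hF.isUnit_det hn.ge),
        Matrix.one_mulVec]
    have heq : toComplex H *ᵥ X = transferFunction F D H z *ᵥ W +
        (toComplex H * (z • (1 : Matrix (Fin m) (Fin m) ℂ) - toComplex F)⁻¹) *ᵥ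
          (z • fun i => ((x 0 - x M) i : ℂ)) := by
      conv_lhs => rw [hsolve]
      rw [transferFunction, Matrix.mulVec_add, Matrix.mulVec_add, Matrix.mulVec_mulVec,
        Matrix.mulVec_mulVec, Matrix.mulVec_mulVec, Matrix.mul_assoc]
    rw [hHX, heq, WithLp.toLp_add]
    have h1 : ‖WithLp.toLp 2 (transferFunction F D H z *ᵥ W)‖ ≤ g₀ * ‖WithLp.toLp 2 W‖ := by
      refine (Matrix.l2_opNorm_mulVec (transferFunction F D H z) (WithLp.toLp 2 W)).trans ?_
      refine mul_le_mul_of_nonneg_right ?_ (norm_nonneg _)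
      rw [hexp]; exact hG _ hθ
    have h2 : ‖WithLp.toLp 2 ((toComplex H *
          (z • (1 : Matrix (Fin m) (Fin m) ℂ) - toComplex F)⁻¹) *ᵥ
          (z • fun i => ((x 0 - x M) i : ℂ)))‖ ≤
        b * ‖WithLp.toLp 2 (fun i => ((x 0 - x M) i : ℂ))‖ := by
      refine (Matrix.l2_opNorm_mulVec _ (WithLp.toLp 2 (z • fun i => ((x 0 - x M) i : ℂ)))).trans ?_
      rw [WithLp.toLp_smul, norm_smul, hn, one_mul]
      exact mul_le_mul_of_nonneg_right (hb z hn) (norm_nonneg _)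
    rw [← norm_sq_toLp_ofReal]
    have h3 := (norm_add_le (WithLp.toLp 2 (transferFunction F D H z *ᵥ W)) (WithLp.toLp 2
      ((toComplex H * (z • (1 : Matrix (Fin m) (Fin m) ℂ) - toComplex F)⁻¹) *ᵥ
          (z • fun i => ((x 0 - x M) i : ℂ))))).trans (add_le_add h1 h2)
    refine (pow_le_pow_left₀ (norm_nonneg _) h3 2).trans ?_
    have h4 : ∀ p q : ℝ, (p + q) ^ 2 ≤ (1 + δ) * p ^ 2 + (1 + δ⁻¹) * q ^ 2 := by
      intro p q
      have h5 : (1 + δ) * p ^ 2 + (1 + δ⁻¹) * q ^ 2 - (p + q) ^ 2 = δ⁻¹ * (δ * p - q) ^ 2 := by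
        field_simp; ring
      have : 0 ≤ δ⁻¹ * (δ * p - q) ^ 2 := by positivity
      linarith
    refine (h4 _ _).trans_eq ?_
    ring
  have hsum := Finset.sum_le_sum hpt
  rw [sum_norm_sq_dft_vec hζ hM fun t => H *ᵥ x t, Finset.sum_add_distrib, ← Finset.mul_sum,
    sum_norm_sq_dft_vec hζ hM, Finset.sum_const, Finset.card_range, nsmul_eq_mul] at hsum
  refine le_of_mul_le_mul_left (hsum.trans_eq ?_) hM0
  ring

/-- Switching the disturbance off after time N and lengthening the window lets the stable state die
out, so the defect x₀ − x_M tends to x₀ and only an initial-state term remains. -/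
theorem energy_bound {F : Matrix (Fin m) (Fin m) ℝ} (hF : IsSchurStable F)
    {D : Matrix (Fin m) (Fin n) ℝ} {H : Matrix (Fin l) (Fin m) ℝ} {γ : ℝ}
    (hG : hInfNorm (transferFunction F D H) < ENNReal.ofReal γ) :
    ∃ c g₁ : ℝ, 0 ≤ c ∧ 0 ≤ g₁ ∧ g₁ < γ ^ 2 ∧ ∀ (x : ℕ → Fin m → ℝ) (w : ℕ → Fin n → ℝ),
      (∀ t, x (t + 1) = F *ᵥ x t + D *ᵥ w t) → ∀ N,
      ∑ t ∈ Finset.range N, (H *ᵥ x t) ⬝ᵥ (H *ᵥ x t) ≤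
        c * (x 0 ⬝ᵥ x 0) + g₁ * ∑ t ∈ Finset.range N, w t ⬝ᵥ w t := by
  obtain ⟨g₀, hg0, hgγ, hbound⟩ := exists_bound_of_hInfNorm_lt hG
  obtain ⟨b, hb0, hb⟩ := exists_bound_resolvent hF H
  have hlt : g₀ ^ 2 < γ ^ 2 := pow_lt_pow_left₀ hgγ hg0 two_ne_zero
  -- Chosen so that (1 + δ) g₀² < γ²; the summand 1 keeps the denominator positive when g₀ = 0.
  set δ := (γ ^ 2 - g₀ ^ 2) / (2 * (g₀ ^ 2 + 1)) with hδdef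
  have hδ : 0 < δ := div_pos (sub_pos.2 hlt) (by positivity)
  refine ⟨(1 + δ⁻¹) * b ^ 2, (1 + δ) * g₀ ^ 2, by positivity, by positivity, ?_, ?_⟩
  · have h1 : δ * (2 * (g₀ ^ 2 + 1)) = γ ^ 2 - g₀ ^ 2 := div_mul_cancel₀ _ (by positivity)
    nlinarith [sq_nonneg g₀]
  intro x w hx N
  set w' : ℕ → Fin n → ℝ := fun t => if t < N then w t else 0 with hw'
  set x' : ℕ → Fin m → ℝ := fun t => Nat.rec (x 0) (fun t y => F *ᵥ y + D *ᵥ w' t) t with hx'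
  have hdyn : ∀ t, x' (t + 1) = F *ᵥ x' t + D *ᵥ w' t := fun t => rfl
  have hxx : ∀ t, t ≤ N → x' t = x t := by
    intro t
    induction t with
    | zero => intro _; rfl
    | succ t ih =>
      intro ht
      rw [hdyn, ih (by omega), hx, hw']
      simp only [if_pos (show t < N by omega)]
  have hww : ∀ M, N ≤ M → ∑ t ∈ Finset.range M, w' t ⬝ᵥ w' t =
      ∑ t ∈ Finset.range N, w t ⬝ᵥ w t := by
    intro M hM
    rw [← Finset.sum_subset (Finset.range_subset_range.2 hM)]
    · refine Finset.sum_congr rfl fun t ht => ?_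
      simp only [hw', if_pos (Finset.mem_range.1 ht)]
    · intro t _ ht
      simp only [hw', if_neg (fun h => ht (Finset.mem_range.2 h)), dotProduct_zero]
  have htail : ∀ j, x' (N + j) = F ^ j *ᵥ x' N := by
    intro j
    induction j with
    | zero => simp
    | succ j ih =>
      rw [← add_assoc, hdyn, ih]
      simp only [hw', if_neg (show ¬ N + j < N by omega), Matrix.mulVec_zero, add_zero]
      rw [Matrix.mulVec_mulVec, pow_succ']
  have hlim : Tendsto (fun j => (1 + δ) * g₀ ^ 2 * ∑ t ∈ Finset.range N, w t ⬝ᵥ w t +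
      (1 + δ⁻¹) * b ^ 2 * ((x 0 - x' (N + j)) ⬝ᵥ (x 0 - x' (N + j)))) atTop
      (𝓝 ((1 + δ) * g₀ ^ 2 * ∑ t ∈ Finset.range N, w t ⬝ᵥ w t +
        (1 + δ⁻¹) * b ^ 2 * (x 0 ⬝ᵥ x 0))) := by
    have hc : Continuous fun Z : Matrix (Fin m) (Fin m) ℝ =>
        (1 + δ) * g₀ ^ 2 * ∑ t ∈ Finset.range N, w t ⬝ᵥ w t +
        (1 + δ⁻¹) * b ^ 2 * ((x 0 - Z *ᵥ x' N) ⬝ᵥ (x 0 - Z *ᵥ x' N)) := by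
      have h1 : Continuous fun Z : Matrix (Fin m) (Fin m) ℝ => x 0 - Z *ᵥ x' N :=
        continuous_const.sub (continuous_id.matrix_mulVec continuous_const)
      exact continuous_const.add (continuous_const.mul (h1.dotProduct h1))
    have h2 := (hc.tendsto 0).comp hF.tendsto_pow
    simp only [Function.comp_def, Matrix.zero_mulVec, sub_zero] at h2
    simpa only [htail] using h2
  rw [add_comm]
  refine ge_of_tendsto hlim ?_
  filter_upwards [eventually_gt_atTop 0] with j hj
  have h1 := window_energy_le hF hδ hbound hb hdyn (M := N + j) (by omega)
  rw [hww _ (by omega)] at h1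
  refine le_trans ?_ h1
  rw [Finset.sum_congr rfl fun t ht => by rw [← hxx t (Finset.mem_range.1 ht).le]]
  refine Finset.sum_le_sum_of_subset_of_nonneg (Finset.range_subset_range.2 (by omega))
    fun t _ _ => ?_
  exact Finset.sum_nonneg fun i _ => mul_self_nonneg _

end Energy

/-! ### Existence of the stabilizing solution (bounded real lemma). -/

namespace GameRiccati

variable {m n l : ℕ} {F : Matrix (Fin m) (Fin m) ℝ} {D : Matrix (Fin m) (Fin n) ℝ}
  {H : Matrix (Fin l) (Fin m) ℝ} {g : ℝ}

theorem dotProduct_gram_mulVec {p q : ℕ} (M : Matrix (Fin p) (Fin q) ℝ) (x : Fin q → ℝ) :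
    x ⬝ᵥ (Mᵀ * M) *ᵥ x = (M *ᵥ x) ⬝ᵥ (M *ᵥ x) := by
  have := dotProduct_conj_mulVec 1 M x
  simpa using this

/-- The sequence `s` with `a` put in front. -/
def consSeq {α : Type*} (a : α) (s : ℕ → α) : ℕ → α
  | 0 => a
  | t + 1 => s t

theorem consSeq_zero {α : Type*} (a : α) (s : ℕ → α) : consSeq a s 0 = a := rfl

theorem consSeq_succ {α : Type*} (a : α) (s : ℕ → α) (t : ℕ) : consSeq a s (t + 1) = s t := rfl

/-- The iterates are finite-horizon values, attained by some disturbance. -/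
theorem exists_trajectory_iter {k : ℕ} (hgap : ∀ j < k, (gap D g (iter F D (Hᵀ * H) g j)).PosDef)
    (hs : ∀ j < k, (iter F D (Hᵀ * H) g j)ᵀ = iter F D (Hᵀ * H) g j) (y : Fin m → ℝ) :
    ∃ (x : ℕ → Fin m → ℝ) (w : ℕ → Fin n → ℝ), x 0 = y ∧
      (∀ t, x (t + 1) = F *ᵥ x t + D *ᵥ w t) ∧
      y ⬝ᵥ iter F D (Hᵀ * H) g k *ᵥ y =
        ∑ t ∈ Finset.range k, ((H *ᵥ x t) ⬝ᵥ (H *ᵥ x t) - g * (w t ⬝ᵥ w t)) := by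
  induction k generalizing y with
  | zero =>
    refine ⟨fun t => F ^ t *ᵥ y, fun _ => 0, by simp, fun t => ?_, by simp [iter]⟩
    simp [pow_succ']
  | succ k ih =>
    set P := iter F D (Hᵀ * H) g k with hP
    set w₀ := gain D g P *ᵥ (F *ᵥ y) with hw₀
    obtain ⟨x, w, hx0, hdyn, hval⟩ := ih (fun j hj => hgap j (by omega))
      (fun j hj => hs j (by omega)) (F *ᵥ y + D *ᵥ w₀)
    refine ⟨consSeq y x, consSeq w₀ w, rfl, ?_, ?_⟩
    · rintro (_ | t)
      · exact hx0
      · exact hdyn t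
    · rw [Finset.sum_range_succ']
      simp only [consSeq_zero, consSeq_succ]
      rw [← hval, iter_succ, ric, Matrix.add_mulVec, dotProduct_add, dotProduct_conj_mulVec,
        dotProduct_gram_mulVec]
      have := complete_square_vec (hs k (by omega)) (gap_isUnit (hgap k (by omega))) (F *ᵥ y) w₀
      rw [← hw₀, sub_self, zero_dotProduct] at this
      linarith

theorem exists_stabilizing_of_hInfNorm_lt {γ : ℝ} (hF : IsSchurStable F)
    (hG : hInfNorm (transferFunction F D H) < ENNReal.ofReal γ) :
    ∃ P, P.PosSemidef ∧ (gap D (γ ^ 2) P).PosDef ∧ ric F D (Hᵀ * H) (γ ^ 2) P = P ∧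
      IsSchurStable (amp D (γ ^ 2) P * F) := by
  obtain ⟨c, g₁, hc, hg₁, hlt, hen⟩ := energy_bound hF hG
  -- The iteration runs at a level g strictly inside (g₁, γ²): the distance g − g₁ is the uniform
  -- margin of the gaps, and γ² − g is the slack that gives stability.
  obtain ⟨g, hg1, hg2⟩ := exists_between hlt
  have hQ : (Hᵀ * H).PosSemidef := Matrix.posSemidef_transpose_mul_self H
  have hS₀ : ((g - g₁) • (1 : Matrix (Fin n) (Fin n) ℝ)).PosDef :=
    Matrix.PosDef.one.smul (sub_pos.2 hg1)
  have hww : ∀ (w : ℕ → Fin n → ℝ) N, 0 ≤ ∑ t ∈ Finset.range N, w t ⬝ᵥ w t := fun w N =>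
    Finset.sum_nonneg fun t _ => Finset.sum_nonneg fun i _ => mul_self_nonneg _
  have key : ∀ k, (∀ j < k + 1, (iter F D (Hᵀ * H) g j).PosSemidef ∧
      (gap D g (iter F D (Hᵀ * H) g j) - (g - g₁) • 1).PosSemidef) := by
    intro k
    induction k with
    | zero =>
      intro j hj
      obtain rfl : j = 0 := by omega
      refine ⟨Matrix.PosSemidef.zero, ?_⟩
      have : gap D g (iter F D (Hᵀ * H) g 0) - (g - g₁) • 1 =
          g₁ • (1 : Matrix (Fin n) (Fin n) ℝ) := by
        simp [gap, iter, sub_smul]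
      rw [this]
      exact Matrix.PosSemidef.one.smul hg₁
    | succ k ih =>
      have hgap : ∀ j < k + 1, (gap D g (iter F D (Hᵀ * H) g j)).PosDef := fun j hj => by
        simpa using hS₀.add_posSemidef (ih j hj).2
      have hpsd : (iter F D (Hᵀ * H) g (k + 1)).PosSemidef := by
        rw [iter_succ]
        exact ric_posSemidef hQ (ih k (by omega)).1 (hgap k (by omega))
      intro j hj
      rcases Nat.lt_succ_iff_lt_or_eq.1 hj with h | rfl
      · exact ih j h
      refine ⟨hpsd, ?_⟩
      rw [Matrix.posSemidef_real_iff]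
      refine ⟨?_, fun v => ?_⟩
      · rw [Matrix.transpose_sub, gap_isSymm hpsd.isSymm]; simp
      obtain ⟨x, w, hx0, hdyn, hval⟩ := exists_trajectory_iter hgap
        (fun j hj => (ih j hj).1.isSymm) (D *ᵥ v)
      -- The trajectory from D v is preceded by one step from rest with disturbance v. The
      -- initial-state term disappears from the energy inequality, which leaves DᵀPD ≤ g₁ I for the
      -- next iterate P.
      have h1 := hen (consSeq 0 x) (consSeq v w) (by
        rintro (_ | t)
        · simpa only [consSeq_zero, consSeq_succ, Matrix.mulVec_zero, zero_add] using hx0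
        · exact hdyn t) (k + 2)
      rw [Finset.sum_range_succ', Finset.sum_range_succ' _ (k + 1)] at h1
      simp only [consSeq_zero, consSeq_succ, Matrix.mulVec_zero, dotProduct_zero, mul_zero, add_zero, zero_add] at h1
      rw [Finset.sum_sub_distrib, ← Finset.mul_sum] at hval
      have h2 : v ⬝ᵥ (gap D g (iter F D (Hᵀ * H) g (k + 1)) - (g - g₁) • 1) *ᵥ v =
          g₁ * (v ⬝ᵥ v) - (D *ᵥ v) ⬝ᵥ iter F D (Hᵀ * H) g (k + 1) *ᵥ (D *ᵥ v) := by
        rw [gap, Matrix.sub_mulVec, Matrix.sub_mulVec, dotProduct_sub, dotProduct_sub,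
          dotProduct_conj_mulVec, Matrix.smul_mulVec, Matrix.smul_mulVec]
        simp only [Matrix.one_mulVec, dotProduct_smul, smul_eq_mul]
        ring
      rw [h2, hval]
      nlinarith [hww w (k + 1)]
  have hgap : ∀ j, (gap D g (iter F D (Hᵀ * H) g j)).PosDef := fun j => by
    simpa using hS₀.add_posSemidef (key j j (by omega)).2
  have hB : ∀ k, (c • 1 - iter F D (Hᵀ * H) g k).PosSemidef := by
    intro k
    have hs := fun j => (key j j (by omega)).1.isSymm
    rw [Matrix.posSemidef_real_iff]
    refine ⟨by rw [Matrix.transpose_sub, hs]; simp, fun y => ?_⟩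
    obtain ⟨x, w, hx0, hdyn, hval⟩ := exists_trajectory_iter (k := k) (fun j _ => hgap j)
        (fun j _ => hs j) y
    have h1 := hen x w hdyn k
    rw [Finset.sum_sub_distrib, ← Finset.mul_sum] at hval
    rw [Matrix.sub_mulVec, dotProduct_sub, hval, Matrix.smul_mulVec, Matrix.one_mulVec,
      dotProduct_smul, smul_eq_mul, ← hx0]
    nlinarith [hww w k]
  obtain ⟨P', -, hP', hgP', hric⟩ := exists_solution hQ hS₀ (fun k => (key k k (by omega)).2) hB
  exact exists_stabilizing_of_slack hF hQ hg2 hP' hgP' hric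

end GameRiccati

/-! ### Stable systems with bounded or vanishing input. -/

section BoundedResponse

attribute [local instance] Matrix.normedAddCommGroup

variable {m p q : ℕ}

theorem Matrix.sup_norm_mul_le (A : Matrix (Fin p) (Fin m) ℝ) (B : Matrix (Fin m) (Fin q) ℝ) :
    ‖A * B‖ ≤ m * ‖A‖ * ‖B‖ := by
  rw [Matrix.norm_le_iff (by positivity)]
  intro i j
  rw [Matrix.mul_apply]
  calc ‖∑ k, A i k * B k j‖ ≤ ∑ k, ‖A i k * B k j‖ := norm_sum_le _ _
    _ ≤ ∑ _k : Fin m, ‖A‖ * ‖B‖ := Finset.sum_le_sum fun k _ => by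
        rw [norm_mul]
        exact mul_le_mul (Matrix.norm_entry_le_entrywise_sup_norm A)
          (Matrix.norm_entry_le_entrywise_sup_norm B) (norm_nonneg _) (norm_nonneg _)
    _ = _ := by simp [mul_assoc]

theorem IsSchurStable.exists_bounded_response {F : Matrix (Fin m) (Fin m) ℝ}
    (hF : IsSchurStable F) {X V : ℕ → Matrix (Fin m) (Fin p) ℝ}
    (hX : ∀ t, X (t + 1) = F * X t + V t) {β : ℝ} (hV : ∀ t, ‖V t‖ ≤ β) :
    ∃ b, ∀ t, ‖X t‖ ≤ b := by
  obtain ⟨c, r, hc, hr0, hr1, hb⟩ := hF.exists_pow_bound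
  have hpow : ∀ k, m * ‖F ^ k‖ ≤ (m * c) * r ^ k := by
    intro k
    rw [mul_assoc]
    refine mul_le_mul_of_nonneg_left ?_ (Nat.cast_nonneg m)
    rw [Matrix.norm_le_iff (by positivity)]
    exact hb k
  set C := (m : ℝ) * c with hC
  have hC0 : 0 ≤ C := by positivity
  have hβ : 0 ≤ β := (norm_nonneg _).trans (hV 0)
  set a := max (C * ‖X 0‖) (C * β / (1 - r)) with ha
  have hr : 0 < 1 - r := by linarith
  -- The bound is proved for all Fᵏ X t at once, since F itself need not contract the norm. The
  -- choice of a makes a r + Cβ ≤ a, which closes the induction.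
  have key : ∀ t k, ‖F ^ k * X t‖ ≤ a * r ^ k := by
    intro t
    induction t with
    | zero =>
      intro k
      refine (Matrix.sup_norm_mul_le _ _).trans ?_
      calc m * ‖F ^ k‖ * ‖X 0‖ ≤ (C * r ^ k) * ‖X 0‖ :=
            mul_le_mul_of_nonneg_right (hpow k) (norm_nonneg _)
        _ = (C * ‖X 0‖) * r ^ k := by ring
        _ ≤ a * r ^ k := mul_le_mul_of_nonneg_right (le_max_left _ _) (by positivity)
    | succ t ih =>
      intro k
      have h1 : F ^ k * X (t + 1) = F ^ (k + 1) * X t + F ^ k * V t := by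
        rw [hX, Matrix.mul_add, ← Matrix.mul_assoc, pow_succ]
      have h2 : C * β ≤ a * (1 - r) := by
        rw [← div_le_iff₀ hr]; exact le_max_right _ _
      rw [h1]
      refine (norm_add_le _ _).trans ?_
      have h3 : ‖F ^ k * V t‖ ≤ C * r ^ k * β :=
        (Matrix.sup_norm_mul_le _ _).trans
          (mul_le_mul (hpow k) (hV t) (norm_nonneg _) (by positivity))
      have h4 := ih (k + 1)
      have h5 : (C * β) * r ^ k ≤ (a * (1 - r)) * r ^ k :=
        mul_le_mul_of_nonneg_right h2 (by positivity)
      rw [pow_succ r] at h4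
      nlinarith
  exact ⟨a, fun t => by simpa using key t 0⟩

theorem IsSchurStable.tendsto_response_transpose_mul {F : Matrix (Fin m) (Fin m) ℝ}
    (hF : IsSchurStable F) {X V : ℕ → Matrix (Fin m) (Fin p) ℝ}
    (hX : ∀ t, X (t + 1) = F * X t + V t) (hV : Tendsto V atTop (𝓝 0))
    {Z : ℕ → Matrix (Fin m) (Fin q) ℝ} (hZ : Tendsto Z atTop (𝓝 0)) :
    Tendsto (fun t => (X t)ᵀ * Z t) atTop (𝓝 0) := by
  obtain ⟨β, hβ⟩ := hV.norm.bddAbove_range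
  obtain ⟨b, hb⟩ := hF.exists_bounded_response hX fun t => hβ ⟨t, rfl⟩
  refine squeeze_zero_norm (a := fun t => m * b * ‖Z t‖) (fun t => ?_) ?_
  · refine (Matrix.sup_norm_mul_le _ _).trans ?_
    rw [Matrix.norm_transpose]
    gcongr
    exact hb t
  · simpa using hZ.norm.const_mul (m * b)

end BoundedResponse

/-! ### Riccati equation of a gain: uniqueness, comparison and saddle inequality. -/

namespace MixedDesign

open GameRiccati

variable {m d n l : ℕ} (S : MixedDesign m d n l)

/-- The output weight `Cᵀ C + Kᵀ R K` of the closed loop. -/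
def weight (K : Matrix (Fin d) (Fin m) ℝ) : Matrix (Fin m) (Fin m) ℝ :=
  S.Cᵀ * S.C + Kᵀ * S.R * K

/-- The weight `R + Bᵀ P̃ B` on the control increments. -/
noncomputable def ctrlWeight (P : Matrix (Fin m) (Fin m) ℝ) : Matrix (Fin d) (Fin d) ℝ :=
  S.R + S.Bᵀ * S.tilde P * S.B

/-- `R K - Bᵀ P̃ (A - B K)`, which vanishes when `K` is optimal against `P`. -/
noncomputable def residual (K : Matrix (Fin d) (Fin m) ℝ) (P : Matrix (Fin m) (Fin m) ℝ) :
    Matrix (Fin d) (Fin m) ℝ :=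
  S.R * K - S.Bᵀ * S.tilde P * S.closedLoop K

/-- The right-hand side of the Riccati equation. -/
noncomputable def ric (K : Matrix (Fin d) (Fin m) ℝ) (P : Matrix (Fin m) (Fin m) ℝ) :
    Matrix (Fin m) (Fin m) ℝ :=
  GameRiccati.ric (S.closedLoop K) S.D (S.weight K) (S.γ ^ 2) P

variable {S} {K K' : Matrix (Fin d) (Fin m) ℝ} {P P' : Matrix (Fin m) (Fin m) ℝ}

theorem tilde_eq (P : Matrix (Fin m) (Fin m) ℝ) :
    S.tilde P = GameRiccati.tilde S.D (S.γ ^ 2) P := rfl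

theorem R_isSymm : S.Rᵀ = S.R := by simp [R]

theorem R_posSemidef : S.R.PosSemidef := Matrix.posSemidef_transpose_mul_self S.E

theorem gap_iff (hγ : 0 < S.γ) : (1 - (S.γ ^ 2)⁻¹ • (S.Dᵀ * P * S.D)).PosDef ↔
    (gap S.D (S.γ ^ 2) P).PosDef := by
  have h2 : (0 : ℝ) < S.γ ^ 2 := by positivity
  have e : gap S.D (S.γ ^ 2) P = S.γ ^ 2 • (1 - (S.γ ^ 2)⁻¹ • (S.Dᵀ * P * S.D)) := by
    rw [gap, smul_sub, smul_smul, mul_inv_cancel₀ h2.ne', one_smul]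
  constructor
  · intro h; rw [e]; exact h.smul h2
  · intro h
    have := h.smul (inv_pos.2 h2)
    rwa [e, smul_smul, inv_mul_cancel₀ h2.ne', one_smul] at this

theorem worstLoop_eq (hγ : 0 < S.γ) (hP : Pᵀ = P) (h : (gap S.D (S.γ ^ 2) P).PosDef) :
    S.worstLoop K P = amp S.D (S.γ ^ 2) P * S.closedLoop K := by
  have h2 : S.γ ^ 2 ≠ 0 := by positivity
  rw [worstLoop, inv_one_sub h2 (gap_isUnit h), ← amp_transpose hP, Matrix.transpose_transpose]

theorem stabilizing_iff (hγ : 0 < S.γ) : S.IsStabilizingSolution K P ↔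
    P.PosSemidef ∧ (gap S.D (S.γ ^ 2) P).PosDef ∧ S.ric K P = P ∧
      IsSchurStable (amp S.D (S.γ ^ 2) P * S.closedLoop K) := by
  have hr : (S.closedLoop K)ᵀ * S.tilde P * S.closedLoop K + S.Cᵀ * S.C + Kᵀ * S.R * K - P = 0 ↔
      S.ric K P = P := by
    rw [sub_eq_zero, add_assoc]; rfl
  constructor
  · intro h
    have hg := (gap_iff hγ).1 h.gap
    refine ⟨h.posSemidef, hg, hr.1 h.riccati, ?_⟩
    rw [← worstLoop_eq hγ h.posSemidef.isSymm hg]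
    exact h.stable
  · rintro ⟨h1, h2, h3, h4⟩
    refine ⟨h1, hr.2 h3, (gap_iff hγ).2 h2, ?_⟩
    rwa [worstLoop_eq hγ h1.isSymm h2]

theorem exists_stabilizing (hγ : 0 < S.γ) (hEC : S.Eᵀ * S.C = 0) (hK : K ∈ S.feasible) :
    ∃ P, S.IsStabilizingSolution K P := by
  obtain ⟨P, h1, h2, h3, h4⟩ := exists_stabilizing_of_hInfNorm_lt hK.1 hK.2
  refine ⟨P, (stabilizing_iff hγ).2 ⟨h1, h2, ?_, h4⟩⟩
  rw [S.output_weight hEC] at h3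
  exact h3

/-- By `tilde_sub_tilde` the difference Y of two solutions satisfies Y = MᵀYM', where M and M' are
their worst-case loops, both stable. -/
theorem stabilizing_unique (hγ : 0 < S.γ) (h : S.IsStabilizingSolution K P)
    (h' : S.IsStabilizingSolution K P') : P = P' := by
  obtain ⟨h1, h2, h3, h4⟩ := (stabilizing_iff hγ).1 h
  obtain ⟨h1', h2', h3', h4'⟩ := (stabilizing_iff hγ).1 h'
  rw [← sub_eq_zero]
  refine eq_zero_of_stein h4 h4' ?_
  nth_rewrite 1 [← h3, ← h3']
  have := tilde_sub_tilde h1.isSymm (gap_isUnit h2) (gap_isUnit h2')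
  rw [Matrix.transpose_mul, Matrix.mul_assoc _ᵀ, Matrix.mul_assoc _ᵀ,
    show (amp S.D (S.γ ^ 2) P)ᵀ * (P - P') * (amp S.D (S.γ ^ 2) P' * S.closedLoop K) =
      ((amp S.D (S.γ ^ 2) P)ᵀ * (P - P') * amp S.D (S.γ ^ 2) P') * S.closedLoop K by
      simp only [Matrix.mul_assoc], ← this]
  simp [ric, GameRiccati.ric, Matrix.sub_mul, Matrix.mul_sub, Matrix.mul_assoc]

theorem riccatiSol_spec (hγ : 0 < S.γ) (hEC : S.Eᵀ * S.C = 0) (hK : K ∈ S.feasible) :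
    S.IsStabilizingSolution K (S.riccatiSol K) := by
  have h := exists_stabilizing hγ hEC hK
  rw [riccatiSol, dif_pos h]
  exact h.choose_spec

/-- The stabilizing solution lies below every supersolution. -/
theorem stabilizing_le (hγ : 0 < S.γ) (h : S.IsStabilizingSolution K P) (hP' : P'ᵀ = P')
    (hg' : (gap S.D (S.γ ^ 2) P').PosDef) (hsup : (P' - S.ric K P').PosSemidef) :
    (P' - P).PosSemidef := by
  obtain ⟨h1, h2, h3, h4⟩ := (stabilizing_iff hγ).1 h
  -- Only the worst-case loop of the stabilizing solution P has to be stable; nothing is required of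
  -- the loop of P'.
  refine posSemidef_of_stein h4 ?_
  have e := (tilde_sub_tilde_ge hP' h1.isSymm hg' (gap_isUnit h2)).transpose_mul_mul_same
    (S.closedLoop K)
  convert hsup.add e using 1
  nth_rewrite 1 [← h3]
  simp only [ric, GameRiccati.ric, Matrix.sub_mul, Matrix.mul_sub, Matrix.mul_assoc,
    Matrix.transpose_mul]
  abel

/-- An exact second-order expansion in the gain with P frozen: `residual` plays the role of the
gradient and `ctrlWeight` that of the Hessian. -/
theorem ric_sub_ric (hP : Pᵀ = P) (K K' : Matrix (Fin d) (Fin m) ℝ) :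
    S.ric K' P - S.ric K P = (K' - K)ᵀ * S.residual K P + (S.residual K P)ᵀ * (K' - K)
      + (K' - K)ᵀ * S.ctrlWeight P * (K' - K) := by
  obtain ⟨Δ, rfl⟩ : ∃ Δ, K' = K + Δ := ⟨K' - K, by abel⟩
  have hT : (S.tilde P)ᵀ = S.tilde P := tilde_isSymm hP
  have hcl : S.closedLoop (K + Δ) = S.closedLoop K - S.B * Δ := by
    simp [closedLoop, Matrix.mul_add]; abel
  rw [add_sub_cancel_left]
  simp only [ric, GameRiccati.ric, hcl, ← tilde_eq, weight, residual, ctrlWeight,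
    Matrix.transpose_sub, Matrix.transpose_mul, Matrix.transpose_add, hT, R_isSymm,
    Matrix.transpose_transpose, Matrix.sub_mul, Matrix.mul_sub, Matrix.add_mul, Matrix.mul_add,
    Matrix.mul_assoc]
  abel

theorem ctrlWeight_posDef (hR : S.R.PosDef) (hP : P.PosSemidef)
    (hg : (gap S.D (S.γ ^ 2) P).PosDef) : (S.ctrlWeight P).PosDef :=
  hR.add_posSemidef ((tilde_posSemidef hg hP).transpose_mul_mul_same S.B)

theorem residual_eq (K : Matrix (Fin d) (Fin m) ℝ) (P : Matrix (Fin m) (Fin m) ℝ) :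
    S.residual K P = S.ctrlWeight P * K - S.Bᵀ * S.tilde P * S.A := by
  simp only [residual, ctrlWeight, closedLoop, Matrix.mul_sub, Matrix.add_mul, Matrix.mul_assoc]
  abel

/-- The gain `(R + Bᵀ P̃ B)⁻¹ Bᵀ P̃ A` that is optimal against `P`. -/
noncomputable def optGain (S : MixedDesign m d n l) (P : Matrix (Fin m) (Fin m) ℝ) :
    Matrix (Fin d) (Fin m) ℝ :=
  (S.ctrlWeight P)⁻¹ * S.Bᵀ * S.tilde P * S.A

theorem sub_optGain (hH : (S.ctrlWeight P).PosDef) (K : Matrix (Fin d) (Fin m) ℝ) :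
    K - S.optGain P = (S.ctrlWeight P)⁻¹ * S.residual K P := by
  rw [residual_eq, Matrix.mul_sub, ← Matrix.mul_assoc,
    Matrix.nonsing_inv_mul _ ((Matrix.isUnit_iff_isUnit_det _).1 hH.isUnit), Matrix.one_mul]
  simp [optGain, Matrix.mul_assoc]

theorem hasOptimalForm_of_residual (hH : (S.ctrlWeight (S.riccatiSol K)).PosDef)
    (h : S.residual K (S.riccatiSol K) = 0) : S.HasOptimalForm K := by
  have := sub_optGain hH K
  rw [h, Matrix.mul_zero, sub_eq_zero] at this
  exact this

theorem residual_optGain (hH : (S.ctrlWeight P).PosDef) : S.residual (S.optGain P) P = 0 := by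
  rw [residual_eq, optGain, ← Matrix.mul_assoc, ← Matrix.mul_assoc, ← Matrix.mul_assoc,
    Matrix.mul_nonsing_inv _ ((Matrix.isUnit_iff_isUnit_det _).1 hH.isUnit), Matrix.one_mul,
    sub_self]

/-- A Newton step damped by s: the linear part contributes −2s and the quadratic part s². -/
theorem ric_step (hP : Pᵀ = P) (hH : (S.ctrlWeight P).PosDef) (K : Matrix (Fin d) (Fin m) ℝ)
    (s : ℝ) : S.ric (K - s • ((S.ctrlWeight P)⁻¹ * S.residual K P)) P =
      S.ric K P - (2 * s - s ^ 2) •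
        ((S.residual K P)ᵀ * (S.ctrlWeight P)⁻¹ * S.residual K P) := by
  have h := ric_sub_ric (S := S) hP K (K - s • ((S.ctrlWeight P)⁻¹ * S.residual K P))
  rw [sub_eq_iff_eq_add] at h
  rw [h, sub_sub_cancel_left]
  have hu := (Matrix.isUnit_iff_isUnit_det _).1 hH.isUnit
  have hs : ((S.ctrlWeight P)⁻¹)ᵀ = (S.ctrlWeight P)⁻¹ := hH.inv.isSymm
  have e : ∀ Z : Matrix (Fin d) (Fin m) ℝ, S.ctrlWeight P * ((S.ctrlWeight P)⁻¹ * Z) = Z :=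
    fun Z => by rw [← Matrix.mul_assoc, Matrix.mul_nonsing_inv _ hu, Matrix.one_mul]
  simp only [Matrix.transpose_neg, Matrix.transpose_smul, Matrix.transpose_mul, hs,
    Matrix.neg_mul, Matrix.mul_neg, Matrix.smul_mul, Matrix.mul_smul, Matrix.mul_assoc, e]
  module

theorem tilde_eq_mul_amp (P : Matrix (Fin m) (Fin m) ℝ) :
    S.tilde P = P * amp S.D (S.γ ^ 2) P := by
  simp [tilde_eq, GameRiccati.tilde, amp, gain, Matrix.mul_add, Matrix.mul_assoc]

/-- Open-loop saddle inequality: against the worst disturbance generated by `(K, P)`, started in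
directions along which `K` is optimal, no other gain does better. -/
theorem saddle (hγ : 0 < S.γ) (h : S.IsStabilizingSolution K P)
    (h' : S.IsStabilizingSolution K' P') (hst : IsSchurStable (S.closedLoop K')) {p : ℕ}
    (X₀ : Matrix (Fin m) (Fin p) ℝ)
    (hE : ∀ k, S.residual K P * ((amp S.D (S.γ ^ 2) P * S.closedLoop K) ^ k * X₀) = 0) :
    (X₀ᵀ * (P' - P) * X₀).PosSemidef := by
  obtain ⟨h1, h2, h3, h4⟩ := (stabilizing_iff hγ).1 h
  obtain ⟨h1', h2', h3', -⟩ := (stabilizing_iff hγ).1 h'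
  set M := amp S.D (S.γ ^ 2) P * S.closedLoop K with hM
  set g := S.γ ^ 2
  set X : ℕ → Matrix (Fin m) (Fin p) ℝ := fun t => M ^ t * X₀ with hX
  -- The worst disturbance for K is recorded as an open-loop signal and fed unchanged to the loop of
  -- K'. Columns carry several initial states at once.
  set W : ℕ → Matrix (Fin n) (Fin p) ℝ := fun t => gain S.D g P * (S.closedLoop K * X t) with hW
  set X' : ℕ → Matrix (Fin m) (Fin p) ℝ := fun t =>
    Nat.rec X₀ (fun t Y => S.closedLoop K' * Y + S.D * W t) t with hX'
  have hXs : ∀ t, X (t + 1) = amp S.D g P * (S.closedLoop K * X t) := fun t => by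
    simp only [hX, pow_succ', hM, Matrix.mul_assoc]
  have hXs' : ∀ t, X (t + 1) = S.closedLoop K * X t + S.D * W t := fun t => by
    rw [hXs, amp, Matrix.add_mul, Matrix.one_mul, Matrix.mul_assoc]
  have hX's : ∀ t, X' (t + 1) = S.closedLoop K' * X' t + S.D * W t := fun t => rfl
  -- Stationarity in the control; together with `hcost`, the adjoint recursion, it makes P X the
  -- costate.
  have hEX : ∀ t, S.R * (K * X t) = S.Bᵀ * (P * X (t + 1)) := by
    intro t
    have := hE t
    rw [residual, Matrix.sub_mul, sub_eq_zero, tilde_eq_mul_amp] at this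
    rw [hXs]
    simpa only [Matrix.mul_assoc, hX] using this
  have hcost : ∀ t, P * X t = S.Aᵀ * (P * X (t + 1)) + S.Cᵀ * (S.C * X t) := by
    intro t
    have e : P * X t = S.ric K P * X t := by rw [h3]
    have hTF : ∀ Z : Matrix (Fin m) (Fin p) ℝ, GameRiccati.tilde S.D g P * Z =
        P * (amp S.D g P * Z) := fun Z => by
      rw [← tilde_eq, tilde_eq_mul_amp, Matrix.mul_assoc]
    change _ = ((S.closedLoop K)ᵀ * GameRiccati.tilde S.D g P * S.closedLoop K +
      (S.Cᵀ * S.C + Kᵀ * S.R * K)) * X t at e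
    simp only [Matrix.add_mul, Matrix.mul_assoc, hTF, ← hXs, hEX] at e
    rw [e]
    simp only [closedLoop, Matrix.transpose_sub, Matrix.transpose_mul, Matrix.sub_mul,
      Matrix.mul_assoc]
    abel
  -- Subtracting the costate pairing `dt` and its transpose removes the first-order terms in X' − X.
  -- The decrement of Z is then a sum of three squares: the loss of W against the disturbance
  -- optimal for P', the output difference and the control difference.
  set dt : ℕ → Matrix (Fin p) (Fin p) ℝ := fun t => (X' t - X t)ᵀ * (P * X t) with hdt
  set Z : ℕ → Matrix (Fin p) (Fin p) ℝ := fun t =>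
    (X' t)ᵀ * P' * X' t - (X t)ᵀ * P * X t - dt t - (dt t)ᵀ with hZ
  have hstep : ∀ t, (Z t - Z (t + 1)).PosSemidef := by
    intro t
    have e1 : (X (t + 1))ᵀ * P * X (t + 1) = (X t)ᵀ * P * X t - (X t)ᵀ * S.weight K * X t
        + g • ((W t)ᵀ * W t) := by
      have := complete_square_gain h1.isSymm (gap_isUnit h2) (S.closedLoop K * X t)
      rw [← hXs, sub_eq_iff_eq_add] at this
      rw [this]
      have e : (X t)ᵀ * P * X t = (X t)ᵀ * S.ric K P * X t := by rw [h3]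
      rw [e, ric, GameRiccati.ric]
      simp only [Matrix.mul_add, Matrix.add_mul, Matrix.transpose_mul, Matrix.mul_assoc, hW]
      abel
    have e2 := complete_square h1'.isSymm (gap_isUnit h2') (S.closedLoop K' * X' t) (W t)
    rw [← hX's, sub_eq_iff_eq_add] at e2
    have e3 : (X' t)ᵀ * P' * X' t = (X' t)ᵀ * S.ric K' P' * X' t := by rw [h3']
    set N := W t - gain S.D g P' * (S.closedLoop K' * X' t) with hN
    have hNpsd : (Nᵀ * gap S.D g P' * N).PosSemidef := h2'.posSemidef.transpose_mul_mul_same N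
    have hq1 := Matrix.posSemidef_transpose_mul_self (S.C * (X' t - X t))
    have hq2 := (R_posSemidef (S := S)).transpose_mul_mul_same (K' * X' t - K * X t)
    have e4 : X' (t + 1) - X (t + 1) =
        S.A * (X' t - X t) - S.B * (K' * X' t - K * X t) := by
      rw [hX's, hXs']
      simp only [closedLoop, Matrix.sub_mul, Matrix.mul_sub, Matrix.mul_assoc]
      abel
    have e5 : dt t - dt (t + 1) = (X' t - X t)ᵀ * (S.Cᵀ * (S.C * X t)) +
        (K' * X' t - K * X t)ᵀ * (S.R * (K * X t)) := by
      simp only [hdt]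
      rw [e4, hcost t, hEX]
      simp only [Matrix.transpose_sub, Matrix.transpose_mul, Matrix.sub_mul, Matrix.mul_sub,
        Matrix.mul_add, Matrix.mul_assoc]
      abel
    have e6 : Z t - Z (t + 1) = Nᵀ * gap S.D g P' * N +
        (S.C * (X' t - X t))ᵀ * (S.C * (X' t - X t)) +
        (K' * X' t - K * X t)ᵀ * S.R * (K' * X' t - K * X t) := by
      have e7 : Z t - Z (t + 1) = ((X' t)ᵀ * P' * X' t - (X' (t + 1))ᵀ * P' * X' (t + 1))
          - ((X t)ᵀ * P * X t - (X (t + 1))ᵀ * P * X (t + 1))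
          - (dt t - dt (t + 1)) - (dt t - dt (t + 1))ᵀ := by
        simp only [hZ, Matrix.transpose_sub]; abel
      rw [e7, e5, e1, e2, e3]
      simp only [ric, GameRiccati.ric, weight, Matrix.transpose_sub, Matrix.transpose_mul,
        Matrix.transpose_add, Matrix.transpose_transpose, Matrix.sub_mul, Matrix.mul_sub,
        Matrix.mul_add, Matrix.add_mul, Matrix.mul_assoc, R_isSymm]
      abel
    rw [e6]
    exact (hNpsd.add hq1).add hq2
  have hZ0 : Z 0 = X₀ᵀ * (P' - P) * X₀ := by
    have e1 : X 0 = X₀ := by simp [hX]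
    have e2 : X' 0 = X₀ := rfl
    simp only [hZ, hdt, e1, e2, sub_self, Matrix.transpose_zero, Matrix.zero_mul, sub_zero]
    simp [Matrix.mul_sub, Matrix.sub_mul]
  have hmono : ∀ t, (Z 0 - Z t).PosSemidef := by
    intro t
    induction t with
    | zero => simpa using Matrix.PosSemidef.zero
    | succ t ih => simpa using ih.add (hstep t)
  have hlow : ∀ t, (Z 0 + ((X t)ᵀ * P * X t + dt t + (dt t)ᵀ)).PosSemidef := by
    intro t
    convert (hmono t).add (h1'.transpose_mul_mul_same (X' t)) using 1
    simp only [hZ]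
    abel
  have hXlim : Tendsto X atTop (𝓝 0) := by
    have hc : Continuous fun Y : Matrix (Fin m) (Fin m) ℝ => Y * X₀ := by fun_prop
    have := (hc.tendsto 0).comp h4.tendsto_pow
    simpa only [Function.comp_def, Matrix.zero_mul] using this
  have hPX : Tendsto (fun t => P * X t) atTop (𝓝 0) := by
    have hc : Continuous fun Y : Matrix (Fin m) (Fin p) ℝ => P * Y := by fun_prop
    simpa only [Function.comp_def, Matrix.mul_zero] using (hc.tendsto 0).comp hXlim
  -- X' stays bounded since K' is stabilizing and its input vanishes at infinity, while P X tends to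
  -- 0. Convergence of X' is not needed.
  have hdlim : Tendsto dt atTop (𝓝 0) := by
    have hV : Tendsto (fun t => S.D * W t) atTop (𝓝 0) := by
      have hc : Continuous fun Y : Matrix (Fin m) (Fin p) ℝ =>
        S.D * (gain S.D g P * (S.closedLoop K * Y)) := by fun_prop
      simpa only [Function.comp_def, Matrix.mul_zero] using (hc.tendsto 0).comp hXlim
    have h5 := hst.tendsto_response_transpose_mul hX's hV hPX
    have h6 : Tendsto (fun t => (X t)ᵀ * (P * X t)) atTop (𝓝 0) := by
      have hc : Continuous fun Y : Matrix (Fin m) (Fin p) ℝ => Yᵀ * (P * Y) := by fun_prop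
      simpa only [Function.comp_def, Matrix.mul_zero] using (hc.tendsto 0).comp hXlim
    simpa only [hdt, Matrix.transpose_sub, Matrix.sub_mul, sub_zero] using h5.sub h6
  rw [← hZ0]
  have hlim : Tendsto (fun t => Z 0 + ((X t)ᵀ * P * X t + dt t + (dt t)ᵀ)) atTop (𝓝 (Z 0)) := by
    have hc : Continuous fun Y : Matrix (Fin m) (Fin p) ℝ × Matrix (Fin p) (Fin p) ℝ =>
        Z 0 + (Y.1ᵀ * P * Y.1 + Y.2 + Y.2ᵀ) := by fun_prop
    have := (hc.tendsto (0, 0)).comp (hXlim.prodMk_nhds hdlim)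
    simpa [Function.comp_def] using this
  exact Matrix.isClosed_posSemidef.mem_of_tendsto hlim (Eventually.of_forall hlow)

end MixedDesign

/-! ### Cauchy–Schwarz, trace and determinant estimates. -/

namespace Matrix

section PosSemidefEstimates

variable {ι : Type*} [Fintype ι]

theorem PosSemidef.sq_dotProduct_le {P : Matrix ι ι ℝ} (hP : P.PosSemidef) (x y : ι → ℝ) :
    (x ⬝ᵥ P *ᵥ y) ^ 2 ≤ (x ⬝ᵥ P *ᵥ x) * (y ⬝ᵥ P *ᵥ y) := by
  have hs : y ⬝ᵥ P *ᵥ x = x ⬝ᵥ P *ᵥ y := by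
    rw [dotProduct_mulVec, ← mulVec_transpose, hP.isSymm, dotProduct_comm]
  have h : ∀ t : ℝ, 0 ≤ (y ⬝ᵥ P *ᵥ y) * (t * t) + (2 * (x ⬝ᵥ P *ᵥ y)) * t + x ⬝ᵥ P *ᵥ x := by
    intro t
    have := (posSemidef_real_iff.1 hP).2 (x + t • y)
    simp only [mulVec_add, mulVec_smul, dotProduct_add, add_dotProduct, smul_dotProduct,
      dotProduct_smul, smul_eq_mul, hs] at this
    linarith
  have := discrim_le_zero h
  unfold discrim at this
  linarith

variable [DecidableEq ι]

theorem PosSemidef.abs_apply_le_trace {V : Matrix ι ι ℝ} (hV : V.PosSemidef) (i j : ι) :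
    |V i j| ≤ V.trace := by
  have hd : ∀ k, 0 ≤ V k k := fun k => hV.diag_nonneg
  have ht : ∀ k, V k k ≤ V.trace := fun k =>
    Finset.single_le_sum (f := fun k => V k k) (fun k _ => hd k) (Finset.mem_univ k)
  have h := hV.sq_dotProduct_le (Pi.single i 1) (Pi.single j 1)
  simp only [mulVec_single_one, single_one_dotProduct, col_apply] at h
  refine abs_le_of_sq_le_sq ?_ hV.trace_nonneg
  nlinarith [hd i, hd j, ht i, ht j, hV.trace_nonneg]

theorem PosSemidef.one_add_trace_le_det {V : Matrix ι ι ℝ} (hV : V.PosSemidef) :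
    1 + V.trace ≤ (1 + V).det := by
  -- For −V the characteristic polynomial at 1 is exactly det(1 + V).
  have hN : (-V).IsHermitian := hV.isHermitian.neg
  have e1 : (1 + V).det = ∏ i, (1 - hN.eigenvalues i) := by
    have h := congrArg (Polynomial.eval 1) hN.charpoly_eq
    rw [eval_charpoly, Polynomial.eval_prod] at h
    simpa using h
  have e2 : V.trace = ∑ i, -hN.eigenvalues i := by
    have h := hN.trace_eq_sum_eigenvalues
    rw [trace_neg] at h
    rw [Finset.sum_neg_distrib, eq_comm, neg_eq_iff_eq_neg, h]
    simp
  have h0 : ∀ i, hN.eigenvalues i ≤ 0 := by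
    intro i
    rw [hN.eigenvalues_eq, neg_mulVec, dotProduct_neg]
    have := hV.re_dotProduct_nonneg (hN.eigenvectorBasis i : ι → ℝ)
    simpa using this
  rw [e1, e2]
  have key : ∀ s : Finset ι, 1 + ∑ i ∈ s, -hN.eigenvalues i ≤ ∏ i ∈ s, (1 - hN.eigenvalues i) ∧
      0 ≤ ∑ i ∈ s, -hN.eigenvalues i := by
    intro s
    induction s using Finset.induction_on with
    | empty => simp
    | insert a s ha ih =>
      rw [Finset.sum_insert ha, Finset.prod_insert ha]
      constructor <;> nlinarith [h0 a, ih.1, ih.2]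
  exact (key _).1

open scoped MatrixOrder ComplexOrder in
theorem PosDef.exists_factor {M : Matrix ι ι ℝ} (hM : M.PosDef) :
    ∃ G : Matrix ι ι ℝ, IsUnit G.det ∧ M = Gᵀ * G := by
  obtain ⟨G, rfl⟩ := CStarAlgebra.nonneg_iff_eq_star_mul_self.mp hM.posSemidef.nonneg
  refine ⟨G, ?_, by simp [star_eq_conjTranspose]⟩
  have := (isUnit_iff_isUnit_det _).1 hM.isUnit
  rw [det_mul] at this
  exact isUnit_of_mul_isUnit_right this

theorem one_add_trace_le_det_div {G W : Matrix ι ι ℝ} (hG : IsUnit G.det) (hW : W.PosSemidef) :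
    1 + ((G⁻¹)ᵀ * W * G⁻¹).trace ≤ (Gᵀ * G + W).det / (Gᵀ * G).det := by
  have h1 := (hW.transpose_mul_mul_same G⁻¹).one_add_trace_le_det
  refine h1.trans_eq ?_
  have h2 : Gᵀ * G + W = Gᵀ * (1 + (G⁻¹)ᵀ * W * G⁻¹) * G := by
    have e1 : G⁻¹ * G = 1 := nonsing_inv_mul _ hG
    have e2 : Gᵀ * (G⁻¹)ᵀ = 1 := by rw [← transpose_mul, e1, transpose_one]
    have e3 : Gᵀ * (1 + (G⁻¹)ᵀ * W * G⁻¹) * G = Gᵀ * G + (Gᵀ * (G⁻¹)ᵀ) * W * (G⁻¹ * G) := by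
      simp only [Matrix.mul_add, Matrix.add_mul, Matrix.mul_assoc, Matrix.mul_one]
    rw [e3, e1, e2]; simp
  rw [h2, det_mul, det_mul, det_mul, eq_div_iff (mul_ne_zero (by simpa using hG.ne_zero) hG.ne_zero)]
  ring

theorem eq_factor_mul {G W : Matrix ι ι ℝ} (hG : IsUnit G.det) :
    W = Gᵀ * ((G⁻¹)ᵀ * W * G⁻¹) * G := by
  have e1 : G⁻¹ * G = 1 := nonsing_inv_mul _ hG
  have e2 : Gᵀ * (G⁻¹)ᵀ = 1 := by rw [← transpose_mul, e1, transpose_one]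
  calc W = (Gᵀ * (G⁻¹)ᵀ) * W * (G⁻¹ * G) := by rw [e1, e2]; simp
    _ = _ := by simp only [Matrix.mul_assoc]

end PosSemidefEstimates

end Matrix

/-! ### The cost function and openness of the feasible set along lines. -/

namespace MixedDesign

open GameRiccati

variable {m d n l : ℕ} {S : MixedDesign m d n l}
  {K K' : Matrix (Fin d) (Fin m) ℝ} {P P' : Matrix (Fin m) (Fin m) ℝ}

theorem cost_eq (hγ : 0 < S.γ) (K : Matrix (Fin d) (Fin m) ℝ) :
    S.cost K = -S.γ ^ 2 * Real.log (((S.γ ^ 2)⁻¹) ^ n * (gap S.D (S.γ ^ 2) (S.riccatiSol K)).det) := by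
  rw [cost, det_one_sub (by positivity), Matrix.det_smul, Fintype.card_fin]

theorem exp_cost_sub (hγ : 0 < S.γ) (h : (gap S.D (S.γ ^ 2) (S.riccatiSol K)).PosDef)
    (h' : (gap S.D (S.γ ^ 2) (S.riccatiSol K')).PosDef) :
    Real.exp ((S.cost K - S.cost K') / S.γ ^ 2) =
      (gap S.D (S.γ ^ 2) (S.riccatiSol K')).det / (gap S.D (S.γ ^ 2) (S.riccatiSol K)).det := by
  have hc : 0 < ((S.γ ^ 2)⁻¹) ^ n := by positivity
  have h2 : S.γ ^ 2 ≠ 0 := by positivity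
  rw [cost_eq hγ, cost_eq hγ, Real.log_mul hc.ne' h.det_pos.ne', Real.log_mul hc.ne' h'.det_pos.ne',
    ← Real.exp_log h'.det_pos, ← Real.exp_log h.det_pos, ← Real.exp_sub, Real.log_exp, Real.log_exp]
  congr 1
  field_simp
  ring

/-- The cost difference is the logarithm of a ratio of gap determinants. After G normalizes the gap
of K to the identity, det(1 + V) ≥ 1 + tr V makes this scalar control the whole positive
semidefinite matrix V. -/
theorem one_add_trace_le_exp (hγ : 0 < S.γ) (h : (gap S.D (S.γ ^ 2) (S.riccatiSol K)).PosDef)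
    (h' : (gap S.D (S.γ ^ 2) (S.riccatiSol K')).PosDef) {G : Matrix (Fin n) (Fin n) ℝ}
    (hG : IsUnit G.det) (hGG : gap S.D (S.γ ^ 2) (S.riccatiSol K) = Gᵀ * G)
    (hW : (S.Dᵀ * (S.riccatiSol K - S.riccatiSol K') * S.D).PosSemidef) :
    1 + ((G⁻¹)ᵀ * (S.Dᵀ * (S.riccatiSol K - S.riccatiSol K') * S.D) * G⁻¹).trace ≤
      Real.exp ((S.cost K - S.cost K') / S.γ ^ 2) := by
  refine (Matrix.one_add_trace_le_det_div hG hW).trans_eq ?_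
  rw [exp_cost_sub hγ h h', ← gap_sub_gap, hGG]
  simp

theorem cost_le (hγ : 0 < S.γ) (h : (gap S.D (S.γ ^ 2) (S.riccatiSol K)).PosDef)
    (h' : (gap S.D (S.γ ^ 2) (S.riccatiSol K')).PosDef)
    (hW : (S.Dᵀ * (S.riccatiSol K - S.riccatiSol K') * S.D).PosSemidef) :
    S.cost K' ≤ S.cost K := by
  obtain ⟨G, hG, hGG⟩ := h.exists_factor
  have h1 := one_add_trace_le_exp hγ h h' hG hGG hW
  have h2 := (hW.transpose_mul_mul_same G⁻¹).trace_nonneg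
  have h3 : 0 ≤ (S.cost K - S.cost K') / S.γ ^ 2 := Real.one_le_exp_iff.1 (by linarith)
  have h4 := mul_nonneg h3 (sq_nonneg S.γ)
  rw [div_mul_cancel₀ _ (by positivity)] at h4
  linarith

/-- The equality case: without a strict drop of the cost the normalized difference has trace 0, and
being positive semidefinite it vanishes. -/
theorem eq_zero_of_cost_le (hγ : 0 < S.γ) (h : (gap S.D (S.γ ^ 2) (S.riccatiSol K)).PosDef)
    (h' : (gap S.D (S.γ ^ 2) (S.riccatiSol K')).PosDef)
    (hW : (S.Dᵀ * (S.riccatiSol K - S.riccatiSol K') * S.D).PosSemidef)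
    (hc : S.cost K ≤ S.cost K') : S.Dᵀ * (S.riccatiSol K - S.riccatiSol K') * S.D = 0 := by
  obtain ⟨G, hG, hGG⟩ := h.exists_factor
  have h1 := one_add_trace_le_exp hγ h h' hG hGG hW
  have hV := hW.transpose_mul_mul_same G⁻¹
  have h3 : Real.exp ((S.cost K - S.cost K') / S.γ ^ 2) ≤ 1 :=
    Real.exp_le_one_iff.2 (div_nonpos_of_nonpos_of_nonneg (by linarith) (sq_nonneg _))
  have h2 := hV.trace_eq_zero_iff.1 (le_antisymm (by linarith) hV.trace_nonneg)
  rw [Matrix.eq_factor_mul (W := S.Dᵀ * (S.riccatiSol K - S.riccatiSol K') * S.D) hG, h2]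
  simp

section Openness

open scoped Matrix.Norms.L2Operator

theorem continuousAt_transferFunction {F : ℝ → Matrix (Fin m) (Fin m) ℝ}
    {H : ℝ → Matrix (Fin l) (Fin m) ℝ} (hF : Continuous F) (hH : Continuous H)
    (D : Matrix (Fin m) (Fin n) ℝ) {s : ℝ} (hs : IsSchurStable (F s)) (θ : ℝ) :
    ContinuousAt (fun Z : ℝ × ℝ =>
      transferFunction (F Z.1) D (H Z.1) (Complex.exp (Z.2 * Complex.I))) (s, θ) := by
  have h1 : ContinuousAt (fun Z : ℝ × ℝ => (Complex.exp (Z.2 * Complex.I) •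
      (1 : Matrix (Fin m) (Fin m) ℂ) - toComplex (F Z.1))⁻¹) (s, θ) :=
    ContinuousAt.comp (f := fun Z : ℝ × ℝ => (Complex.exp (Z.2 * Complex.I), F Z.1))
      (continuousAt_resolvent (hs.isUnit_det (by rw [Complex.norm_exp_ofReal_mul_I])))
      (by fun_prop)
  have h2 : ContinuousAt (fun Z : ℝ × ℝ => toComplex (H Z.1)) (s, θ) :=
    (continuous_toComplex.comp (hH.comp continuous_fst)).continuousAt
  have h3 : Continuous fun Y : Matrix (Fin l) (Fin m) ℂ × Matrix (Fin m) (Fin m) ℂ =>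
      Y.1 * Y.2 * toComplex D := by fun_prop
  exact ContinuousAt.comp (f := fun Z : ℝ × ℝ => (toComplex (H Z.1), (Complex.exp (Z.2 * Complex.I) •
      (1 : Matrix (Fin m) (Fin m) ℂ) - toComplex (F Z.1))⁻¹)) h3.continuousAt (h2.prodMk h1)

theorem eventually_feasible (hK : K ∈ S.feasible) (Δ : Matrix (Fin d) (Fin m) ℝ) :
    ∀ᶠ s in 𝓝 (0 : ℝ), K - s • Δ ∈ S.feasible := by
  obtain ⟨hst, hnorm⟩ := hK
  have hF : Continuous fun s : ℝ => S.closedLoop (K - s • Δ) := by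
    unfold closedLoop; fun_prop
  have hH : Continuous fun s : ℝ => S.C - S.E * (K - s • Δ) := by fun_prop
  have h1 : ∀ᶠ s in 𝓝 (0 : ℝ), IsSchurStable (S.closedLoop (K - s • Δ)) :=
    hF.continuousAt.eventually_mem (isOpen_isSchurStable.mem_nhds (by simpa using hst))
  obtain ⟨g₀, hg0, hgγ, hb⟩ := exists_bound_of_hInfNorm_lt hnorm
  obtain ⟨g, hg, hg'⟩ := exists_between hgγ
  -- The norm is a supremum over a half-open interval; periodicity closes it, so that compactness
  -- makes the estimate uniform in θ.
  have hb' : ∀ θ ∈ Set.Icc (0 : ℝ) (2 * Real.pi),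
      ‖S.closedLoopTransfer K (Complex.exp (θ * Complex.I))‖ ≤ g₀ := by
    intro θ hθ
    rcases hθ.2.lt_or_eq with h | rfl
    · exact hb θ ⟨hθ.1, h⟩
    · have := hb 0 ⟨le_rfl, by positivity⟩
      simpa [Complex.exp_two_pi_mul_I] using this
  have h2 : ∀ᶠ s in 𝓝 (0 : ℝ), ∀ θ ∈ Set.Icc (0 : ℝ) (2 * Real.pi),
      ‖S.closedLoopTransfer (K - s • Δ) (Complex.exp (θ * Complex.I))‖ < g := by
    refine isCompact_Icc.eventually_forall_of_forall_eventually fun θ hθ => ?_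
    have hc := (continuousAt_transferFunction hF hH S.D (s := 0) (by simpa using hst) θ).norm
    refine hc.eventually_lt_const ?_
    have := (hb' θ hθ).trans_lt hg
    simpa [closedLoopTransfer] using this
  filter_upwards [h1, h2] with s hs1 hs2
  refine ⟨hs1, ?_⟩
  have hlt : ENNReal.ofReal g < ENNReal.ofReal S.γ :=
    (ENNReal.ofReal_lt_ofReal_iff (hg0.trans_lt hgγ)).2 hg'
  refine lt_of_le_of_lt (iSup₂_le fun θ hθ => ?_) hlt
  rw [← ofReal_norm]
  exact ENNReal.ofReal_le_ofReal (hs2 θ ⟨hθ.1, hθ.2.le⟩).le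

end Openness

end MixedDesign

/-! ### First-order conditions and their sufficiency. -/

namespace MixedDesign

open GameRiccati

variable {m d n l : ℕ} {S : MixedDesign m d n l}
  {K K' : Matrix (Fin d) (Fin m) ℝ} {P P' : Matrix (Fin m) (Fin m) ℝ}

section Gradient

variable (hγ : 0 < S.γ) (hEC : S.Eᵀ * S.C = 0) (hR : S.R.PosDef)

/-- The direction of descent `H⁻¹ (R K - Bᵀ P̃ (A - B K))`. -/
noncomputable def descent (S : MixedDesign m d n l) (K : Matrix (Fin d) (Fin m) ℝ) :
    Matrix (Fin d) (Fin m) ℝ :=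
  (S.ctrlWeight (S.riccatiSol K))⁻¹ * S.residual K (S.riccatiSol K)

/-- The first-order decrease of the Riccati solution along `descent`. -/
noncomputable def decrease (S : MixedDesign m d n l) (K : Matrix (Fin d) (Fin m) ℝ) :
    Matrix (Fin m) (Fin m) ℝ :=
  (S.residual K (S.riccatiSol K))ᵀ * (S.ctrlWeight (S.riccatiSol K))⁻¹ *
    S.residual K (S.riccatiSol K)

include hγ hEC

theorem sol_posSemidef (hK : K ∈ S.feasible) : (S.riccatiSol K).PosSemidef :=
  (riccatiSol_spec hγ hEC hK).posSemidef

theorem sol_gap (hK : K ∈ S.feasible) : (gap S.D (S.γ ^ 2) (S.riccatiSol K)).PosDef :=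
  (gap_iff hγ).1 (riccatiSol_spec hγ hEC hK).gap

theorem sol_ric (hK : K ∈ S.feasible) : S.ric K (S.riccatiSol K) = S.riccatiSol K :=
  ((stabilizing_iff hγ).1 (riccatiSol_spec hγ hEC hK)).2.2.1

include hR

theorem sol_ctrlWeight (hK : K ∈ S.feasible) : (S.ctrlWeight (S.riccatiSol K)).PosDef :=
  ctrlWeight_posDef hR (sol_posSemidef hγ hEC hK) (sol_gap hγ hEC hK)

theorem decrease_posSemidef (hK : K ∈ S.feasible) : (S.decrease K).PosSemidef :=
  (sol_ctrlWeight hγ hEC hR hK).inv.posSemidef.transpose_mul_mul_same _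

theorem ric_descent (hK : K ∈ S.feasible) (s : ℝ) :
    S.ric (K - s • S.descent K) (S.riccatiSol K) =
      S.riccatiSol K - (2 * s - s ^ 2) • S.decrease K := by
  rw [descent, ric_step (sol_posSemidef hγ hEC hK).isSymm (sol_ctrlWeight hγ hEC hR hK),
    sol_ric hγ hEC hK]
  rfl

theorem sol_descent_le (hK : K ∈ S.feasible) {s : ℝ} (hs0 : 0 ≤ s) (hs1 : s ≤ 1)
    (hs : K - s • S.descent K ∈ S.feasible) :
    (S.riccatiSol K - S.riccatiSol (K - s • S.descent K)).PosSemidef := by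
  refine stabilizing_le hγ (riccatiSol_spec hγ hEC hs) (sol_posSemidef hγ hEC hK).isSymm
    (sol_gap hγ hEC hK) ?_
  rw [ric_descent hγ hEC hR hK, sub_sub_cancel]
  exact (decrease_posSemidef hγ hEC hR hK).smul (by nlinarith)

/-- The drop Y satisfies Y ≥ s Z + MᵀYM, with Z = `decrease` and M the new worst-case loop.
Unrolling this and keeping the k-th term alone gives the bound. -/
theorem sol_descent_decrease (hK : K ∈ S.feasible) {s : ℝ} (hs0 : 0 ≤ s) (hs1 : s ≤ 1)
    (hs : K - s • S.descent K ∈ S.feasible) (k : ℕ) :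
    (S.riccatiSol K - S.riccatiSol (K - s • S.descent K) -
      s • (((amp S.D (S.γ ^ 2) (S.riccatiSol (K - s • S.descent K)) *
          S.closedLoop (K - s • S.descent K)) ^ k)ᵀ * S.decrease K *
        (amp S.D (S.γ ^ 2) (S.riccatiSol (K - s • S.descent K)) *
          S.closedLoop (K - s • S.descent K)) ^ k)).PosSemidef := by
  have hY := sol_descent_le hγ hEC hR hK hs0 hs1 hs
  have hr := ric_descent hγ hEC hR hK s
  have hZ := decrease_posSemidef hγ hEC hR hK
  set Ks := K - s • S.descent K with hKs
  set Ps := S.riccatiSol Ks with hPs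
  set M := amp S.D (S.γ ^ 2) Ps * S.closedLoop Ks with hM
  have h1 : (S.riccatiSol K - Ps - s • S.decrease K -
      Mᵀ * (S.riccatiSol K - Ps) * M).PosSemidef := by
    have e := (tilde_sub_tilde_ge (sol_posSemidef hγ hEC hK).isSymm
      (sol_posSemidef hγ hEC hs).isSymm (sol_gap hγ hEC hK)
      (gap_isUnit (sol_gap hγ hEC hs))).transpose_mul_mul_same (S.closedLoop Ks)
    -- Of the available factor 2s − s² only s is kept; the rest, s − s², is nonnegative on [0, 1].
    have e2 := hZ.smul (show 0 ≤ s - s ^ 2 by nlinarith)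
    convert e.add e2 using 1
    have h3 : S.riccatiSol K = S.ric Ks (S.riccatiSol K) + (2 * s - s ^ 2) • S.decrease K := by
      rw [hr]; abel
    have h4 : S.riccatiSol K - Ps - s • S.decrease K =
        S.ric Ks (S.riccatiSol K) - S.ric Ks Ps + (s - s ^ 2) • S.decrease K := by
      nth_rewrite 1 [h3]
      rw [sol_ric hγ hEC hs, ← hPs]
      module
    rw [h4]
    simp only [ric, GameRiccati.ric, hM, ← hPs, Matrix.transpose_mul, Matrix.mul_sub,
      Matrix.sub_mul, Matrix.mul_assoc]
    abel
  induction k with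
  | zero =>
    have := h1.add (hY.transpose_mul_mul_same M)
    simpa using this
  | succ k ih =>
    have e := (h1.add (hZ.smul hs0)).add (ih.transpose_mul_mul_same M)
    convert e using 1
    simp only [pow_succ, Matrix.transpose_mul, Matrix.mul_sub, Matrix.sub_mul, Matrix.mul_smul,
      Matrix.smul_mul, Matrix.mul_assoc]
    abel

/-- If `Dᵀ P D` decreases slower than linearly along the descent direction, then `K` is optimal
along all directions reached by the worst-case closed loop. -/
theorem residual_mul_pow_eq_zero (hK : K ∈ S.feasible)
    (hlim : Tendsto (fun s : ℝ => s⁻¹ • (S.Dᵀ * (S.riccatiSol K -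
      S.riccatiSol (K - s • S.descent K)) * S.D)) (𝓝[>] 0) (𝓝 0)) (k : ℕ) :
    S.residual K (S.riccatiSol K) *
      ((amp S.D (S.γ ^ 2) (S.riccatiSol K) * S.closedLoop K) ^ k * S.D) = 0 := by
  have hev : ∀ᶠ s in 𝓝[>] (0 : ℝ), 0 < s ∧ s ≤ 1 ∧ K - s • S.descent K ∈ S.feasible := by
    have h1 : ∀ᶠ s in 𝓝[>] (0 : ℝ), s ∈ Set.Ioc (0 : ℝ) 1 := Ioc_mem_nhdsGT one_pos
    filter_upwards [h1, nhdsWithin_le_nhds (eventually_feasible hK (S.descent K))] with s hs hs'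
    exact ⟨hs.1, hs.2, hs'⟩
  set Y : ℝ → Matrix (Fin m) (Fin m) ℝ := fun s =>
    S.riccatiSol K - S.riccatiSol (K - s • S.descent K) with hYdef
  have hid : Tendsto (fun s : ℝ => s) (𝓝[>] 0) (𝓝 0) := nhdsWithin_le_nhds
  have hDYD : Tendsto (fun s => S.Dᵀ * Y s * S.D) (𝓝[>] 0) (𝓝 0) := by
    have h1 := hid.smul hlim
    rw [smul_zero] at h1
    refine h1.congr' ?_
    filter_upwards [hev] with s hs
    rw [smul_smul, mul_inv_cancel₀ hs.1.ne', one_smul]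
  -- Cauchy–Schwarz gives (YD)ᵢⱼ² ≤ Yᵢᵢ (DᵀYD)ⱼⱼ, and Yᵢᵢ is at most the diagonal entry of P_K
  -- because the new solution is positive semidefinite. Thus DᵀP converges along the ray, with no
  -- continuity of K ↦ P_K required.
  have hYD : Tendsto (fun s => Y s * S.D) (𝓝[>] 0) (𝓝 0) := by
    refine tendsto_pi_nhds.2 fun i => tendsto_pi_nhds.2 fun j => ?_
    have hjj : Tendsto (fun s => Real.sqrt (S.riccatiSol K i i * (S.Dᵀ * Y s * S.D) j j))
        (𝓝[>] 0) (𝓝 0) := by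
      have h1 : Tendsto (fun s => (S.Dᵀ * Y s * S.D) j j) (𝓝[>] 0) (𝓝 0) :=
        tendsto_pi_nhds.1 (tendsto_pi_nhds.1 hDYD j) j
      have h2 := (Real.continuous_sqrt.tendsto _).comp (h1.const_mul (S.riccatiSol K i i))
      simpa [Function.comp_def] using h2
    refine squeeze_zero_norm' ?_ hjj
    filter_upwards [hev] with s hs
    have hY := sol_descent_le hγ hEC hR hK hs.1.le hs.2.1 hs.2.2
    have h1 := hY.sq_dotProduct_le (Pi.single i 1) (S.D.col j)
    have e1 : Pi.single i 1 ⬝ᵥ Y s *ᵥ S.D.col j = (Y s * S.D) i j := by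
      rw [single_one_dotProduct]
      simp [Matrix.mulVec, dotProduct, Matrix.mul_apply]
    have e2 : S.D.col j ⬝ᵥ Y s *ᵥ S.D.col j = (S.Dᵀ * Y s * S.D) j j := by
      rw [Matrix.mul_assoc]
      simp [Matrix.mulVec, dotProduct, Matrix.mul_apply]
    have e3 : Pi.single i 1 ⬝ᵥ Y s *ᵥ Pi.single i 1 = Y s i i := by simp
    rw [show S.riccatiSol K - S.riccatiSol (K - s • S.descent K) = Y s from rfl, e1, e2, e3] at h1
    refine Real.abs_le_sqrt (h1.trans (mul_le_mul_of_nonneg_right ?_ ?_))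
    · have := (sol_posSemidef hγ hEC hs.2.2).diag_nonneg (i := i)
      simp only [hYdef, Matrix.sub_apply]
      linarith
    · exact (hY.transpose_mul_mul_same S.D).diag_nonneg
  have hDP : Tendsto (fun s : ℝ => S.Dᵀ * S.riccatiSol (K - s • S.descent K)) (𝓝[>] 0)
      (𝓝 (S.Dᵀ * S.riccatiSol K)) := by
    have hc : Continuous fun N : Matrix (Fin m) (Fin n) ℝ => S.Dᵀ * S.riccatiSol K - Nᵀ := by
      fun_prop
    have h1 := (hc.tendsto 0).comp hYD
    rw [Matrix.transpose_zero, sub_zero] at h1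
    refine h1.congr' ?_
    filter_upwards [hev] with s hs
    simp only [Function.comp_apply, hYdef, Matrix.transpose_mul, Matrix.transpose_sub,
      (sol_posSemidef hγ hEC hK).isSymm, (sol_posSemidef hγ hEC hs.2.2).isSymm, Matrix.mul_sub]
    abel
  -- `amp` depends on P through DᵀP only.
  have hamp : Tendsto (fun s : ℝ => amp S.D (S.γ ^ 2) (S.riccatiSol (K - s • S.descent K))) (𝓝[>] 0)
      (𝓝 (amp S.D (S.γ ^ 2) (S.riccatiSol K))) := by
    have h1 : ContinuousAt (fun N : Matrix (Fin n) (Fin m) ℝ =>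
        (S.γ ^ 2 • (1 : Matrix (Fin n) (Fin n) ℝ) - N * S.D)⁻¹) (S.Dᵀ * S.riccatiSol K) :=
      ContinuousAt.comp (f := fun N : Matrix (Fin n) (Fin m) ℝ =>
        (S.γ ^ 2 • (1 : Matrix (Fin n) (Fin n) ℝ) - N * S.D))
        (Matrix.continuousAt_nonsing_inv (gap_isUnit (sol_gap hγ hEC hK))) (by fun_prop)
    have h2 : Continuous fun Z : Matrix (Fin n) (Fin n) ℝ × Matrix (Fin n) (Fin m) ℝ =>
        1 + S.D * (Z.1 * Z.2) := by fun_prop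
    have h3 := (h2.tendsto _).comp ((h1.tendsto.comp hDP).prodMk_nhds hDP)
    simpa only [Function.comp_def, amp, gain, gap, Matrix.mul_assoc] using h3
  have hM : Tendsto (fun s : ℝ => amp S.D (S.γ ^ 2) (S.riccatiSol (K - s • S.descent K)) *
      S.closedLoop (K - s • S.descent K)) (𝓝[>] 0)
      (𝓝 (amp S.D (S.γ ^ 2) (S.riccatiSol K) * S.closedLoop K)) := by
    have h1 : Continuous fun s : ℝ => S.closedLoop (K - s • S.descent K) := by
      unfold closedLoop; fun_prop
    have h2 := (h1.tendsto 0).comp hid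
    simp only [zero_smul, sub_zero, Function.comp_def] at h2
    exact hamp.mul h2
  set M := amp S.D (S.γ ^ 2) (S.riccatiSol K) * S.closedLoop K
  -- The bound of `sol_descent_decrease`, compressed by D and divided by s, loses its first term in
  -- the limit.
  have hneg : (-((M ^ k * S.D)ᵀ * S.decrease K * (M ^ k * S.D))).PosSemidef := by
    have hc : Continuous fun N : Matrix (Fin m) (Fin m) ℝ =>
        (N ^ k * S.D)ᵀ * S.decrease K * (N ^ k * S.D) := by fun_prop
    have h1 := hlim.sub ((hc.tendsto _).comp hM)
    rw [zero_sub] at h1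
    refine Matrix.isClosed_posSemidef.mem_of_tendsto h1 ?_
    filter_upwards [hev] with s hs
    have h2 := ((sol_descent_decrease hγ hEC hR hK hs.1.le hs.2.1 hs.2.2 k).transpose_mul_mul_same
      S.D).smul (inv_nonneg.2 hs.1.le)
    refine (congrArg Matrix.PosSemidef ?_).mpr h2
    simp only [Function.comp_apply, Matrix.mul_sub, Matrix.sub_mul, smul_sub, Matrix.mul_smul,
      Matrix.smul_mul, smul_smul, inv_mul_cancel₀ hs.1.ne', one_smul, Matrix.transpose_mul,
      Matrix.mul_assoc]
  have hzero := ((decrease_posSemidef hγ hEC hR hK).transpose_mul_mul_same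
    (M ^ k * S.D)).eq_zero_of_neg hneg
  have hH := sol_ctrlWeight hγ hEC hR hK
  have h3 := hH.inv.posSemidef.mul_eq_zero_of_transpose_mul_mul
    (M := S.residual K (S.riccatiSol K) * (M ^ k * S.D)) (by
      rw [← hzero, decrease]
      simp only [Matrix.transpose_mul, Matrix.mul_assoc])
  have h4 := congrArg (S.ctrlWeight (S.riccatiSol K) * ·) h3
  simpa only [← Matrix.mul_assoc, Matrix.mul_nonsing_inv _
    ((Matrix.isUnit_iff_isUnit_det _).1 hH.isUnit), Matrix.one_mul, Matrix.mul_zero] using h4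

theorem IsGlobalOptimum.residual_mul_pow_eq_zero (hK : S.IsGlobalOptimum K) (k : ℕ) :
    S.residual K (S.riccatiSol K) *
      ((amp S.D (S.γ ^ 2) (S.riccatiSol K) * S.closedLoop K) ^ k * S.D) = 0 := by
  refine MixedDesign.residual_mul_pow_eq_zero hγ hEC hR hK.1 ?_ k
  refine tendsto_const_nhds.congr' ?_
  have h1 : ∀ᶠ s in 𝓝[>] (0 : ℝ), s ∈ Set.Ioc (0 : ℝ) 1 := Ioc_mem_nhdsGT one_pos
  filter_upwards [h1, nhdsWithin_le_nhds (eventually_feasible hK.1 (S.descent K))] with s hs hs'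
  rw [eq_zero_of_cost_le hγ (sol_gap hγ hEC hK.1) (sol_gap hγ hEC hs')
    ((sol_descent_le hγ hEC hR hK.1 hs.1.le hs.2 hs').transpose_mul_mul_same S.D) (hK.2 _ hs'),
    smul_zero]

section
attribute [local instance] Matrix.normedAddCommGroup Matrix.normedSpace

omit hγ hEC hR in
theorem IsStationary.hasDerivAt (hK : S.IsStationary K) (Δ : Matrix (Fin d) (Fin m) ℝ) :
    HasDerivAt (fun s : ℝ => S.cost (K - s • Δ)) 0 0 := by
  have h1 := ((hasDerivAt_id (0 : ℝ)).smul_const Δ).const_sub K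
  have h2 : HasFDerivAt S.cost (0 : Matrix (Fin d) (Fin m) ℝ →L[ℝ] ℝ) (K - (0 : ℝ) • Δ) := by
    rw [zero_smul, sub_zero]; exact hK.2
  exact HasFDerivAt.comp_hasDerivAt (0 : ℝ) h2 h1

end

theorem IsStationary.residual_mul_pow_eq_zero (hK : S.IsStationary K) (k : ℕ) :
    S.residual K (S.riccatiSol K) *
      ((amp S.D (S.γ ^ 2) (S.riccatiSol K) * S.closedLoop K) ^ k * S.D) = 0 := by
  refine MixedDesign.residual_mul_pow_eq_zero hγ hEC hR hK.1 ?_ k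
  obtain ⟨G, hG, hGG⟩ := (sol_gap hγ hEC hK.1).exists_factor
  set W : ℝ → Matrix (Fin n) (Fin n) ℝ := fun s => S.Dᵀ * (S.riccatiSol K -
      S.riccatiSol (K - s • S.descent K)) * S.D with hW
  set V : ℝ → Matrix (Fin n) (Fin n) ℝ := fun s => (G⁻¹)ᵀ * W s * G⁻¹ with hV
  -- The exponential has value 1 and derivative 0 at s = 0, and its excess over 1 dominates tr V s,
  -- hence every entry of V s.
  have hφ : Tendsto (fun s : ℝ => s⁻¹ *
      (Real.exp ((S.cost K - S.cost (K - s • S.descent K)) / S.γ ^ 2) - 1)) (𝓝[>] 0) (𝓝 0) := by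
    have h1 := (((hK.hasDerivAt (S.descent K)).const_sub (S.cost K)).div_const (S.γ ^ 2)).exp
    have h2 := (hasDerivAt_iff_tendsto_slope_zero.1 h1).mono_left
      (nhdsWithin_mono 0 (s := Set.Ioi 0) fun x hx => ne_of_gt hx)
    simpa using h2
  have hVlim : Tendsto (fun s => s⁻¹ • V s) (𝓝[>] 0) (𝓝 0) := by
    refine tendsto_pi_nhds.2 fun i => tendsto_pi_nhds.2 fun j => ?_
    refine squeeze_zero_norm' ?_ hφ
    have h1 : ∀ᶠ s in 𝓝[>] (0 : ℝ), s ∈ Set.Ioc (0 : ℝ) 1 := Ioc_mem_nhdsGT one_pos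
    filter_upwards [h1, nhdsWithin_le_nhds (eventually_feasible hK.1 (S.descent K))] with s hs hs'
    have hWs : (W s).PosSemidef :=
      (sol_descent_le hγ hEC hR hK.1 hs.1.le hs.2 hs').transpose_mul_mul_same S.D
    have h2 := one_add_trace_le_exp hγ (sol_gap hγ hEC hK.1) (sol_gap hγ hEC hs') hG hGG hWs
    have h3 := (hWs.transpose_mul_mul_same G⁻¹).abs_apply_le_trace i j
    rw [Matrix.smul_apply, smul_eq_mul, norm_mul, Real.norm_of_nonneg (inv_nonneg.2 hs.1.le)]
    refine mul_le_mul_of_nonneg_left ?_ (inv_nonneg.2 hs.1.le)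
    rw [Real.norm_eq_abs]
    exact h3.trans (by linarith)
  have hc : Continuous fun N : Matrix (Fin n) (Fin n) ℝ => Gᵀ * N * G := by fun_prop
  have h4 := (hc.tendsto 0).comp hVlim
  simp only [Matrix.mul_zero, Matrix.zero_mul] at h4
  refine h4.congr fun s => ?_
  simp only [Function.comp_apply, Matrix.mul_smul, Matrix.smul_mul]
  rw [← Matrix.eq_factor_mul hG]

omit hR in
-- The saddle inequality with X₀ = D orders DᵀPD, which is all the cost depends on.
theorem isGlobalOptimum_of_residual_mul_pow (hK : K ∈ S.feasible)
    (h : ∀ k : ℕ, S.residual K (S.riccatiSol K) *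
      ((amp S.D (S.γ ^ 2) (S.riccatiSol K) * S.closedLoop K) ^ k * S.D) = 0) :
    S.IsGlobalOptimum K :=
  ⟨hK, fun _ hK' => cost_le hγ (sol_gap hγ hEC hK') (sol_gap hγ hEC hK)
    (saddle hγ (riccatiSol_spec hγ hEC hK) (riccatiSol_spec hγ hEC hK') hK'.1 S.D h)⟩

omit hR in
theorem isMatrixMinimal_of_residual (hK : K ∈ S.feasible)
    (h : S.residual K (S.riccatiSol K) = 0) : S.IsMatrixMinimal K := by
  intro K' hK'
  have := saddle hγ (riccatiSol_spec hγ hEC hK) (riccatiSol_spec hγ hEC hK') hK'.1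
    (1 : Matrix (Fin m) (Fin m) ℝ)
    (fun k => by rw [h, Matrix.zero_mul])
  simpa using this

end Gradient

end MixedDesign

/-! ### Reachable space, feedback invariance and unstable modes. -/

theorem IsControllablePair.eq_zero_of_mul {m n q : ℕ} {F : Matrix (Fin m) (Fin m) ℝ}
    {D : Matrix (Fin m) (Fin n) ℝ} (h : IsControllablePair F D) {N : Matrix (Fin q) (Fin m) ℝ}
    (hN : ∀ k, N * (F ^ k * D) = 0) : N = 0 := by
  set 𝒞 := Matrix.of fun (i : Fin m) (kj : Fin m × Fin n) => (F ^ (kj.1 : ℕ) * D) i kj.2 with h𝒞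
  have hN𝒞 : N * 𝒞 = 0 := by
    ext i kj
    exact congrFun (congrFun (hN kj.1) i) kj.2
  have hr : LinearMap.range 𝒞.mulVecLin = ⊤ := by
    apply Submodule.eq_top_of_finrank_eq
    rw [Module.finrank_fin_fun]
    exact h
  have hz : ∀ x, N *ᵥ x = 0 := by
    intro x
    obtain ⟨c, rfl⟩ := LinearMap.range_eq_top.1 hr x
    rw [Matrix.mulVecLin_apply, Matrix.mulVec_mulVec, hN𝒞, Matrix.zero_mulVec]
  ext i j
  simpa using congrFun (hz (Pi.single j 1)) i

namespace GameRiccati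

variable {m n q : ℕ}

/-- Disturbance feedback does not change which functionals vanish on the reachable space. -/
theorem mul_pow_mul_eq_zero_of_feedback {N : Matrix (Fin q) (Fin m) ℝ}
    {M M' : Matrix (Fin m) (Fin m) ℝ} {D : Matrix (Fin m) (Fin n) ℝ} {L : Matrix (Fin n) (Fin m) ℝ}
    (hM : M' = M + D * L) (hN : ∀ k, N * (M ^ k * D) = 0) (k : ℕ) : N * (M' ^ k * D) = 0 := by
  -- Mixed words MʲM'ᵏD are needed: replacing one M' by M + DL produces either a further M or a
  -- factor N MʲD = 0.
  suffices h : ∀ k j, N * (M ^ j * (M' ^ k * D)) = 0 by simpa using h k 0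
  intro k
  induction k with
  | zero => simpa using hN
  | succ k ih =>
    intro j
    have e : N * (M ^ j * (M' ^ (k + 1) * D)) = N * (M ^ (j + 1) * (M' ^ k * D)) +
        N * (M ^ j * D) * (L * (M' ^ k * D)) := by
      rw [pow_succ' M', pow_succ M]
      nth_rewrite 1 [hM]
      simp only [Matrix.mul_add, Matrix.add_mul, Matrix.mul_assoc]
    rw [e, ih (j + 1), hN, Matrix.zero_mul, add_zero]

/-- The correction P̃ − P involves P only through PD and its transpose. -/
theorem tilde_sub_tilde_of_mul_eq_zero {D : Matrix (Fin m) (Fin n) ℝ} {g : ℝ}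
    {P P' : Matrix (Fin m) (Fin m) ℝ} (hP : Pᵀ = P) (hP' : P'ᵀ = P') (h : (P' - P) * D = 0) :
    tilde D g P' - tilde D g P = P' - P := by
  have e1 : P' * D = P * D := by rwa [Matrix.sub_mul, sub_eq_zero] at h
  have e2 : Dᵀ * P' = Dᵀ * P := by
    have := congrArg Matrix.transpose e1
    simpa only [Matrix.transpose_mul, hP, hP'] using this
  rw [tilde, tilde, gap, gap, Matrix.mul_assoc _ Dᵀ, Matrix.mul_assoc _ Dᵀ P, e2, e1]
  abel

end GameRiccati

namespace MixedDesign

open GameRiccati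

variable {m d n l : ℕ} {S : MixedDesign m d n l}
  {K K' : Matrix (Fin d) (Fin m) ℝ} {P P' : Matrix (Fin m) (Fin m) ℝ}

theorem pow_mul_eq_of_gain_eq (h : ∀ k : ℕ, (K' - K) * (S.closedLoop K ^ k * S.D) = 0) (k : ℕ) :
    S.closedLoop K' ^ k * S.D = S.closedLoop K ^ k * S.D := by
  induction k with
  | zero => simp
  | succ k ih =>
    have e : S.closedLoop K' = S.closedLoop K - S.B * (K' - K) := by
      simp [closedLoop, Matrix.mul_sub]
    rw [pow_succ', Matrix.mul_assoc, ih, e, Matrix.sub_mul, Matrix.mul_assoc S.B, h,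
      Matrix.mul_zero, sub_zero, pow_succ', Matrix.mul_assoc]

/-- Gains that agree on the reachable space have the same transfer function. -/
theorem closedLoopTransfer_eq (hst : IsSchurStable (S.closedLoop K))
    (hst' : IsSchurStable (S.closedLoop K'))
    (h : ∀ k : ℕ, (K' - K) * (S.closedLoop K ^ k * S.D) = 0) {z : ℂ} (hz : ‖z‖ = 1) :
    S.closedLoopTransfer K' z = S.closedLoopTransfer K z := by
  set Δ := K' - K with hΔ
  set F := S.closedLoop K with hF
  set X := (z • (1 : Matrix (Fin m) (Fin m) ℂ) - toComplex F)⁻¹ * toComplex S.D with hX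
  have hsolve : (z • (1 : Matrix (Fin m) (Fin m) ℂ) - toComplex F) * X = toComplex S.D := by
    rw [hX, ← Matrix.mul_assoc, Matrix.mul_nonsing_inv _ (hst.isUnit_det hz.ge), Matrix.one_mul]
  have hFX : toComplex F * X = z • X - toComplex S.D := by
    rw [← hsolve, Matrix.sub_mul, Matrix.smul_mul, Matrix.one_mul]; abel
  -- Since F X = z X − D and Δ kills FᵏD, each F acts as z under Δ. As Fᵏ tends to 0 while |zᵏ| = 1,
  -- ΔX must vanish.
  have hpow : ∀ k : ℕ, toComplex Δ * (toComplex (F ^ k) * X) = z ^ k • (toComplex Δ * X) := by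
    intro k
    induction k with
    | zero => simp [toComplex_one]
    | succ k ih =>
      rw [pow_succ, toComplex_mul, Matrix.mul_assoc, hFX, Matrix.mul_sub, Matrix.mul_sub,
        Matrix.mul_smul, Matrix.mul_smul, ih, ← toComplex_mul, ← toComplex_mul, h, toComplex_zero,
        sub_zero, smul_smul, pow_succ']
  have hΔX : toComplex Δ * X = 0 := by
    have hc : Continuous fun N : Matrix (Fin m) (Fin m) ℝ => toComplex Δ * (toComplex N * X) :=
      continuous_const.matrix_mul (continuous_toComplex.matrix_mul continuous_const)
    have hlim := (hc.tendsto 0).comp hst.tendsto_pow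
    simp only [toComplex_zero, Matrix.zero_mul, Matrix.mul_zero, Function.comp_def, hpow] at hlim
    ext i j
    have h1 := (tendsto_pi_nhds.1 (tendsto_pi_nhds.1 hlim i) j).norm
    simp only [Matrix.smul_apply, norm_smul, norm_pow, hz, one_pow, one_mul, Matrix.zero_apply,
      norm_zero] at h1
    simpa using tendsto_nhds_unique tendsto_const_nhds h1
  have hF' : S.closedLoop K' = F - S.B * Δ := by
    simp [hF, hΔ, closedLoop, Matrix.mul_sub]
  have hsolve' : (z • (1 : Matrix (Fin m) (Fin m) ℂ) - toComplex (S.closedLoop K')) * X =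
      toComplex S.D := by
    rw [hF', toComplex_sub, toComplex_mul, sub_sub_eq_add_sub, add_sub_right_comm, Matrix.add_mul,
      hsolve, Matrix.mul_assoc, hΔX, Matrix.mul_zero, add_zero]
  have hX' : (z • (1 : Matrix (Fin m) (Fin m) ℂ) - toComplex (S.closedLoop K'))⁻¹ *
      toComplex S.D = X := by
    rw [← hsolve', ← Matrix.mul_assoc, Matrix.nonsing_inv_mul _ (hst'.isUnit_det hz.ge),
      Matrix.one_mul]
  have hH : S.C - S.E * K' = (S.C - S.E * K) - S.E * Δ := by
    simp [hΔ, Matrix.mul_sub]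
  rw [closedLoopTransfer, closedLoopTransfer, transferFunction, transferFunction,
    Matrix.mul_assoc, Matrix.mul_assoc, hX', ← hF, ← hX, hH, toComplex_sub, toComplex_mul,
    Matrix.sub_mul, Matrix.mul_assoc, hΔX, Matrix.mul_zero, sub_zero]

theorem feasible_of_gain_eq (hK : K ∈ S.feasible) (hst' : IsSchurStable (S.closedLoop K'))
    (h : ∀ k : ℕ, (K' - K) * (S.closedLoop K ^ k * S.D) = 0) : K' ∈ S.feasible := by
  refine ⟨hst', lt_of_le_of_lt (le_of_eq ?_) hK.2⟩
  unfold hInfNorm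
  simp only [closedLoopTransfer_eq hK.1 hst' h (Complex.norm_exp_ofReal_mul_I _)]

/-- Unstable modes of the closed loop of a supersolution are unobservable and uncontrolled. -/
theorem mode_of_supersolution (hR : S.R.PosDef) (hP : P.PosSemidef)
    (hg : (gap S.D (S.γ ^ 2) P).PosDef) (hsup : (P - S.ric K P).PosSemidef) {μ : ℂ}
    {v : Fin m → ℂ} (he : toComplex (S.closedLoop K) *ᵥ v = μ • v) (hμ : 1 ≤ ‖μ‖) :
    toComplex S.C *ᵥ v = 0 ∧ toComplex K *ᵥ v = 0 ∧ toComplex S.A *ᵥ v = μ • v ∧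
      (‖μ‖ ^ 2 - 1) * hermForm P v = 0 := by
  have h1 := hermForm_nonneg hsup v
  have h2 := hermForm_nonneg ((tilde_sub_self hg hP.isSymm).transpose_mul_mul_same
    (S.closedLoop K)) v
  have h3 := hermForm_nonneg (Matrix.posSemidef_transpose_mul_self S.C) v
  have h4 := hermForm_nonneg ((R_posSemidef (S := S)).transpose_mul_mul_same K) v
  have h5 := hermForm_nonneg hP v
  rw [ric, GameRiccati.ric, weight, hermForm_sub, hermForm_add, hermForm_add] at h1
  rw [Matrix.mul_sub, Matrix.sub_mul, hermForm_sub, hermForm_conj P, he, hermForm_smul_vec] at h2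
  -- The C-term, the K-term and this one are nonnegative, and the supersolution inequality makes
  -- their sum nonpositive, so all three vanish.
  have h6 : 0 ≤ (‖μ‖ ^ 2 - 1) * hermForm P v :=
    mul_nonneg (sub_nonneg.2 (one_le_pow₀ hμ)) h5
  have hC : toComplex S.C *ᵥ v = 0 := toComplex_mulVec_eq_zero_of_gram (by linarith)
  have hRK : hermForm (Kᵀ * S.R * K) v = 0 := by linarith
  have hK : toComplex K *ᵥ v = 0 := by
    rw [hermForm_conj] at hRK
    have h7 := eq_zero_of_hermForm_eq_zero hR.posSemidef hRK
    have h8 := congrArg (toComplex S.R⁻¹ *ᵥ ·) h7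
    simpa only [Matrix.mulVec_mulVec, ← toComplex_mul, ← Matrix.mul_assoc,
      Matrix.nonsing_inv_mul _ ((Matrix.isUnit_iff_isUnit_det _).1 hR.isUnit), Matrix.one_mul,
      Matrix.mulVec_zero] using h8
  refine ⟨hC, hK, ?_, by linarith⟩
  rw [← he, closedLoop, toComplex_sub, toComplex_mul, Matrix.sub_mulVec, ← Matrix.mulVec_mulVec, hK,
    Matrix.mulVec_zero, sub_zero]

/-! ### Uniqueness, policy improvement and policy iteration. -/

section Main

variable (hγ : 0 < S.γ) (hEC : S.Eᵀ * S.C = 0) (hR : S.R.PosDef)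

include hγ hEC hR

/-- The worst-case loop and the nominal loop differ by a disturbance feedback D L, so the same row
vectors annihilate their reachable spaces. -/
theorem IsGlobalOptimum.residual_mul_closedLoop_pow (hK : S.IsGlobalOptimum K) (k : ℕ) :
    S.residual K (S.riccatiSol K) * (S.closedLoop K ^ k * S.D) = 0 := by
  refine mul_pow_mul_eq_zero_of_feedback
    (M := amp S.D (S.γ ^ 2) (S.riccatiSol K) * S.closedLoop K)
    (L := -(gain S.D (S.γ ^ 2) (S.riccatiSol K) * S.closedLoop K)) ?_
    (hK.residual_mul_pow_eq_zero hγ hEC hR) k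
  rw [amp, Matrix.add_mul, Matrix.one_mul, Matrix.mul_neg, Matrix.mul_assoc]
  abel

/-- Equal cost forces Y D = 0 for Y = P' − P ≥ 0, so the Riccati difference collapses to Y = F'ᵀYF'
+ ΔᵀHΔ with Δ = K' − K. Testing on F'ᵏD makes two nonnegative terms sum to 0, which carries Y to the
next power and kills Δ on the reachable space. -/
theorem IsGlobalOptimum.eq_of_residual (hK : S.IsGlobalOptimum K)
    (h0 : S.residual K (S.riccatiSol K) = 0)
    (hctrl : IsControllablePair (S.worstLoop K (S.riccatiSol K)) S.D)
    (hK' : S.IsGlobalOptimum K') : K' = K := by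
  set P := S.riccatiSol K with hPdef
  set P' := S.riccatiSol K' with hP'def
  have hP := sol_posSemidef hγ hEC hK.1
  have hP' := sol_posSemidef hγ hEC hK'.1
  have hg := sol_gap hγ hEC hK.1
  have hH : (S.ctrlWeight P).PosDef := sol_ctrlWeight hγ hEC hR hK.1
  have hY : (P' - P).PosSemidef := isMatrixMinimal_of_residual hγ hEC hK.1 h0 K' hK'.1
  have hYD : (P' - P) * S.D = 0 := hY.mul_eq_zero_of_transpose_mul_mul
    (eq_zero_of_cost_le hγ (sol_gap hγ hEC hK'.1) hg (hY.transpose_mul_mul_same S.D)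
      (hK'.2 K hK.1))
  have ht : S.tilde P' = S.tilde P + (P' - P) := by
    rw [← tilde_sub_tilde_of_mul_eq_zero (g := S.γ ^ 2) hP.isSymm hP'.isSymm hYD, tilde_eq,
      tilde_eq]
    abel
  set F' := S.closedLoop K' with hF'
  have hstein : P' - P = F'ᵀ * (P' - P) * F' + (K' - K)ᵀ * S.ctrlWeight P * (K' - K) := by
    have e1 := ric_sub_ric (S := S) hP.isSymm K K'
    rw [← hPdef, h0, sol_ric hγ hEC hK.1, ← hPdef] at e1
    have e2 := sol_ric hγ hEC hK'.1
    have e3 : S.ric K' P' = S.ric K' P + F'ᵀ * (P' - P) * F' := by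
      simp only [ric, GameRiccati.ric, ← tilde_eq, ht, Matrix.mul_add, Matrix.add_mul, ← hF']
      abel
    rw [← hP'def, e3] at e2
    simp only [Matrix.mul_zero, Matrix.transpose_zero, Matrix.zero_mul, zero_add] at e1
    rw [← e1]
    nth_rewrite 1 [← e2]
    abel
  have key : ∀ k : ℕ, (P' - P) * (F' ^ k * S.D) = 0 ∧ (K' - K) * (F' ^ k * S.D) = 0 := by
    have step : ∀ k : ℕ, (P' - P) * (F' ^ k * S.D) = 0 →
        (P' - P) * (F' ^ (k + 1) * S.D) = 0 ∧ (K' - K) * (F' ^ k * S.D) = 0 := by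
      intro k hk
      set N := F' ^ k * S.D with hN
      have e1 : (F' * N)ᵀ * (P' - P) * (F' * N) +
          ((K' - K) * N)ᵀ * S.ctrlWeight P * ((K' - K) * N) = 0 := by
        have e2 : Nᵀ * ((P' - P) * N) = 0 := by rw [hk, Matrix.mul_zero]
        rw [hstein] at e2
        rw [← e2]
        simp only [Matrix.transpose_mul, Matrix.mul_add, Matrix.add_mul, Matrix.mul_assoc]
      have hp1 := hY.transpose_mul_mul_same (F' * N)
      have hp2 := hH.posSemidef.transpose_mul_mul_same ((K' - K) * N)
      have e3 := hp1.eq_zero_of_neg (by rw [neg_eq_of_add_eq_zero_right e1]; exact hp2)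
      have e4 := hp2.eq_zero_of_neg (by rw [neg_eq_of_add_eq_zero_left e1]; exact hp1)
      refine ⟨?_, ?_⟩
      · rw [pow_succ', Matrix.mul_assoc]
        exact hY.mul_eq_zero_of_transpose_mul_mul e3
      · have e5 := congrArg ((S.ctrlWeight P)⁻¹ * ·)
          (hH.posSemidef.mul_eq_zero_of_transpose_mul_mul e4)
        simpa only [← Matrix.mul_assoc, Matrix.nonsing_inv_mul _
          ((Matrix.isUnit_iff_isUnit_det _).1 hH.isUnit), Matrix.one_mul, Matrix.mul_zero] using e5
    have hall : ∀ k : ℕ, (P' - P) * (F' ^ k * S.D) = 0 := by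
      intro k
      induction k with
      | zero => simpa using hYD
      | succ k ih => exact (step k ih).1
    exact fun k => ⟨hall k, (step k (hall k)).2⟩
  have hF : ∀ k : ℕ, (K' - K) * (S.closedLoop K ^ k * S.D) = 0 := by
    intro k
    rw [pow_mul_eq_of_gain_eq (K := K') (K' := K) (fun k => ?_)]
    · exact (key k).2
    · rw [← neg_sub, Matrix.neg_mul, (key k).2, neg_zero]
  rw [worstLoop_eq hγ hP.isSymm hg] at hctrl
  rw [← sub_eq_zero]
  refine hctrl.eq_zero_of_mul (mul_pow_mul_eq_zero_of_feedback (M := S.closedLoop K)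
    (L := gain S.D (S.γ ^ 2) P * S.closedLoop K) ?_ hF)
  rw [amp, Matrix.add_mul, Matrix.one_mul, Matrix.mul_assoc]

/-- Policy improvement at a global optimum. -/
theorem IsGlobalOptimum.improve (hmode : NoUnobservableUnitCircleMode S.A S.C)
    (hK : S.IsGlobalOptimum K) :
    S.IsGlobalOptimum (S.optGain (S.riccatiSol K)) ∧
      (S.riccatiSol K - S.riccatiSol (S.optGain (S.riccatiSol K))).PosSemidef ∧
      (S.riccatiSol K - S.riccatiSol (S.optGain (S.riccatiSol K))) * S.D = 0 ∧
      ∀ k : ℕ, (S.optGain (S.riccatiSol K) - K) * (S.closedLoop K ^ k * S.D) = 0 := by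
  have hP := sol_posSemidef hγ hEC hK.1
  have hg := sol_gap hγ hEC hK.1
  have hH := sol_ctrlWeight hγ hEC hR hK.1
  have hsub := sub_optGain hH K
  have hK₁ : S.optGain (S.riccatiSol K) = K - (1 : ℝ) • S.descent K := by
    rw [one_smul, descent, ← hsub]; abel
  have hagree : ∀ k : ℕ, (S.optGain (S.riccatiSol K) - K) * (S.closedLoop K ^ k * S.D) = 0 := by
    intro k
    rw [← neg_sub, hsub, Matrix.neg_mul, Matrix.mul_assoc,
      hK.residual_mul_closedLoop_pow hγ hEC hR, Matrix.mul_zero, neg_zero]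
  have hsup : (S.riccatiSol K - S.ric (S.optGain (S.riccatiSol K)) (S.riccatiSol K)).PosSemidef := by
    rw [hK₁, ric_descent hγ hEC hR hK.1, sub_sub_cancel]
    exact (decrease_posSemidef hγ hEC hR hK.1).smul (by norm_num)
  have hst : IsSchurStable (S.closedLoop (S.optGain (S.riccatiSol K))) := by
    rw [isSchurStable_iff]
    intro μ v hv he
    by_contra! hμ
    obtain ⟨hC, -, hA, hform⟩ := mode_of_supersolution hR hP hg hsup he hμ
    rcases hμ.eq_or_lt with h1 | h1
    · exact hv (hmode μ v h1.symm hA hC)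
    -- For |μ| > 1 the form of P vanishes at v. The Riccati equation of the old gain K then gives K
    -- v = 0, so v is also an unstable mode of the old stable loop.
    · have h2 : hermForm (S.riccatiSol K) v = 0 := by
        refine (mul_eq_zero.1 hform).resolve_left (ne_of_gt ?_)
        have := one_lt_pow₀ h1 two_ne_zero
        linarith
      have h3 := hermForm_nonneg ((tilde_posSemidef hg hP).transpose_mul_mul_same
        (S.closedLoop K)) v
      have h4 := hermForm_nonneg (Matrix.posSemidef_transpose_mul_self S.C) v
      have h5 := hermForm_nonneg ((R_posSemidef (S := S)).transpose_mul_mul_same K) v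
      have h6 : hermForm (S.ric K (S.riccatiSol K)) v = 0 := by rw [sol_ric hγ hEC hK.1, h2]
      rw [ric, GameRiccati.ric, weight, hermForm_add, hermForm_add] at h6
      have h7 : hermForm (Kᵀ * S.R * K) v = 0 := by linarith
      rw [hermForm_conj] at h7
      have h8 := congrArg (toComplex S.R⁻¹ *ᵥ ·) (eq_zero_of_hermForm_eq_zero hR.posSemidef h7)
      simp only [Matrix.mulVec_mulVec, ← toComplex_mul, ← Matrix.mul_assoc,
        Matrix.nonsing_inv_mul _ ((Matrix.isUnit_iff_isUnit_det _).1 hR.isUnit), Matrix.one_mul,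
        Matrix.mulVec_zero] at h8
      have h9 : toComplex (S.closedLoop K) *ᵥ v = μ • v := by
        rw [closedLoop, toComplex_sub, toComplex_mul, Matrix.sub_mulVec, ← Matrix.mulVec_mulVec,
          h8, Matrix.mulVec_zero, sub_zero, hA]
      exact absurd ((isSchurStable_iff _).1 hK.1.1 μ v hv h9) (not_lt.2 hμ)
  have hfeas := feasible_of_gain_eq hK.1 hst hagree
  have hle := stabilizing_le hγ (riccatiSol_spec hγ hEC hfeas) hP.isSymm hg hsup
  have hcost := cost_le hγ hg (sol_gap hγ hEC hfeas) (hle.transpose_mul_mul_same S.D)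
  refine ⟨⟨hfeas, fun K' hK' => hcost.trans (hK.2 K' hK')⟩, hle, ?_, hagree⟩
  exact hle.mul_eq_zero_of_transpose_mul_mul (eq_zero_of_cost_le hγ hg (sol_gap hγ hEC hfeas)
    (hle.transpose_mul_mul_same S.D) (hK.2 _ hfeas))

omit hγ hEC hR in
theorem continuousAt_optGain (hg : (gap S.D (S.γ ^ 2) P).PosDef) (hH : (S.ctrlWeight P).PosDef) :
    ContinuousAt S.optGain P := by
  have h1 : ContinuousAt S.tilde P := continuousAt_tilde (gap_isUnit hg)
  have h2 : ContinuousAt (fun T : Matrix (Fin m) (Fin m) ℝ => (S.R + S.Bᵀ * T * S.B)⁻¹)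
      (S.tilde P) :=
    ContinuousAt.comp (f := fun T : Matrix (Fin m) (Fin m) ℝ => S.R + S.Bᵀ * T * S.B)
      (Matrix.continuousAt_nonsing_inv ((Matrix.isUnit_iff_isUnit_det _).1 hH.isUnit))
      (by fun_prop)
  have h3 : Continuous fun Z : Matrix (Fin d) (Fin d) ℝ × Matrix (Fin m) (Fin m) ℝ =>
      Z.1 * S.Bᵀ * Z.2 * S.A := by fun_prop
  exact ContinuousAt.comp (f := fun X => ((S.ctrlWeight X)⁻¹, S.tilde X)) h3.continuousAt
    ((ContinuousAt.comp (f := S.tilde) h2 h1).prodMk h1)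

/-- Policy iteration from a global optimum converges to one of the optimal form. -/
theorem IsGlobalOptimum.exists_optimalForm (hmode : NoUnobservableUnitCircleMode S.A S.C)
    {K₀ : Matrix (Fin d) (Fin m) ℝ} (hK₀ : S.IsGlobalOptimum K₀) :
    ∃ K, S.IsGlobalOptimum K ∧ S.residual K (S.riccatiSol K) = 0 := by
  set κ : ℕ → Matrix (Fin d) (Fin m) ℝ := fun j => (fun K => S.optGain (S.riccatiSol K))^[j] K₀
    with hκ
  have hκs : ∀ j, κ (j + 1) = S.optGain (S.riccatiSol (κ j)) := fun j =>
    Function.iterate_succ_apply' _ _ _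
  have hopt : ∀ j, S.IsGlobalOptimum (κ j) := by
    intro j
    induction j with
    | zero => exact hK₀
    | succ j ih => rw [hκs]; exact (ih.improve hγ hEC hR hmode).1
  have hpsd : ∀ j, (S.riccatiSol (κ j)).PosSemidef := fun j => sol_posSemidef hγ hEC (hopt j).1
  have hagree : ∀ j k : ℕ, (κ j - K₀) * (S.closedLoop K₀ ^ k * S.D) = 0 := by
    intro j
    induction j with
    | zero => intro k; simp [hκ]
    | succ j ih =>
      intro k
      have h1 := ((hopt j).improve hγ hEC hR hmode).2.2.2 k
      rw [← hκs, pow_mul_eq_of_gain_eq ih] at h1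
      have h2 := ih k
      rw [Matrix.sub_mul, sub_eq_zero] at h1 h2 ⊢
      rw [h1, h2]
  have hPD : ∀ j, S.riccatiSol (κ j) * S.D = S.riccatiSol K₀ * S.D := by
    intro j
    induction j with
    | zero => rfl
    | succ j ih =>
      have h1 := ((hopt j).improve hγ hEC hR hmode).2.2.1
      rw [← hκs, Matrix.sub_mul, sub_eq_zero] at h1
      rw [← h1, ih]
  obtain ⟨P, hlim⟩ : ∃ P, Tendsto (fun j => S.riccatiSol (κ j)) atTop (𝓝 P) := by
    obtain ⟨L, hL⟩ := Matrix.exists_tendsto_of_monotone (P := fun j => -S.riccatiSol (κ j))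
      (B := 0) (fun j => by rw [Matrix.transpose_neg, (hpsd j).isSymm])
      (fun j => by
        have h1 := ((hopt j).improve hγ hEC hR hmode).2.1
        rw [← hκs] at h1
        rwa [neg_sub_neg])
      (fun j => by simpa using hpsd j)
    exact ⟨-L, by simpa using hL.neg⟩
  have hP : P.PosSemidef :=
    Matrix.isClosed_posSemidef.mem_of_tendsto hlim (Eventually.of_forall hpsd)
  have hPD' : P * S.D = S.riccatiSol K₀ * S.D := by
    have hc : Continuous fun X : Matrix (Fin m) (Fin m) ℝ => X * S.D := by fun_prop
    have h1 := (hc.tendsto P).comp hlim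
    simp only [Function.comp_def, hPD] at h1
    exact tendsto_nhds_unique h1 tendsto_const_nhds
  -- PD never changes along the iteration, so the limit inherits the gap of the starting point.
  have hg : (gap S.D (S.γ ^ 2) P).PosDef := by
    have h1 := sol_gap hγ hEC hK₀.1
    rwa [gap, Matrix.mul_assoc, ← hPD', ← Matrix.mul_assoc] at h1
  have hH : (S.ctrlWeight P).PosDef := ctrlWeight_posDef hR hP hg
  set K := S.optGain P with hK
  have hKlim : Tendsto (fun j => κ (j + 1)) atTop (𝓝 K) := by
    simp only [hκs]
    exact (continuousAt_optGain hg hH).tendsto.comp hlim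
  have hric : S.ric K P = P := by
    have hc : Continuous fun Z : Matrix (Fin d) (Fin m) ℝ × Matrix (Fin m) (Fin m) ℝ =>
        (S.closedLoop Z.1)ᵀ * Z.2 * S.closedLoop Z.1 + S.weight Z.1 := by
      unfold closedLoop weight; fun_prop
    have hlim' := hlim.comp (tendsto_add_atTop_nat 1)
    have h1 := (hc.tendsto (K, S.tilde P)).comp
      (hKlim.prodMk_nhds ((continuousAt_tilde (gap_isUnit hg)).tendsto.comp hlim'))
    refine tendsto_nhds_unique h1 ?_
    refine hlim'.congr fun j => ?_
    exact (sol_ric hγ hEC (hopt (j + 1)).1).symm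
  -- A limit of stable loops has its eigenvalues in the closed disc; those on the circle would be
  -- unobservable modes of A.
  have hst : IsSchurStable (S.closedLoop K) := by
    rw [isSchurStable_iff]
    intro μ v hv he
    have hc : Continuous fun X : Matrix (Fin d) (Fin m) ℝ => S.closedLoop X := by
      unfold closedLoop; fun_prop
    have h1 : ‖μ‖ ≤ 1 := norm_le_one_of_tendsto (fun j => (hopt (j + 1)).1.1)
      ((hc.tendsto K).comp hKlim) hv he
    refine lt_of_le_of_ne h1 fun h2 => hv ?_
    obtain ⟨hC, -, hA, -⟩ := mode_of_supersolution hR hP hg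
      (by rw [hric, sub_self]; exact Matrix.PosSemidef.zero) he h2.ge
    exact hmode μ v h2 hA hC
  have hfeas : K ∈ S.feasible := by
    refine feasible_of_gain_eq hK₀.1 hst fun k => ?_
    have hc : Continuous fun X : Matrix (Fin d) (Fin m) ℝ =>
        (X - K₀) * (S.closedLoop K₀ ^ k * S.D) := by fun_prop
    have h1 := (hc.tendsto K).comp hKlim
    simp only [Function.comp_def, hagree] at h1
    exact (tendsto_nhds_unique h1 tendsto_const_nhds)
  have hle : (P - S.riccatiSol K).PosSemidef :=
    stabilizing_le hγ (riccatiSol_spec hγ hEC hfeas) hP.isSymm hg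
      (by rw [hric, sub_self]; exact Matrix.PosSemidef.zero)
  have hWeq : S.Dᵀ * (S.riccatiSol K₀ - S.riccatiSol K) * S.D =
      S.Dᵀ * (P - S.riccatiSol K) * S.D := by
    rw [Matrix.mul_assoc, Matrix.mul_assoc, Matrix.sub_mul, Matrix.sub_mul, hPD']
  have hW : (S.Dᵀ * (S.riccatiSol K₀ - S.riccatiSol K) * S.D).PosSemidef := by
    rw [hWeq]; exact hle.transpose_mul_mul_same S.D
  have hcost := cost_le hγ (sol_gap hγ hEC hK₀.1) (sol_gap hγ hEC hfeas) hW
  have hzero := eq_zero_of_cost_le hγ (sol_gap hγ hEC hK₀.1) (sol_gap hγ hEC hfeas) hW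
    (hK₀.2 K hfeas)
  rw [hWeq] at hzero
  have hYD := hle.mul_eq_zero_of_transpose_mul_mul hzero
  -- P solves the Riccati equation of K, but its worst-case loop is not known to be stable. Since (P
  -- − P_K)D = 0, the difference solves a Stein equation for the nominal loop, which is stable.
  have hsol : P = S.riccatiSol K := by
    rw [← sub_eq_zero]
    refine eq_zero_of_stein hst hst ?_
    have e1 := tilde_sub_tilde_of_mul_eq_zero (g := S.γ ^ 2)
      (sol_posSemidef hγ hEC hfeas).isSymm hP.isSymm hYD
    nth_rewrite 1 [← hric, ← sol_ric hγ hEC hfeas]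
    rw [← e1]
    simp only [ric, GameRiccati.ric, Matrix.mul_sub, Matrix.sub_mul]
    abel
  refine ⟨K, ⟨hfeas, fun K' hK' => hcost.trans (hK₀.2 K' hK')⟩, ?_⟩
  rw [← hsol]
  exact residual_optGain hH

end Main

end MixedDesign

/-! ### Assembly of the three claims. -/

theorem proposition3p1 {m d n l : ℕ} (S : MixedDesign m d n l)
    (hγ : 0 < S.γ) (hEC : S.Eᵀ * S.C = 0) (hR : S.R.PosDef) :
    (∀ K ∈ S.feasible, ∃! P, S.IsStabilizingSolution K P) ∧
    (NoUnobservableUnitCircleMode S.A S.C →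
      (∃ K, S.IsGlobalOptimum K) →
      ∃ Kstar, S.IsGlobalOptimum Kstar ∧ S.HasOptimalForm Kstar ∧ S.IsMatrixMinimal Kstar) ∧
    (∀ K, S.IsStationary K →
      IsControllablePair (S.worstLoop K (S.riccatiSol K)) S.D →
      (∀ K', S.IsStationary K' → K' = K) ∧
      S.IsGlobalOptimum K ∧ (∀ K', S.IsGlobalOptimum K' → K' = K) ∧
      S.HasOptimalForm K ∧ S.IsMatrixMinimal K) := by
  refine ⟨fun K hK => ?_, ?_, ?_⟩
  · obtain ⟨P, hP⟩ := MixedDesign.exists_stabilizing hγ hEC hK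
    exact ⟨P, hP, fun P' hP' => MixedDesign.stabilizing_unique hγ hP' hP⟩
  · rintro hmode ⟨K₀, hK₀⟩
    obtain ⟨K, hK, h0⟩ := hK₀.exists_optimalForm hγ hEC hR hmode
    exact ⟨K, hK, MixedDesign.hasOptimalForm_of_residual
      (MixedDesign.sol_ctrlWeight hγ hEC hR hK.1) h0,
      MixedDesign.isMatrixMinimal_of_residual hγ hEC hK.1 h0⟩
  · intro K hK hctrl
    have hglob : ∀ K', S.IsStationary K' → S.IsGlobalOptimum K' := fun K' hK' =>
      MixedDesign.isGlobalOptimum_of_residual_mul_pow hγ hEC hK'.1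
        (hK'.residual_mul_pow_eq_zero hγ hEC hR)
    have h0 : S.residual K (S.riccatiSol K) = 0 := by
      refine hctrl.eq_zero_of_mul fun k => ?_
      rw [MixedDesign.worstLoop_eq hγ (MixedDesign.sol_posSemidef hγ hEC hK.1).isSymm
        (MixedDesign.sol_gap hγ hEC hK.1)]
      exact hK.residual_mul_pow_eq_zero hγ hEC hR k
    have huniq : ∀ K', S.IsGlobalOptimum K' → K' = K := fun K' hK' =>
      (hglob K hK).eq_of_residual hγ hEC hR h0 hctrl hK'
    exact ⟨fun K' hK' => huniq K' (hglob K' hK'), hglob K hK, huniq,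
      MixedDesign.hasOptimalForm_of_residual (MixedDesign.sol_ctrlWeight hγ hEC hR hK.1) h0,
      MixedDesign.isMatrixMinimal_of_residual hγ hEC hK.1 h0⟩
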